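/- Conventions. A model category is a complete and cocomplete closed model category (functoriality of the factorizations is not required), and $\mathsf{ModCat}$ is the $2$-category of model categories, left Quillen functors and natural isomorphisms. For a category $I$ and a pseudo-functor $\omega\colon I\to\mathsf{ModCat}$, a section of $\omega$ is a family of objects $x_i\in\omega(i)$ ($i\in I$) together with morphisms $x_f\colon \omega(f)(x_i)\to x_j$ for all $f\colon i\to j$ in $I$, compatible with the identities and the composition of $I$ through the structure isomorphisms of $\omega$. Sections form a category $\mathsf{Sect}(\omega)$ with objectwise weak equivalences; $\mathsf{Ho}\,\mathsf{Sect}(\omega)$ is its localization at the weak equivalences. The projective model structure on $\mathsf{Sect}(\omega)$, if it exists, is the one in which weak equivalences and fibrations are objectwise. An object $x\in\mathsf{Ho}\,\mathsf{Sect}(\omega)$ is cartesian if for every $f\colon i\to j$ in $I$ the natural morphism $\mathbf{L}\omega(f)(x_i)\to x_j$ in $\mathsf{Ho}\,\omega(j)$ is an isomorphism, and $\mathsf{Ho}\,\mathsf{Sect}(\omega)_{\mathrm{cart}}$ is the full subcategory of cartesian objects. Let $\bigtriangleup$ be the category of the finite ordered sets $[p]=\{0<\dots<p\}$, $p\ge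 0$, and monotone maps, and let $\bigtriangleup_*$ be the category of the pointed ordered sets $[p]_*=[p]\sqcup\{*\}$, $p\geq -1$ ($[-1]=\emptyset$), where $*$ is the base point and the largest element, with monotone pointed maps. There is the inclusion functor $\bigtriangleup\to\bigtriangleup_*$, $[p]\mapsto[p]_*$, and $[-1]_*=\{*\}$ is an initial object of $\bigtriangleup_*$. Proposition. (1) Let $F\colon\bigtriangleup_*\to\mathsf{ModCat}$ be a pseudo-functor, let $F'$ be its restriction to $\bigtriangleup$, and suppose that the projective model structure on $\mathsf{Sect}(F')$ exists. Consider the functor $F([-1]_*)\to\mathsf{Sect}(F')$ which sends $c$ to the section $[p]\mapsto F([-1]_*\to[p]_*)(c)$. Its total left derived functor $\mathsf{Ho}\,F([-1]_*)\to\mathsf{Ho}\,\mathsf{Sect}(F')$ takes values in $\mathsf{Ho}\,\mathsf{Sect}(F')_{\mathrm{cart}}$, and the resulting functor $$\mathsf{Ho}\,F([-1]_*)\to\mathsf{Ho}\,\mathsf{Sect}(F')_{\mathrm{cart}}$$ is an equivalence of categories. (2) Let $F\colon\bigtriangleup\times\bigtriangleup\to\mathsf{ModCat}$ be a pseudo-functor,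 let $F'$ be its composition with the diagonal functor $\bigtriangleup\to\bigtriangleup\times\bigtriangleup$, and suppose that the projective model structures on $\mathsf{Sect}(F)$ and $\mathsf{Sect}(F')$ exist. Then the functor $\mathsf{Ho}\,\mathsf{Sect}(F)\to\mathsf{Ho}\,\mathsf{Sect}(F')$ given by restriction of sections along the diagonal preserves cartesian objects, and the induced functor $$\mathsf{Ho}\,\mathsf{Sect}(F)_{\mathrm{cart}}\to\mathsf{Ho}\,\mathsf{Sect}(F')_{\mathrm{cart}}$$ is an equivalence of categories. -/

import Mathlib

universe v u w' w

set_option linter.checkUnivs false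

namespace HoSect

open CategoryTheory Category Limits HomotopicalAlgebra Bicategory

/-- A (complete and cocomplete) model category, bundled. -/
structure ModCat : Type (max (u + 1) (v + 1)) where
  /-- the underlying category -/
  carrier : Type u
  [category : Category.{v} carrier]
  [model : ModelCategory carrier]
  [hasLimits : HasLimits carrier]
  [hasColimits : HasColimits carrier]

attribute [instance] ModCat.category ModCat.model ModCat.hasLimits ModCat.hasColimits

/-- A left Quillen functor: a left adjoint which preserves cofibrations and
trivial cofibrations. -/
structure LeftQuillenFunctor (C D : ModCat.{v, u}) : Type (max u v) where
  functor : C.carrier ⥤ D.carrier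
  isLeftAdjoint : functor.IsLeftAdjoint
  cofibration_map : ∀ {X Y : C.carrier} (f : X ⟶ Y), Cofibration f → Cofibration (functor.map f)
  weakEquivalence_map : ∀ {X Y : C.carrier} (f : X ⟶ Y), Cofibration f → WeakEquivalence f →
    WeakEquivalence (functor.map f)

namespace LeftQuillenFunctor

/-- The identity left Quillen functor. -/
def id (C : ModCat.{v, u}) : LeftQuillenFunctor C C where
  functor := 𝟭 C.carrier
  isLeftAdjoint := inferInstance
  cofibration_map _ h := h
  weakEquivalence_map _ _ h := h

/-- The composition of left Quillen functors. -/
def comp {C D E : ModCat.{v, u}} (F : LeftQuillenFunctor C D) (G : LeftQuillenFunctor D E) :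
    LeftQuillenFunctor C E where
  functor := F.functor ⋙ G.functor
  isLeftAdjoint :=
    have := F.isLeftAdjoint
    have := G.isLeftAdjoint
    inferInstance
  cofibration_map f hf := G.cofibration_map _ (F.cofibration_map f hf)
  weakEquivalence_map f hf hf' :=
    G.weakEquivalence_map _ (F.cofibration_map f hf) (F.weakEquivalence_map f hf hf')

/-- The `2`-morphisms between left Quillen functors are the natural isomorphisms. -/
instance (C D : ModCat.{v, u}) : Category (LeftQuillenFunctor C D) where
  Hom F G := F.functor ≅ G.functor
  id F := Iso.refl F.functor
  comp e e' := Iso.trans e e'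
  id_comp e := Iso.refl_trans e
  comp_id e := Iso.trans_refl e
  assoc e e' e'' := Iso.trans_assoc e e' e''

/-- Invertible `2`-morphisms are given by natural isomorphisms. -/
def mkIso {C D : ModCat.{v, u}} {F G : LeftQuillenFunctor C D} (e : F.functor ≅ G.functor) :
    F ≅ G where
  hom := e
  inv := e.symm
  hom_inv_id := Iso.self_symm_id e
  inv_hom_id := Iso.symm_self_id e

lemma hom_ext {C D : ModCat.{v, u}} {F G : LeftQuillenFunctor C D} (e e' : F ⟶ G)
    (h : ∀ X, (show F.functor ≅ G.functor from e).hom.app X =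
      (show F.functor ≅ G.functor from e').hom.app X) : e = e' :=
  Iso.ext (NatTrans.ext (funext h))

end LeftQuillenFunctor

/-- The `2`-category of model categories, left Quillen functors and natural isomorphisms. -/
instance : Bicategory ModCat.{v, u} where
  Hom C D := LeftQuillenFunctor C D
  id C := LeftQuillenFunctor.id C
  comp F G := LeftQuillenFunctor.comp F G
  homCategory C D := inferInstance
  whiskerLeft F _ _ η := Functor.isoWhiskerLeft F.functor η
  whiskerRight η H := Functor.isoWhiskerRight η H.functor
  associator F G H :=
    LeftQuillenFunctor.mkIso (Functor.associator F.functor G.functor H.functor)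
  leftUnitor F := LeftQuillenFunctor.mkIso F.functor.leftUnitor
  rightUnitor F := LeftQuillenFunctor.mkIso F.functor.rightUnitor
  whiskerLeft_id F G :=
    LeftQuillenFunctor.hom_ext (F := F.comp G) (G := F.comp G) _ _ fun X => rfl
  whiskerLeft_comp F G _ G' η θ :=
    LeftQuillenFunctor.hom_ext (F := F.comp G) (G := F.comp G') _ _ fun X => rfl
  id_whiskerLeft {C _ F F'} η :=
    LeftQuillenFunctor.hom_ext (F := (LeftQuillenFunctor.id C).comp F)
      (G := (LeftQuillenFunctor.id C).comp F') _ _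
      fun X => ((id_comp _).trans (comp_id _)).symm
  comp_whiskerLeft F G H H' η :=
    LeftQuillenFunctor.hom_ext (F := (F.comp G).comp H) (G := (F.comp G).comp H') _ _
      fun X => ((id_comp _).trans (comp_id _)).symm
  id_whiskerRight F G :=
    LeftQuillenFunctor.hom_ext (F := F.comp G) (G := F.comp G) _ _ fun X => G.functor.map_id _
  comp_whiskerRight {_ _ _ F _ F'} η θ H :=
    LeftQuillenFunctor.hom_ext (F := F.comp H) (G := F'.comp H) _ _
      fun X => H.functor.map_comp _ _
  whiskerRight_id {_ D F F'} η :=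
    LeftQuillenFunctor.hom_ext (F := F.comp (LeftQuillenFunctor.id D))
      (G := F'.comp (LeftQuillenFunctor.id D)) _ _
      fun X => ((id_comp _).trans (comp_id _)).symm
  whiskerRight_comp {_ _ _ _ F F'} η G H :=
    LeftQuillenFunctor.hom_ext (F := F.comp (G.comp H)) (G := F'.comp (G.comp H)) _ _
      fun X => ((id_comp _).trans (comp_id _)).symm
  whisker_assoc F G G' η H :=
    LeftQuillenFunctor.hom_ext (F := (F.comp G).comp H) (G := (F.comp G').comp H) _ _
      fun X => ((id_comp _).trans (comp_id _)).symm
  whisker_exchange {_ _ _ F G H K} η θ :=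
    LeftQuillenFunctor.hom_ext (F := F.comp H) (G := G.comp K) _ _
      fun X => ((show H.functor ≅ K.functor from θ).hom.naturality _).symm
  pentagon F G H K :=
    LeftQuillenFunctor.hom_ext (F := ((F.comp G).comp H).comp K)
      (G := F.comp (G.comp (H.comp K))) _ _ fun X => by
      change K.functor.map (𝟙 _) ≫ 𝟙 _ ≫ 𝟙 _ = 𝟙 _ ≫ 𝟙 _
      simp
  triangle {_ D _} F G :=
    LeftQuillenFunctor.hom_ext (F := (F.comp (LeftQuillenFunctor.id D)).comp G)
      (G := F.comp G) _ _ fun X => by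
      change 𝟙 _ ≫ 𝟙 _ = G.functor.map (𝟙 _)
      simp

namespace ModCat

variable {C D E E' : ModCat.{v, u}}

/-- The functor underlying a left Quillen functor. -/
def functor (F : C ⟶ D) : C.carrier ⥤ D.carrier := LeftQuillenFunctor.functor F

/-- The natural isomorphism underlying a `2`-morphism of `ModCat`. -/
def natIso {F G : C ⟶ D} (η : F ⟶ G) : functor F ≅ functor G := η

@[simp]
lemma natIso_id (F : C ⟶ D) : natIso (𝟙 F) = Iso.refl (functor F) := rfl

@[simp]
lemma natIso_comp {F G H : C ⟶ D} (η : F ⟶ G) (θ : G ⟶ H) :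
    natIso (η ≫ θ) = natIso η ≪≫ natIso θ := rfl

lemma natIso_whiskerLeft_hom_app (F : C ⟶ D) {G H : D ⟶ E} (η : G ⟶ H) (X : C.carrier) :
    (natIso (F ◁ η)).hom.app X = (natIso η).hom.app ((functor F).obj X) := rfl

lemma natIso_whiskerRight_hom_app {F G : C ⟶ D} (η : F ⟶ G) (H : D ⟶ E) (X : C.carrier) :
    (natIso (η ▷ H)).hom.app X = (functor H).map ((natIso η).hom.app X) := rfl

lemma natIso_associator_hom_app (F : C ⟶ D) (G : D ⟶ E) (H : E ⟶ E') (X : C.carrier) :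
    (natIso (α_ F G H).hom).hom.app X = 𝟙 _ := rfl

lemma natIso_associator_inv_app (F : C ⟶ D) (G : D ⟶ E) (H : E ⟶ E') (X : C.carrier) :
    (natIso (α_ F G H).inv).hom.app X = 𝟙 _ := rfl

lemma natIso_leftUnitor_hom_app (F : C ⟶ D) (X : C.carrier) :
    (natIso (λ_ F).hom).hom.app X = 𝟙 _ := rfl

lemma natIso_leftUnitor_inv_app (F : C ⟶ D) (X : C.carrier) :
    (natIso (λ_ F).inv).hom.app X = 𝟙 _ := rfl

lemma natIso_rightUnitor_hom_app (F : C ⟶ D) (X : C.carrier) :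
    (natIso (ρ_ F).hom).hom.app X = 𝟙 _ := rfl

lemma natIso_rightUnitor_inv_app (F : C ⟶ D) (X : C.carrier) :
    (natIso (ρ_ F).inv).hom.app X = 𝟙 _ := rfl

lemma natIso_inv {F G : C ⟶ D} (e : F ≅ G) : natIso e.inv = (natIso e.hom).symm := by
  have h : natIso e.inv ≪≫ natIso e.hom = Iso.refl _ := by
    rw [← natIso_comp, e.inv_hom_id, natIso_id]
  rw [← Iso.trans_refl (natIso e.inv), ← Iso.self_symm_id (natIso e.hom), ← Iso.trans_assoc, h,
    Iso.refl_trans]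

lemma natIso_inv_hom_app {F G : C ⟶ D} (e : F ≅ G) (X : C.carrier) :
    (natIso e.inv).hom.app X = (natIso e.hom).inv.app X := by
  rw [natIso_inv]
  rfl

end ModCat

/-- A diagram of model categories indexed by `I`: a pseudo-functor from `I` to the `2`-category
of model categories. -/
abbrev Diagram (I : Type w) [Category.{w'} I] := LocallyDiscrete I ⥤ᵖ ModCat.{v, u}

namespace Diagram

variable {I : Type w} [Category.{w'} I] (ω : Diagram.{v, u} I)

/-- The model category `ω(i)`. -/
abbrev fib (i : I) : Type u := (ω.obj ⟨i⟩).carrier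

/-- The left Quillen functor `ω(f) : ω(i) ⥤ ω(j)`. -/
abbrev push {i j : I} (f : i ⟶ j) : ω.fib i ⥤ ω.fib j :=
  ModCat.functor (ω.map f.toLoc)

/-- The structure isomorphism `ω(𝟙 i) ≅ 𝟭`. -/
abbrev pushId (i : I) : ω.push (𝟙 i) ≅ 𝟭 (ω.fib i) := ModCat.natIso (ω.mapId ⟨i⟩).hom

/-- The structure isomorphism `ω(f ≫ g) ≅ ω(f) ⋙ ω(g)`. -/
abbrev pushComp {i j k : I} (f : i ⟶ j) (g : j ⟶ k) : ω.push (f ≫ g) ≅ ω.push f ⋙ ω.push g :=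
  ModCat.natIso (ω.mapComp f.toLoc g.toLoc).hom

/-- Variant of `pushId` for an endomorphism `f = 𝟙 i`. -/
def pushId' {i : I} (f : i ⟶ i) (h : f = 𝟙 i) : ω.push f ≅ 𝟭 (ω.fib i) :=
  ModCat.natIso (ω.mapId' f.toLoc (congrArg Quiver.Hom.toLoc h)).hom

lemma pushId'_eq_pushId (i : I) : ω.pushId' (𝟙 i) rfl = ω.pushId i :=
  congrArg (fun e : ω.map (𝟙 (⟨i⟩ : LocallyDiscrete I)) ≅ 𝟙 _ => ModCat.natIso e.hom)
    (ω.mapId'_eq_mapId ⟨i⟩)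

/-- Variant of `pushComp` for a factorization `f ≫ g = fg`. -/
def pushComp' {i j k : I} (f : i ⟶ j) (g : j ⟶ k) (fg : i ⟶ k) (h : f ≫ g = fg) :
    ω.push fg ≅ ω.push f ⋙ ω.push g :=
  ModCat.natIso
    (ω.mapComp' f.toLoc g.toLoc fg.toLoc (congrArg Quiver.Hom.toLoc h)).hom

lemma pushComp'_eq_pushComp {i j k : I} (f : i ⟶ j) (g : j ⟶ k) :
    ω.pushComp' f g (f ≫ g) rfl = ω.pushComp f g :=
  congrArg (fun e : ω.map (f.toLoc ≫ g.toLoc) ≅ ω.map f.toLoc ≫ ω.map g.toLoc =>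
    ModCat.natIso e.hom) (ω.mapComp'_eq_mapComp f.toLoc g.toLoc)

lemma pushComp'_id_inv_app {i j : I} (f : i ⟶ j) (c : ω.fib i) :
    (ω.pushComp' f (𝟙 j) f (comp_id f)).inv.app c =
      (ω.pushId j).hom.app ((ω.push f).obj c) := by
  have h := ω.mapComp'_comp_id_inv f.toLoc
  exact (ModCat.natIso_inv_hom_app (ω.mapComp' f.toLoc (𝟙 _) f.toLoc) c).symm.trans
    ((congrArg (fun η => (ModCat.natIso η).hom.app c) h).trans (comp_id _))

lemma pushComp'_comp_inv_app {i j k l : I} (f : i ⟶ j) (g : j ⟶ k) (h : k ⟶ l)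
    (fg : i ⟶ k) (fgh : i ⟶ l) (h₁ : f ≫ g = fg) (h₂ : fg ≫ h = fgh)
    (h₃ : f ≫ g ≫ h = fgh) (c : ω.fib i) :
    (ω.pushComp' f (g ≫ h) fgh h₃).inv.app c =
      (ω.pushComp g h).hom.app ((ω.push f).obj c) ≫
        (ω.push h).map ((ω.pushComp' f g fg h₁).inv.app c) ≫
          (ω.pushComp' fg h fgh h₂).inv.app c := by
  have key := ω.whiskerLeft_mapComp'_inv_comp_mapComp'₀₁₃_inv f.toLoc g.toLoc h.toLoc
    fg.toLoc (g ≫ h).toLoc fgh.toLoc (congrArg Quiver.Hom.toLoc h₁) rfl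
    (congrArg Quiver.Hom.toLoc h₃)
  have key' : (ω.pushComp' g h (g ≫ h) rfl).inv.app ((ω.push f).obj c) ≫
      (ω.pushComp' f (g ≫ h) fgh h₃).inv.app c =
      (ω.push h).map ((ω.pushComp' f g fg h₁).inv.app c) ≫
        (ω.pushComp' fg h fgh h₂).inv.app c := by
    have a₁ := ModCat.natIso_inv_hom_app
      (ω.mapComp' g.toLoc h.toLoc (g ≫ h).toLoc rfl) ((ω.push f).obj c)
    have a₂ := ModCat.natIso_inv_hom_app (ω.mapComp' f.toLoc (g ≫ h).toLoc fgh.toLoc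
      (congrArg Quiver.Hom.toLoc h₃)) c
    have a₃ := congrArg (ω.push h).map (ModCat.natIso_inv_hom_app
      (ω.mapComp' f.toLoc g.toLoc fg.toLoc (congrArg Quiver.Hom.toLoc h₁)) c)
    have a₄ := ModCat.natIso_inv_hom_app (ω.mapComp' fg.toLoc h.toLoc fgh.toLoc
      (congrArg Quiver.Hom.toLoc h₂)) c
    refine (congrArg₂ (fun a b => a ≫ b) a₁ a₂).symm.trans
      (Eq.trans ?_ (congrArg₂ (fun a b => a ≫ b) a₃ a₄))
    exact (congrArg (fun η => (ModCat.natIso η).hom.app c) key).trans (id_comp _)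
  rw [← key', ← pushComp'_eq_pushComp]
  simp

/-- The composition `ω ∘ J` of a diagram of model categories with a functor `J`. -/
abbrev restrict {I' : Type*} [Category* I'] (J : I' ⥤ I) : Diagram.{v, u} I' :=
  J.toPseudofunctor.comp ω

end Diagram

/-- A section of a diagram `ω` of model categories: objects `x_i` of `ω(i)` and
morphisms `ω(f)(x_i) ⟶ x_j` for `f : i ⟶ j`, compatible with identities and composition. -/
structure Sect {I : Type w} [Category.{w'} I] (ω : Diagram.{v, u} I) where
  obj (i : I) : ω.fib i
  map {i j : I} (f : i ⟶ j) : (ω.push f).obj (obj i) ⟶ obj j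
  map_id (i : I) : map (𝟙 i) = (ω.pushId i).hom.app (obj i)
  map_comp {i j k : I} (f : i ⟶ j) (g : j ⟶ k) :
    map (f ≫ g) = (ω.pushComp f g).hom.app (obj i) ≫ (ω.push g).map (map f) ≫ map g

namespace Sect

variable {I : Type w} [Category.{w'} I] {ω : Diagram.{v, u} I}

/-- Morphisms of sections. -/
@[ext]
structure Hom (x y : Sect ω) where
  app (i : I) : x.obj i ⟶ y.obj i
  naturality {i j : I} (f : i ⟶ j) : x.map f ≫ app j = (ω.push f).map (app i) ≫ y.map f

instance : Category (Sect ω) where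
  Hom := Hom
  id x := { app := fun _ => 𝟙 _, naturality := fun f => by simp }
  comp φ ψ :=
    { app := fun i => φ.app i ≫ ψ.app i
      naturality := fun f => by
        rw [← assoc, φ.naturality, assoc, ψ.naturality, Functor.map_comp, assoc] }
  id_comp φ := Hom.ext (funext fun i => id_comp _)
  comp_id φ := Hom.ext (funext fun i => comp_id _)
  assoc φ ψ χ := Hom.ext (funext fun i => assoc _ _ _)

@[ext]
lemma hom_ext {x y : Sect ω} {φ ψ : x ⟶ y} (h : ∀ i, φ.app i = ψ.app i) : φ = ψ :=
  Hom.ext (funext h)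

@[simp]
lemma id_app (x : Sect ω) (i : I) : Hom.app (𝟙 x) i = 𝟙 (x.obj i) := rfl

@[simp]
lemma comp_app {x y z : Sect ω} (φ : x ⟶ y) (ψ : y ⟶ z) (i : I) :
    Hom.app (φ ≫ ψ) i = φ.app i ≫ ψ.app i := rfl

variable (ω)

/-- The evaluation of sections at `i`. -/
@[simps]
def ev (i : I) : Sect ω ⥤ ω.fib i where
  obj x := x.obj i
  map φ := φ.app i

/-- The structure maps of sections, as a natural transformation. -/
@[simps]
def evMap {i j : I} (f : i ⟶ j) : ev ω i ⋙ ω.push f ⟶ ev ω j where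
  app x := x.map f
  naturality _ _ φ := (φ.naturality f).symm

variable {ω}

lemma map_comp' (x : Sect ω) {i j k : I} (f : i ⟶ j) (g : j ⟶ k) (fg : i ⟶ k)
    (h : f ≫ g = fg) :
    x.map fg = (ω.pushComp' f g fg h).hom.app (x.obj i) ≫
      (ω.push g).map (x.map f) ≫ x.map g := by
  subst h
  rw [x.map_comp, ← ω.pushComp'_eq_pushComp f g]

lemma map_id' (x : Sect ω) {i : I} (f : i ⟶ i) (h : f = 𝟙 i) :
    x.map f = (ω.pushId' f h).hom.app (x.obj i) := by
  subst h
  rw [x.map_id, ← ω.pushId'_eq_pushId i]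

variable (ω)

/-- The pull-back functor `J^* : Sect(ω) ⥤ Sect(ω ∘ J)`. -/
@[simps]
def pullback {I' : Type*} [Category* I'] (J : I' ⥤ I) : Sect ω ⥤ Sect (ω.restrict J) where
  obj x :=
    { obj := fun i => x.obj (J.obj i)
      map := fun f => x.map (J.map f)
      map_id := fun i => x.map_id' _ (J.map_id i)
      map_comp := fun f g => x.map_comp' _ _ _ (J.map_comp f g).symm }
  map φ :=
    { app := fun i => φ.app (J.obj i)
      naturality := fun f => φ.naturality (J.map f) }

/-- The functor `ω(i₀) ⥤ Sect(ω)` which sends `c` to the section `i ↦ ω(i₀ ⟶ i)(c)` when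
`i₀` is an initial object of the index category. -/
@[simps]
def ofInitial {i₀ : I} (h₀ : IsInitial i₀) : ω.fib i₀ ⥤ Sect ω where
  obj c :=
    { obj := fun i => (ω.push (h₀.to i)).obj c
      map := fun {i j} f =>
        (ω.pushComp' (h₀.to i) f (h₀.to j) (h₀.hom_ext _ _)).inv.app c
      map_id := fun i => ω.pushComp'_id_inv_app (h₀.to i) c
      map_comp := fun {i j k} f g =>
        ω.pushComp'_comp_inv_app (h₀.to i) f g (h₀.to j) (h₀.to k)
          (h₀.hom_ext _ _) (h₀.hom_ext _ _) (h₀.hom_ext _ _) c }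
  map φ :=
    { app := fun i => (ω.push (h₀.to i)).map φ
      naturality := fun {i j} f =>
        ((ω.pushComp' (h₀.to i) f (h₀.to j) (h₀.hom_ext _ _)).inv.naturality φ).symm }
  map_id _ := hom_ext fun _ => CategoryTheory.Functor.map_id _ _
  map_comp _ _ := hom_ext fun _ => CategoryTheory.Functor.map_comp _ _ _

/-- Weak equivalences of sections are defined objectwise. -/
instance : CategoryWithWeakEquivalences (Sect ω) where
  weakEquivalences _ _ φ := ∀ i, WeakEquivalence (φ.app i)

/-- The class of objectwise fibrations of sections. -/
def objectwiseFibrations : MorphismProperty (Sect ω) :=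
  fun _ _ φ => ∀ i, Fibration (φ.app i)

/-- The projective model structure on `Sect(ω)` exists: there is a model category
structure whose weak equivalences and fibrations are the objectwise ones. -/
def HasProjectiveModelStructure : Prop :=
  ∃ M : ModelCategory (Sect ω),
    @weakEquivalences (Sect ω) _ M.categoryWithWeakEquivalences = weakEquivalences (Sect ω) ∧
    @fibrations (Sect ω) _ M.categoryWithFibrations = objectwiseFibrations ω

end Sect

/-- The homotopy category: the localization with respect to weak equivalences. -/
abbrev Ho (C : Type*) [Category* C] [CategoryWithWeakEquivalences C] :=
  (weakEquivalences C).Localization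

/-- The localization functor. -/
abbrev toHo (C : Type*) [Category* C] [CategoryWithWeakEquivalences C] : C ⥤ Ho C :=
  (weakEquivalences C).Q

lemma isIso_toHo_map {C : Type*} [Category* C] [CategoryWithWeakEquivalences C] {X Y : C}
    (f : X ⟶ Y) (hf : WeakEquivalence f) : IsIso ((toHo C).map f) :=
  Localization.inverts (toHo C) (weakEquivalences C) f ((weakEquivalence_iff f).1 hf)

/-- A functor on a model category which inverts the weak equivalences between cofibrant
objects has a left derived functor. -/
lemma hasLeftDerivedFunctor {C H : Type*} [Category* C] [Category* H] [ModelCategory C]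
    (F : C ⥤ H) (hF : ∀ {X Y : C} (f : X ⟶ Y), IsCofibrant X → IsCofibrant Y →
      WeakEquivalence f → IsIso (F.map f)) :
    F.HasLeftDerivedFunctor (weakEquivalences C) := by
  let W := weakEquivalences C
  have hd : (CofibrantObject.localizerMorphism C).op.Derives F.op := by
    intro X Y f hf
    have := hF f.unop.hom Y.unop.2 X.unop.2 ((weakEquivalence_iff _).2 hf)
    change IsIso (F.map f.unop.hom).op
    infer_instance
  have := hd.hasPointwiseRightDerivedFunctor
  let R := F.op.totalRightDerived W.Q.op W.op
  let β : F.op ⟶ W.Q.op ⋙ R := F.op.totalRightDerivedUnit W.Q.op W.op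
  let L : W.Localization ⥤ H := R.unop
  let α : W.Q ⋙ L ⟶ F := NatTrans.unop β
  have hL : L.IsRightKanExtension α := by
    refine ⟨⟨IsTerminal.ofUniqueHom (fun E => CostructuredArrow.homMk
      (NatTrans.unop (R.rightDerivedDesc β W.op E.left.op (NatTrans.op E.hom))) ?_) ?_⟩⟩
    · ext X
      exact congrArg Quiver.Hom.unop
        (R.rightDerived_fac_app β W.op E.left.op (NatTrans.op E.hom) (Opposite.op X))
    · intro E m
      ext : 1
      have h : NatTrans.op m.left =
          R.rightDerivedDesc β W.op E.left.op (NatTrans.op E.hom) := by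
        refine R.rightDerived_ext β W.op _ _ _ ?_
        rw [R.rightDerived_fac]
        ext X
        have := NatTrans.congr_app (CostructuredArrow.w m) X.unop
        exact congrArg Quiver.Hom.op this
      exact congrArg NatTrans.unop h
  have : L.IsLeftDerivedFunctor α W := ⟨hL⟩
  exact Functor.HasLeftDerivedFunctor.mk' L α

/-- Left Quillen functors preserve weak equivalences between cofibrant objects. -/
lemma ModCat.weakEquivalence_map {C D : ModCat.{v, u}} (G : C ⟶ D) {X Y : C.carrier}
    (f : X ⟶ Y) (hX : IsCofibrant X) (hY : IsCofibrant Y) (hf : WeakEquivalence f) :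
    WeakEquivalence ((ModCat.functor G).map f) := by
  let h : CofibrantBrownFactorization f := Classical.arbitrary _
  have hi : Cofibration h.i := (cofibration_iff _).2 h.hi
  have h₁ : WeakEquivalence ((ModCat.functor G).map h.i) :=
    LeftQuillenFunctor.weakEquivalence_map G h.i hi inferInstance
  have h₂ : WeakEquivalence ((ModCat.functor G).map h.s) :=
    LeftQuillenFunctor.weakEquivalence_map G h.s inferInstance inferInstance
  have h₃ : WeakEquivalence ((ModCat.functor G).map h.p) := by
    refine weakEquivalence_of_precomp_of_fac (f := (ModCat.functor G).map h.s)
      (fg := 𝟙 _) ?_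
    rw [← Functor.map_comp, h.s_p, CategoryTheory.Functor.map_id]
  rw [← h.fac, Functor.map_comp]
  infer_instance

namespace Diagram

variable {I : Type w} [Category.{w'} I] (ω : Diagram.{v, u} I)

instance {i j : I} (f : i ⟶ j) :
    (ω.push f ⋙ toHo (ω.fib j)).HasLeftDerivedFunctor (weakEquivalences (ω.fib i)) :=
  hasLeftDerivedFunctor _ fun g hX hY hg =>
    isIso_toHo_map _ (ModCat.weakEquivalence_map (ω.map f.toLoc) g hX hY hg)

/-- The left derived functor `𝐋ω(f) : Ho ω(i) ⥤ Ho ω(j)`. -/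
noncomputable def leftDerivedPush {i j : I} (f : i ⟶ j) : Ho (ω.fib i) ⥤ Ho (ω.fib j) :=
  (ω.push f ⋙ toHo (ω.fib j)).totalLeftDerived (toHo (ω.fib i)) (weakEquivalences (ω.fib i))

/-- The canonical morphism `𝐋ω(f)(x) ⟶ ω(f)(x)` in `Ho ω(j)`. -/
noncomputable def leftDerivedPushCounit {i j : I} (f : i ⟶ j) :
    toHo (ω.fib i) ⋙ ω.leftDerivedPush f ⟶ ω.push f ⋙ toHo (ω.fib j) :=
  (ω.push f ⋙ toHo (ω.fib j)).totalLeftDerivedCounit (toHo (ω.fib i))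
    (weakEquivalences (ω.fib i))

end Diagram

namespace Sect

variable {I : Type w} [Category.{w'} I] (ω : Diagram.{v, u} I)

lemma ev_inverts (i : I) :
    (weakEquivalences (Sect ω)).IsInvertedBy (ev ω i ⋙ toHo (ω.fib i)) :=
  fun _ _ _ h => isIso_toHo_map _ (h i)

/-- The evaluation `x ↦ x_i` on homotopy categories. -/
noncomputable def hoEv (i : I) : Ho (Sect ω) ⥤ Ho (ω.fib i) :=
  Localization.lift (ev ω i ⋙ toHo (ω.fib i)) (ev_inverts ω i) (toHo (Sect ω))

noncomputable instance (i : I) : Localization.Lifting (toHo (Sect ω)) (weakEquivalences (Sect ω))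
    (ev ω i ⋙ toHo (ω.fib i)) (hoEv ω i) :=
  inferInstanceAs (Localization.Lifting _ _ _ (Localization.lift _ _ _))

/-- For `f : i ⟶ j`, the natural morphism `𝐋ω(f)(x_i) ⟶ x_j` in `Ho ω(j)`, for
`x : Ho (Sect ω)`: for a section `x`, it is the composition of `𝐋ω(f)(x_i) ⟶ ω(f)(x_i)`
and of the structure map `ω(f)(x_i) ⟶ x_j`. -/
noncomputable def hoEvMap {i j : I} (f : i ⟶ j) :
    hoEv ω i ⋙ ω.leftDerivedPush f ⟶ hoEv ω j :=
  Localization.liftNatTrans (toHo (Sect ω)) (weakEquivalences (Sect ω))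
    ((ev ω i ⋙ toHo (ω.fib i)) ⋙ ω.leftDerivedPush f) (ev ω j ⋙ toHo (ω.fib j)) _ _
    ((Functor.associator _ _ _).hom ≫
      Functor.whiskerLeft (ev ω i) (ω.leftDerivedPushCounit f) ≫
      (Functor.associator _ _ _).inv ≫ Functor.whiskerRight (evMap ω f) (toHo (ω.fib j)))

/-- Cartesian objects of `Ho (Sect ω)`. -/
def IsCartesian : ObjectProperty (Ho (Sect ω)) :=
  fun x => ∀ ⦃i j : I⦄ (f : i ⟶ j), IsIso ((hoEvMap ω f).app x)

/-- The category `Ho (Sect ω)_cart`. -/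
abbrev HoCart := (IsCartesian ω).FullSubcategory

lemma isCartesian_toHo_obj_iff (x : Sect ω) :
    IsCartesian ω ((toHo (Sect ω)).obj x) ↔ ∀ ⦃i j : I⦄ (f : i ⟶ j),
      IsIso ((ω.leftDerivedPushCounit f).app (x.obj i) ≫ (toHo (ω.fib j)).map (x.map f)) := by
  refine forall_congr' fun i => forall_congr' fun j => forall_congr' fun f => ?_
  dsimp only [hoEvMap]
  rw [Localization.liftNatTrans_app, isIso_comp_left_iff, isIso_comp_right_iff]
  simp
  rfl

lemma pullback_inverts {I' : Type*} [Category* I'] (J : I' ⥤ I) :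
    (weakEquivalences (Sect ω)).IsInvertedBy (pullback ω J ⋙ toHo (Sect (ω.restrict J))) :=
  fun _ _ φ h => isIso_toHo_map ((pullback ω J).map φ)
    ((weakEquivalence_iff _).2 fun i => h (J.obj i))

/-- The functor `Ho (Sect ω) ⥤ Ho (Sect (ω ∘ J))` induced by `J^*`. -/
noncomputable def hoPullback {I' : Type*} [Category* I'] (J : I' ⥤ I) :
    Ho (Sect ω) ⥤ Ho (Sect (ω.restrict J)) :=
  Localization.lift (pullback ω J ⋙ toHo (Sect (ω.restrict J))) (pullback_inverts ω J)
    (toHo (Sect ω))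

instance {I' : Type*} [Category* I'] (J : I' ⥤ I) {i₀ : I} (h₀ : IsInitial i₀) :
    ((ofInitial ω h₀ ⋙ pullback ω J) ⋙ toHo (Sect (ω.restrict J))).HasLeftDerivedFunctor
      (weakEquivalences (ω.fib i₀)) :=
  hasLeftDerivedFunctor _ fun g hX hY hg =>
    isIso_toHo_map ((ofInitial ω h₀ ⋙ pullback ω J).map g)
      ((weakEquivalence_iff _).2 fun i =>
        ModCat.weakEquivalence_map (ω.map (h₀.to (J.obj i)).toLoc) g hX hY hg)

/-- When `i₀` is an initial object of `I` and `J : I' ⥤ I`, this is the canonical functor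
`Ho ω(i₀) ⥤ Ho (Sect (ω ∘ J))`, i.e. the left derived functor of the functor
which sends `c` to the section `i' ↦ ω(i₀ ⟶ J(i'))(c)`. -/
noncomputable def hoOfInitial {I' : Type*} [Category* I'] (J : I' ⥤ I) {i₀ : I}
    (h₀ : IsInitial i₀) : Ho (ω.fib i₀) ⥤ Ho (Sect (ω.restrict J)) :=
  ((ofInitial ω h₀ ⋙ pullback ω J) ⋙ toHo (Sect (ω.restrict J))).totalLeftDerived
    (toHo (ω.fib i₀)) (weakEquivalences (ω.fib i₀))

end Sect

/-- The category `Δ_*` of the pointed finite ordered sets `[p]_* = [p] ⊔ {*}` for `p ≥ -1`,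
where the base point `*` is the largest element. The object with `card = p + 1`
corresponds to `[p]_*`. -/
@[ext]
structure PointedSimplexCategory where
  card : ℕ

namespace PointedSimplexCategory

/-- The pointed ordered set `[p]_*`, with base point `⊤`. -/
abbrev toType (X : PointedSimplexCategory) : Type := WithTop (Fin X.card)

/-- Morphisms in `Δ_*` are order preserving pointed maps. -/
@[ext]
structure Hom (X Y : PointedSimplexCategory) where
  toOrderHom : X.toType →o Y.toType
  map_top : toOrderHom ⊤ = ⊤

instance : Category PointedSimplexCategory where
  Hom := Hom
  id X := { toOrderHom := OrderHom.id, map_top := rfl }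
  comp f g :=
    { toOrderHom := g.toOrderHom.comp f.toOrderHom
      map_top := (congrArg g.toOrderHom f.map_top).trans g.map_top }

/-- The object `[-1]_*`. -/
def base : PointedSimplexCategory := ⟨0⟩

/-- `[-1]_*` is an initial object of `Δ_*`. -/
def isInitialBase : IsInitial base :=
  IsInitial.ofUniqueHom
    (fun X => { toOrderHom := ⟨fun _ => ⊤, fun _ _ _ => le_rfl⟩, map_top := rfl })
    (fun X f => Hom.ext (OrderHom.ext _ _ (funext fun x => by
      have hx : x = ⊤ := by
        induction x with
        | none => rfl
        | some a => exact Fin.elim0 a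
      rw [hx]
      exact f.map_top)))

/-- The inclusion `Δ ⥤ Δ_*` which sends `[p]` to `[p]_*`. -/
def incl : SimplexCategory ⥤ PointedSimplexCategory where
  obj n := ⟨n.len + 1⟩
  map f := { toOrderHom := (SimplexCategory.Hom.toOrderHom f).withTopMap, map_top := rfl }
  map_id n := Hom.ext (OrderHom.ext _ _ (funext fun x => by
    induction x <;> rfl))
  map_comp f g := Hom.ext (OrderHom.ext _ _ (funext fun x => by
    induction x <;> rfl))

end PointedSimplexCategory

end HoSect

open CategoryTheory HoSect

/-! Both equivalences come from a functor and a candidate inverse whose comparison morphisms are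
weak equivalences on cofibrant cartesian sections.

Statement (2): restriction along a functor `J` has a left adjoint, the left Kan extension `lan`,
whose value at `j` is the colimit of the objects ω(k)(x_r) over all `k : J r ⟶ j`. Restriction
preserves weak equivalences and fibrations, so the adjunction passes to homotopy categories
(`exists_isEquivalence_lift_of_adjunction`). By two-out-of-three, its unit and counit are invertible
on cartesian objects as soon as the maps from ω(k)(x_r) to the value of `lan x` at `j` are weak
equivalences for `x` cofibrant and cartesian. The diagram of the ω(k)(x_r) is then projectively
cofibrant (`IsProjCofibrant.exists_lift`) and consists of weak equivalences. For the diagonal of Δ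
it is indexed by the simplices of Δ^p × Δ^q. The vertex sets of these simplices are the nonempty
chains of [p] × [q], and the chains form a cone whose apex is the top vertex. Collapsing this cone
to its apex, one pair of faces at a time, builds the colimit by pushouts of trivial cofibrations
(`weakEquivalence_subColim_ι`).

Statement (1): this is the extra degeneracy argument. Let L(c) be the section induced by c over
[-1]_* and let S(x) = ω(ε)(x_[0]) with ε : [0]_* ⟶ [-1]_*. Then S(L(c)) ≅ c because [-1]_* is
initial. In the other direction one uses the shifted section T(x), equal to ω(u_p)(x_[p+1]) at [p],
where u_p : [p+1]_* ⟶ [p]_* sends the last vertex to the base point. The inclusion [p] ⟶ [p+1] gives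
x ⟶ T(x), and the last vertex [0] ⟶ [p+1] gives L(S(x)) ⟶ T(x). Both are weak equivalences for `x`
cofibrant and cartesian, and `exists_isEquivalence_lift_of_zigzag` concludes. -/

namespace HoSect

open CategoryTheory Category Limits HomotopicalAlgebra

/-! ### Saturation of weak equivalences and computation of left derived functors -/

section ModelCategory

variable {C : Type*} [Category* C] [ModelCategory C]

lemma exists_cofibrant_resolution (X : C) :
    ∃ (X' : C) (p : X' ⟶ X), IsCofibrant X' ∧ Fibration p ∧ WeakEquivalence p := by
  obtain ⟨X', h, p, hp, hp'⟩ := CofibrantObject.HoCat.exists_resolution X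
  exact ⟨X', p, h, hp, hp'⟩

lemma exists_fibrant_resolution (X : C) :
    ∃ (X' : C) (i : X ⟶ X'), IsFibrant X' ∧ Cofibration i ∧ WeakEquivalence i :=
  ⟨_, FibrantObject.HoCat.iResolutionObj X, inferInstance, inferInstance, inferInstance⟩

section

variable {H : Type*} [Category* H] (L : C ⥤ H) [L.IsLocalization (weakEquivalences C)]

lemma isIso_map_of_weakEquivalence {X Y : C} (f : X ⟶ Y) (hf : WeakEquivalence f) :
    IsIso (L.map f) :=
  Localization.inverts L (weakEquivalences C) f ((weakEquivalence_iff f).1 hf)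

/-- A homotopy section of the fibration `p` is deformed by covering homotopy into a strict section
`s`. Then `p ≫ s` is homotopic to the identity, hence a weak equivalence, and `p` is a retract of
it. -/
lemma weakEquivalence_of_isIso_of_fibration {X Y : C} (p : X ⟶ Y) [IsCofibrant X] [IsFibrant X]
    [IsCofibrant Y] [IsFibrant Y] [Fibration p] [IsIso (L.map p)] : WeakEquivalence p := by
  obtain ⟨s₀, hs₀⟩ := map_surjective_of_isLocalization L _ _ (inv (L.map p))
  have h₀ : LeftHomotopyRel (s₀ ≫ p) (𝟙 Y) := by
    rw [LeftHomotopyRel.iff_map_eq L]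
    simp [hs₀]
  obtain ⟨P, _, ⟨h⟩⟩ := h₀.exists_good_cylinder
  obtain ⟨s, h', _⟩ := h.covering_homotopy p s₀ rfl
  have hs : s ≫ p = 𝟙 Y := by
    rw [← h'.h₁, assoc, ‹h'.h ≫ p = h.h›, h.h₁]
  have hs' : L.map s = inv (L.map p) := by
    rw [← cancel_mono (L.map p), ← L.map_comp, hs]
    simp
  have h₁ : LeftHomotopyRel (p ≫ s) (𝟙 X) := by
    rw [LeftHomotopyRel.iff_map_eq L]
    simp [hs']
  obtain ⟨Q, ⟨k⟩⟩ := h₁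
  have : WeakEquivalence (p ≫ s) := k.weakEquivalence_iff.2 inferInstance
  have r : RetractArrow p (p ≫ s) :=
    { i := Arrow.homMk (𝟙 X) s (by simp)
      r := Arrow.homMk (𝟙 X) p (by simp [hs])
      retract := by
        ext
        · simp
        · simpa using! hs }
  rw [weakEquivalence_iff] at this ⊢
  exact MorphismProperty.of_retract r this

/-- A morphism in a model category is a weak equivalence as soon as it becomes invertible in
the homotopy category. -/
lemma weakEquivalence_of_isIso {X Y : C} (f : X ⟶ Y) (hf : IsIso (L.map f)) :
    WeakEquivalence f := by
  wlog hY : IsCofibrant Y generalizing X Y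
  -- The source is resolved as well: `p ≫ f` lifts through the trivial fibration `q` because `X'` is
  -- cofibrant.
  · obtain ⟨Y', q, _, _, _⟩ := exists_cofibrant_resolution Y
    obtain ⟨X', p, _, _, _⟩ := exists_cofibrant_resolution X
    have hp := isIso_map_of_weakEquivalence L p inferInstance
    have hq := isIso_map_of_weakEquivalence L q inferInstance
    have sq : CommSq (initial.to Y') (initial.to X') q (p ≫ f) := { }
    have h : IsIso (L.map sq.lift) := by
      have : IsIso (L.map sq.lift ≫ L.map q) := by
        rw [← L.map_comp, sq.fac_right, L.map_comp]
        infer_instance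
      exact IsIso.of_isIso_comp_right _ (L.map q)
    have := this sq.lift h inferInstance
    have h' : WeakEquivalence (p ≫ f) := by
      rw [← sq.fac_right]
      infer_instance
    exact weakEquivalence_of_precomp p f
  wlog hX : IsCofibrant X generalizing X
  · obtain ⟨X', p, _, _, _⟩ := exists_cofibrant_resolution X
    have hp := isIso_map_of_weakEquivalence L p inferInstance
    have := this (p ≫ f) (by rw [L.map_comp]; infer_instance) inferInstance
    exact weakEquivalence_of_precomp p f
  wlog hY' : IsFibrant Y generalizing Y
  · obtain ⟨Y', i, _, _, _⟩ := exists_fibrant_resolution Y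
    have hi := isIso_map_of_weakEquivalence L i inferInstance
    have hc := isCofibrant_of_cofibration i
    have := this hc (f ≫ i) (by rw [L.map_comp]; infer_instance) inferInstance
    exact weakEquivalence_of_postcomp f i
  let h := MorphismProperty.factorizationData (trivialCofibrations C) (fibrations C) f
  have hi := isIso_map_of_weakEquivalence L h.i inferInstance
  have := isCofibrant_of_cofibration h.i
  have := isFibrant_of_fibration h.p
  have : IsIso (L.map h.p) := by
    have : IsIso (L.map h.i ≫ L.map h.p) := by
      rw [← L.map_comp, h.fac]
      exact hf
    exact IsIso.of_isIso_comp_left (L.map h.i) _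
  have := weakEquivalence_of_isIso_of_fibration L h.p
  rw [← h.fac]
  infer_instance

end

/-- Ken Brown's lemma. -/
lemma weakEquivalence_map_of_cofibrant {D : Type*} [Category* D] [ModelCategory D] (G : C ⥤ D)
    (hG : ∀ {X Y : C} (i : X ⟶ Y), Cofibration i → WeakEquivalence i → WeakEquivalence (G.map i))
    {X Y : C} (f : X ⟶ Y) (hX : IsCofibrant X) (hY : IsCofibrant Y) (hf : WeakEquivalence f) :
    WeakEquivalence (G.map f) := by
  let h : CofibrantBrownFactorization f := Classical.arbitrary _
  have h₁ : WeakEquivalence (G.map h.i) := hG h.i ((cofibration_iff _).2 h.hi) inferInstance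
  have h₂ : WeakEquivalence (G.map h.s) := hG h.s inferInstance inferInstance
  have h₃ : WeakEquivalence (G.map h.p) := by
    refine weakEquivalence_of_precomp_of_fac (f := G.map h.s) (fg := 𝟙 _) ?_
    rw [← Functor.map_comp, h.s_p, CategoryTheory.Functor.map_id]
  rw [← h.fac, Functor.map_comp]
  infer_instance

section LeftDerived

variable {D H : Type*} [Category* D] [Category* H] (L : C ⥤ D)
  [L.IsLocalization (weakEquivalences C)] (F : C ⥤ H)

/-- The functor `F` inverts weak equivalences between cofibrant objects. -/
abbrev InvertsCofibrant : Prop :=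
  ∀ {X Y : C} (f : X ⟶ Y), IsCofibrant X → IsCofibrant Y → WeakEquivalence f → IsIso (F.map f)

variable {L F}

/-- The derived functor is built for `F.op`, for which cofibrant objects are right resolutions;
invertibility on cofibrant objects comes with this construction. Any other candidate can then be
compared with this model. -/
lemma exists_leftDerivedFunctor_isIso (hF : InvertsCofibrant F) :
    ∃ (LF : D ⥤ H) (α : L ⋙ LF ⟶ F),
      LF.IsLeftDerivedFunctor α (weakEquivalences C) ∧ ∀ X, IsCofibrant X → IsIso (α.app X) := by
  let W := weakEquivalences C
  have hd : (CofibrantObject.localizerMorphism C).op.Derives F.op := by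
    intro X Y f hf
    have := hF f.unop.hom Y.unop.2 X.unop.2 ((weakEquivalence_iff _).2 hf)
    change IsIso (F.map f.unop.hom).op
    infer_instance
  have := hd.hasPointwiseRightDerivedFunctor
  let R := F.op.totalRightDerived L.op W.op
  let β : F.op ⟶ L.op ⋙ R := F.op.totalRightDerivedUnit L.op W.op
  let LF : D ⥤ H := R.unop
  let α : L ⋙ LF ⟶ F := NatTrans.unop β
  refine ⟨LF, α, ?_, fun X hX => ?_⟩
  · have hL : LF.IsRightKanExtension α := by
      refine ⟨⟨IsTerminal.ofUniqueHom (fun E => CostructuredArrow.homMk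
        (NatTrans.unop (R.rightDerivedDesc β W.op E.left.op (NatTrans.op E.hom))) ?_) ?_⟩⟩
      · ext X
        exact congrArg Quiver.Hom.unop
          (R.rightDerived_fac_app β W.op E.left.op (NatTrans.op E.hom) (Opposite.op X))
      · intro E m
        ext : 1
        have h : NatTrans.op m.left =
            R.rightDerivedDesc β W.op E.left.op (NatTrans.op E.hom) := by
          refine R.rightDerived_ext β W.op _ _ _ ?_
          rw [R.rightDerived_fac]
          ext X
          have := NatTrans.congr_app (CostructuredArrow.w m) X.unop
          exact congrArg Quiver.Hom.op this
        exact congrArg NatTrans.unop h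
    exact ⟨hL⟩
  · have h : IsIso (β.app (Opposite.op X)) :=
      hd.isIso_of_isRightDerivedFunctor β (Opposite.op (CofibrantObject.mk X))
    exact inferInstanceAs (IsIso (β.app (Opposite.op X)).unop)

variable {LF : D ⥤ H} (α : L ⋙ LF ⟶ F)

lemma isIso_leftDerived_app (hF : InvertsCofibrant F)
    [LF.IsLeftDerivedFunctor α (weakEquivalences C)] (X : C) (hX : IsCofibrant X) :
    IsIso (α.app X) := by
  obtain ⟨LF', α', _, h⟩ := exists_leftDerivedFunctor_isIso (L := L) hF
  have := h X hX
  have e := (LF.leftDerived_fac_app α (weakEquivalences C) LF' α' X)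
  have : IsIso (LF.leftDerivedLift α (weakEquivalences C) LF' α') :=
    (Functor.isLeftDerivedFunctor_iff_isIso_leftDerivedLift LF α (weakEquivalences C) LF' α').1
      inferInstance
  have : IsIso ((LF.leftDerivedLift α (weakEquivalences C) LF' α').app (L.obj X) ≫ α.app X) := by
    rw [e]
    infer_instance
  exact IsIso.of_isIso_comp_left
    ((LF.leftDerivedLift α (weakEquivalences C) LF' α').app (L.obj X)) _

lemma isIso_of_isIso_app_cofibrant {F G : D ⥤ H} (τ : F ⟶ G)
    (h : ∀ X, IsCofibrant X → IsIso (τ.app (L.obj X))) : IsIso τ := by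
  have : ∀ Y, IsIso (τ.app Y) := fun Y => by
    let L' := CofibrantObject.ι ⋙ L
    have := Localization.essSurj L' (weakEquivalences (CofibrantObject C))
    have := h _ (L'.objPreimage Y).2
    exact (NatTrans.isIso_app_iff_of_iso τ (L'.objObjPreimageIso Y)).1 this
  exact NatIso.isIso_of_isIso_app _

/-- Converse of `isIso_leftDerived_app`: the comparison with the model of
`exists_leftDerivedFunctor_isIso` is invertible on cofibrant objects, hence everywhere, since each
object of `D` is isomorphic to the image of a cofibrant one. -/
lemma isLeftDerivedFunctor_of_isIso_app (hF : InvertsCofibrant F)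
    (h : ∀ X, IsCofibrant X → IsIso (α.app X)) :
    LF.IsLeftDerivedFunctor α (weakEquivalences C) := by
  obtain ⟨LF', α', _, h'⟩ := exists_leftDerivedFunctor_isIso (L := L) hF
  rw [Functor.isLeftDerivedFunctor_iff_isIso_leftDerivedLift LF' α' (weakEquivalences C)]
  refine isIso_of_isIso_app_cofibrant (L := L) _ fun X hX => ?_
  have := h X hX
  have := h' X hX
  have e := (LF'.leftDerived_fac_app α' (weakEquivalences C) LF α X)
  have : IsIso ((LF'.leftDerivedLift α' (weakEquivalences C) LF α).app (L.obj X) ≫ α'.app X) := by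
    rw [e]
    infer_instance
  exact IsIso.of_isIso_comp_right _ (α'.app X)

/-- Here `X` need not be cofibrant: naturality of `α` along `p` carries invertibility from `X'` to
`X`. -/
lemma isIso_leftDerived_app_of_resolution (hF : InvertsCofibrant F)
    [LF.IsLeftDerivedFunctor α (weakEquivalences C)] {X' X : C} (p : X' ⟶ X)
    (hX' : IsCofibrant X') (hp : WeakEquivalence p) (hFp : IsIso (F.map p)) :
    IsIso (α.app X) := by
  have := isIso_leftDerived_app α hF X' hX'
  have := isIso_map_of_weakEquivalence L p hp
  have e := α.naturality p
  have : IsIso ((L ⋙ LF).map p ≫ α.app X) := by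
    rw [e]
    infer_instance
  have : IsIso ((L ⋙ LF).map p) := by
    dsimp only [Functor.comp_map]
    infer_instance
  exact IsIso.of_isIso_comp_left ((L ⋙ LF).map p) _

end LeftDerived

end ModelCategory

/-! ### Criteria for equivalences between full subcategories of homotopy categories -/

/-- A right adjoint functor restricts to an equivalence between the full subcategories of objects
on which the counit and the unit are invertible. -/
lemma isEquivalence_lift_of_adjunction {C D : Type*} [Category* C] [Category* D] {L : D ⥤ C}
    {G : C ⥤ D} (adj : L ⊣ G) (P : ObjectProperty C) (Q : ObjectProperty D)
    (hG : ∀ x : P.FullSubcategory, Q ((P.ι ⋙ G).obj x)) (hL : ∀ x, Q x → P (L.obj x))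
    (hP : ∀ y, P y → IsIso (adj.counit.app y)) (hQ : ∀ x, Q x → IsIso (adj.unit.app x)) :
    (Q.lift (P.ι ⋙ G) hG).IsEquivalence where
  faithful := ⟨fun {y z} f g h => by
    have := hP _ y.property
    ext
    rw [← cancel_epi (adj.counit.app y.obj)]
    have h' : G.map f.hom = G.map g.hom := congrArg Q.ι.map h
    have e₁ := adj.counit.naturality f.hom
    have e₂ := adj.counit.naturality g.hom
    dsimp at e₁ e₂
    rw [← e₁, ← e₂, h']⟩
  full := ⟨fun {y z} k => by
    have := hP _ y.property
    -- The preimage is `L.map k.hom` read through the counits; only the one at `y` has to be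
    -- inverted.
    refine ⟨ObjectProperty.homMk (inv (adj.counit.app y.obj) ≫ L.map k.hom ≫
      adj.counit.app z.obj), ?_⟩
    ext
    apply (adj.homEquiv _ _).symm.injective
    rw [Adjunction.homEquiv_counit, Adjunction.homEquiv_counit]
    have e := adj.counit.naturality
      (inv (adj.counit.app y.obj) ≫ L.map k.hom ≫ adj.counit.app z.obj)
    refine e.trans ?_
    simp⟩
  essSurj := ⟨fun x => by
    have := hQ _ x.property
    exact ⟨⟨L.obj x.obj, hL _ x.property⟩, ⟨Q.isoMk (asIso (adj.unit.app x.obj)).symm⟩⟩⟩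

section Quillen

variable {C D : Type*} [Category* C] [Category* D] [ModelCategory C] [ModelCategory D]

/-- A criterion for the right derived functor of a right Quillen functor which preserves
weak equivalences to induce an equivalence between full subcategories of homotopy categories. -/
lemma exists_isEquivalence_lift_of_adjunction {L : D ⥤ C} {G : C ⥤ D} (adj : L ⊣ G)
    (hL : InvertsCofibrant (L ⋙ toHo C))
    (GH : Ho C ⥤ Ho D) (e : toHo C ⋙ GH ≅ G ⋙ toHo D)
    (P : ObjectProperty (Ho C)) (Q : ObjectProperty (Ho D))
    [P.IsClosedUnderIsomorphisms] [Q.IsClosedUnderIsomorphisms]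
    (hPQ : ∀ y, P ((toHo C).obj y) → Q ((toHo D).obj (G.obj y)))
    (h₁ : ∀ x, IsCofibrant x → Q ((toHo D).obj x) →
      P ((toHo C).obj (L.obj x)) ∧ WeakEquivalence (adj.unit.app x))
    (h₂ : ∀ y x (p : x ⟶ G.obj y), IsCofibrant x → WeakEquivalence p → P ((toHo C).obj y) →
      WeakEquivalence ((adj.homEquiv _ _).symm p)) :
    ∃ h, (Q.lift (P.ι ⋙ GH) h).IsEquivalence := by
  obtain ⟨LH, α, hα, hα'⟩ := exists_leftDerivedFunctor_isIso (L := toHo D) hL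
  let β := e.inv
  have hGH : ∀ y, P y → Q (GH.obj y) := fun y hy => by
    have := Localization.essSurj (toHo C) (weakEquivalences C)
    have hy' := P.prop_of_iso ((toHo C).objObjPreimageIso y).symm hy
    exact Q.prop_of_iso ((e.symm.app _).trans (GH.mapIso ((toHo C).objObjPreimageIso y)))
      (hPQ _ hy')
  -- By `e`, the functor `G ⋙ toHo D` already factors through `Ho C`, so `GH` is its right derived
  -- functor without fibrant replacement.
  have : GH.IsRightDerivedFunctor β (weakEquivalences C) :=
    Functor.isRightDerivedFunctor_of_inverts _ GH e
  have : (LH ⋙ GH).IsLeftDerivedFunctor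
      ((Functor.associator _ _ _).inv ≫ Functor.whiskerRight α GH) (weakEquivalences D) := by
    apply isLeftDerivedFunctor_of_isIso_app
    · intro X Y f hX hY hf
      have := hL f hX hY hf
      dsimp only [Functor.comp_map] at this ⊢
      infer_instance
    · intro X hX
      have := hα' X hX
      simp only [NatTrans.comp_app, Functor.whiskerRight_app, Functor.associator_inv_app]
      infer_instance
  have : (GH ⋙ LH).IsRightDerivedFunctor
      (Functor.whiskerRight β LH ≫ (Functor.associator _ _ _).hom) (weakEquivalences C) :=
    Functor.isRightDerivedFunctor_of_inverts _ (GH ⋙ LH)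
      ((Functor.associator _ _ _).symm ≪≫ Functor.isoWhiskerRight e LH)
  let adj' : LH ⊣ GH := adj.derived (weakEquivalences D) (weakEquivalences C) α β
  refine ⟨fun y => hGH _ y.property, isEquivalence_lift_of_adjunction adj' P Q _ ?_ ?_ ?_⟩
  · intro x hx
    let L' := CofibrantObject.ι ⋙ toHo D
    have := Localization.essSurj L' (weakEquivalences (CofibrantObject D))
    have := hα' _ (L'.objPreimage x).2
    exact P.prop_of_iso ((asIso (α.app (L'.objPreimage x).obj)).symm.trans
      (LH.mapIso (L'.objObjPreimageIso x)))
      (h₁ _ (L'.objPreimage x).2 (Q.prop_of_iso (L'.objObjPreimageIso x).symm hx)).1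
  · intro y hy
    have := Localization.essSurj (toHo C) (weakEquivalences C)
    refine (NatTrans.isIso_app_iff_of_iso adj'.counit ((toHo C).objObjPreimageIso y)).1 ?_
    have hy' := P.prop_of_iso ((toHo C).objObjPreimageIso y).symm hy
    generalize (toHo C).objPreimage y = y at hy'
    -- Up to the invertible `α`, the derived counit precomposed with the image of the resolution `p`
    -- is the transpose of `p`, which is a weak equivalence by `h₂`.
    obtain ⟨x, p, hx, _, hp⟩ := exists_cofibrant_resolution (G.obj y)
    have hw := h₂ y x p hx hp hy'
    have e₁ := adj.derivedε_fac_app (weakEquivalences C) α β y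
    have e₂ := α.naturality p
    have := isIso_toHo_map p hp
    have := isIso_toHo_map _ hw
    have := hα' x hx
    have h₃ : IsIso (LH.map ((toHo D).map p) ≫ LH.map (β.app y) ≫ adj'.counit.app ((toHo C).obj y)) := by
      have : LH.map ((toHo D).map p) ≫ LH.map (β.app y) ≫ adj'.counit.app ((toHo C).obj y) =
          α.app x ≫ (toHo C).map ((adj.homEquiv _ _).symm p) := by
        rw [Adjunction.homEquiv_counit, Functor.map_comp]
        refine (LH.map ((toHo D).map p) ≫= e₁).trans ?_
        exact (reassoc_of% e₂) _
      rw [this]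
      infer_instance
    have h₄ := IsIso.of_isIso_comp_left (LH.map ((toHo D).map p))
      (LH.map (β.app y) ≫ adj'.counit.app ((toHo C).obj y))
    exact IsIso.of_isIso_comp_left (LH.map (β.app y)) _
  · intro x hx
    let L' := CofibrantObject.ι ⋙ toHo D
    have := Localization.essSurj L' (weakEquivalences (CofibrantObject D))
    refine (NatTrans.isIso_app_iff_of_iso adj'.unit (L'.objObjPreimageIso x)).1 ?_
    have hx' := Q.prop_of_iso (L'.objObjPreimageIso x).symm hx
    have := hα' _ (L'.objPreimage x).2
    have := isIso_toHo_map _ (h₁ _ (L'.objPreimage x).2 hx').2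
    have e₁ := adj.derivedη_fac_app (weakEquivalences D) α β (L'.objPreimage x).obj
    have h₃ : IsIso (adj'.unit.app (L'.obj (L'.objPreimage x)) ≫
        GH.map (α.app (L'.objPreimage x).obj)) := by
      refine (congrArg (fun f => IsIso f) e₁).mpr ?_
      infer_instance
    exact IsIso.of_isIso_comp_right _ (GH.map (α.app (L'.objPreimage x).obj))

/-- The zigzag `S ⋙ L ⟶ T ⟵ 𝟭 D` makes the derived functor of `S` a quasi-inverse of `LH` on `P`.
The class `K` is there because `L` need not preserve cofibrant objects: it contains them and the
values of `L` on them, and `S` and `T` preserve weak equivalences inside it. -/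
lemma exists_isEquivalence_lift_of_zigzag (L : C ⥤ D) (S : D ⥤ C) (T : D ⥤ D)
    (K : ObjectProperty D) (hK : ∀ x, IsCofibrant x → K x)
    (hL : ∀ {X Y : C} (f : X ⟶ Y), IsCofibrant X → IsCofibrant Y → WeakEquivalence f →
      WeakEquivalence (L.map f)) (hLK : ∀ X, IsCofibrant X → K (L.obj X))
    (hS : ∀ {X Y : D} (f : X ⟶ Y), K X → K Y → WeakEquivalence f → WeakEquivalence (S.map f))
    (hSK : ∀ X, K X → IsCofibrant (S.obj X))
    (hT : ∀ {X Y : D} (f : X ⟶ Y), K X → K Y → WeakEquivalence f → WeakEquivalence (T.map f))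
    (i : L ⋙ S ≅ 𝟭 C) (a : S ⋙ L ⟶ T) (b : 𝟭 D ⟶ T) (P : ObjectProperty (Ho D))
    [P.IsClosedUnderIsomorphisms] (hPL : ∀ X, IsCofibrant X → P ((toHo D).obj (L.obj X)))
    (hab : ∀ x, IsCofibrant x → P ((toHo D).obj x) →
      WeakEquivalence (a.app x) ∧ WeakEquivalence (b.app x))
    (LH : Ho C ⥤ Ho D) (α : toHo C ⋙ LH ⟶ L ⋙ toHo D)
    [LH.IsLeftDerivedFunctor α (weakEquivalences C)] :
    ∃ h, (P.lift LH h).IsEquivalence := by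
  have hL' : InvertsCofibrant (L ⋙ toHo D) := fun f hX hY hf => isIso_toHo_map _ (hL f hX hY hf)
  have hS' : InvertsCofibrant (S ⋙ toHo C) := fun f hX hY hf =>
    isIso_toHo_map _ (hS f (hK _ hX) (hK _ hY) hf)
  have hα := isIso_leftDerived_app α hL'
  obtain ⟨SH, σ, _, _⟩ := exists_leftDerivedFunctor_isIso (L := toHo D) hS'
  -- `L.obj X` is only known to satisfy `K`, so the derived functor of `S` has to be computed on all
  -- of `K`.
  have hσ : ∀ x, K x → IsIso (σ.app x) := fun x hx => by
    obtain ⟨x', p, hx', _, hp⟩ := exists_cofibrant_resolution x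
    exact isIso_leftDerived_app_of_resolution σ hS' p hx' hp
      (isIso_toHo_map _ (hS p (hK _ hx') hx hp))
  let ιC : CofibrantObject C ⥤ Ho C := CofibrantObject.ι ⋙ toHo C
  let ιD : CofibrantObject D ⥤ Ho D := CofibrantObject.ι ⋙ toHo D
  have hessC : ιC.EssSurj := Localization.essSurj ιC (weakEquivalences (CofibrantObject C))
  have hessD : ιD.EssSurj := Localization.essSurj ιD (weakEquivalences (CofibrantObject D))
  have hP : ∀ X, P (LH.obj X) := fun X => by
    have := hα _ (ιC.objPreimage X).2
    exact P.prop_of_iso ((asIso (α.app (ιC.objPreimage X).obj)).symm.trans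
      (LH.mapIso (ιC.objObjPreimageIso X))) (hPL _ (ιC.objPreimage X).2)
  -- the composition `LH ⋙ SH` is isomorphic to the identity
  let e₁ : ιC ⋙ LH ⋙ SH ≅ ιC ⋙ 𝟭 _ :=
    NatIso.ofComponents (fun X =>
      have := hα _ X.2
      have := hσ _ (hLK _ X.2)
      SH.mapIso (asIso (α.app X.obj)) ≪≫ asIso (σ.app (L.obj X.obj)) ≪≫
        (toHo C).mapIso (i.app X.obj)) (fun {X Y} f => by
      have h₁ := SH.congr_map (α.naturality f.hom)
      have h₂ := σ.naturality (L.map f.hom)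
      have h₃ := (toHo C).congr_map (i.hom.naturality f.hom)
      simp only [Functor.comp_map, Functor.map_comp, Functor.id_map, Iso.trans_hom,
        Functor.mapIso_hom, asIso_hom, assoc, Iso.app_hom, ObjectProperty.ι_map, ιC] at h₁ h₂ h₃ ⊢
      rw [reassoc_of% h₁, reassoc_of% h₂, h₃])
  let e₂ : LH ⋙ SH ≅ 𝟭 _ :=
    Localization.liftNatIso ιC (weakEquivalences (CofibrantObject C)) (ιC ⋙ LH ⋙ SH) (ιC ⋙ 𝟭 _)
      _ _ e₁
  -- the functor induced by `T`
  have hTι : (weakEquivalences (CofibrantObject D)).IsInvertedBy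
      (CofibrantObject.ι ⋙ T ⋙ toHo D) := fun X Y f hf =>
    isIso_toHo_map _ (hT f.hom (hK _ X.2) (hK _ Y.2) ((weakEquivalence_iff _).2 hf))
  let TH : Ho D ⥤ Ho D := Localization.lift _ hTι ιD
  let τ : ιD ⋙ TH ≅ CofibrantObject.ι ⋙ T ⋙ toHo D := Localization.fac _ hTι ιD
  -- Cofibrant objects already localize to `Ho D`, so the two legs of the zigzag are built on them
  -- and then extended.
  let u₁ : ιD ⋙ SH ⋙ LH ⟶ ιD ⋙ TH :=
    { app := fun x => LH.map (σ.app x.obj) ≫ α.app (S.obj x.obj) ≫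
        (toHo D).map (a.app x.obj) ≫ τ.inv.app x
      naturality := fun {x y} f => by
        have h₁ := LH.congr_map (σ.naturality f.hom)
        have h₂ := α.naturality (S.map f.hom)
        have h₃ := (toHo D).congr_map (a.naturality f.hom)
        have h₄ := τ.inv.naturality f
        simp only [Functor.comp_map, Functor.map_comp, assoc, ObjectProperty.ι_map, ιD] at h₁ h₂ h₃ h₄ ⊢
        rw [reassoc_of% h₁, reassoc_of% h₂, reassoc_of% h₃]
        erw [h₄] }
  let v₁ : ιD ⋙ 𝟭 _ ⟶ ιD ⋙ TH :=
    { app := fun x => (toHo D).map (b.app x.obj) ≫ τ.inv.app x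
      naturality := fun {x y} f => by
        have h₃ := (toHo D).congr_map (b.naturality f.hom)
        have h₄ := τ.inv.naturality f
        simp only [Functor.comp_map, Functor.id_map, Functor.map_comp, assoc, ObjectProperty.ι_map, ιD] at h₃ h₄ ⊢
        rw [reassoc_of% h₃]
        erw [h₄] }
  let u : SH ⋙ LH ⟶ TH :=
    Localization.liftNatTrans ιD (weakEquivalences (CofibrantObject D)) _ _ _ _ u₁
  let v : 𝟭 _ ⟶ TH :=
    Localization.liftNatTrans ιD (weakEquivalences (CofibrantObject D)) (ιD ⋙ 𝟭 _) (ιD ⋙ TH)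
      _ _ v₁
  have hu : ∀ x, P x → IsIso (u.app x) := fun x hx => by
    refine (NatTrans.isIso_app_iff_of_iso u (ιD.objObjPreimageIso x)).1 ?_
    have := isIso_toHo_map _
      (hab _ (ιD.objPreimage x).2 (P.prop_of_iso (ιD.objObjPreimageIso x).symm hx)).1
    have := hσ _ (hK _ (ιD.objPreimage x).2)
    have := hα _ (hSK _ (hK _ (ιD.objPreimage x).2))
    have : IsIso (u₁.app (ιD.objPreimage x)) := by
      dsimp only [u₁]
      infer_instance
    rw [Localization.liftNatTrans_app]
    infer_instance
  have hv : ∀ x, P x → IsIso (v.app x) := fun x hx => by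
    refine (NatTrans.isIso_app_iff_of_iso v (ιD.objObjPreimageIso x)).1 ?_
    have := isIso_toHo_map _
      (hab _ (ιD.objPreimage x).2 (P.prop_of_iso (ιD.objObjPreimageIso x).symm hx)).2
    have : IsIso (v₁.app (ιD.objPreimage x)) := by
      dsimp only [v₁]
      infer_instance
    rw [Localization.liftNatTrans_app]
    infer_instance
  let E := CategoryTheory.Equivalence.mk (P.lift LH hP) (P.ι ⋙ SH) e₂.symm
    (NatIso.ofComponents (fun x =>
      have := hu _ x.property
      have := hv _ x.property
      P.isoMk (asIso (u.app x.obj) ≪≫ (asIso (v.app x.obj)).symm)) (fun {x y} f => by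
        have := hu _ x.property
        have := hv _ x.property
        have := hv _ y.property
        ext
        have h₁ := u.naturality f.hom
        have h₂ := v.naturality f.hom
        dsimp at h₁ h₂
        change LH.map (SH.map f.hom) ≫ u.app y.obj ≫ inv (v.app y.obj) =
          (u.app x.obj ≫ inv (v.app x.obj)) ≫ f.hom
        rw [← cancel_mono (v.app y.obj)]
        simp only [assoc, IsIso.inv_hom_id, comp_id, h₂, IsIso.inv_hom_id_assoc]
        exact h₁))
  exact ⟨hP, E.isEquivalence_functor⟩

end Quillen

/-! ### Calculus of morphisms lying over a morphism of the index category -/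

namespace Diagram

variable {I : Type w} [Category.{w'} I] (ω : Diagram.{v, u} I)

instance isLeftAdjoint_push {i j : I} (f : i ⟶ j) : (ω.push f).IsLeftAdjoint :=
  LeftQuillenFunctor.isLeftAdjoint (ω.map f.toLoc)

lemma cofibration_push_map {i j : I} (f : i ⟶ j) {X Y : ω.fib i} (g : X ⟶ Y)
    (hg : Cofibration g) : Cofibration ((ω.push f).map g) :=
  LeftQuillenFunctor.cofibration_map (ω.map f.toLoc) g hg

lemma weakEquivalence_push_map {i j : I} (f : i ⟶ j) {X Y : ω.fib i} (g : X ⟶ Y)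
    (hX : IsCofibrant X) (hY : IsCofibrant Y) (hg : WeakEquivalence g) :
    WeakEquivalence ((ω.push f).map g) :=
  ModCat.weakEquivalence_map (ω.map f.toLoc) g hX hY hg

lemma isCofibrant_push_obj {i j : I} (f : i ⟶ j) {X : ω.fib i} (hX : IsCofibrant X) :
    IsCofibrant ((ω.push f).obj X) := by
  have h : IsInitial ((ω.push f).obj (⊥_ _)) := IsInitial.isInitialObj _ _ initialIsInitial
  rw [isCofibrant_iff_of_isInitial ((ω.push f).map (initial.to X)) h]
  exact ω.cofibration_push_map f _ hX

/-- The composition of a morphism `ω(f)(a) ⟶ b` over `f` and of a morphism `ω(g)(b) ⟶ c`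
over `g`, as a morphism over `f ≫ g`. -/
def comp {i j k : I} (f : i ⟶ j) (g : j ⟶ k) (fg : i ⟶ k) (h : f ≫ g = fg) {a : ω.fib i}
    {b : ω.fib j} {c : ω.fib k} (α : (ω.push f).obj a ⟶ b) (β : (ω.push g).obj b ⟶ c) :
    (ω.push fg).obj a ⟶ c :=
  (ω.pushComp' f g fg h).hom.app a ≫ (ω.push g).map α ≫ β

lemma pushComp'_hom_assoc {i j k l : I} (f : i ⟶ j) (g : j ⟶ k) (h : k ⟶ l) (fg : i ⟶ k)
    (gh : j ⟶ l) (fgh : i ⟶ l) (h₁ : f ≫ g = fg) (h₂ : fg ≫ h = fgh) (h₃ : f ≫ gh = fgh)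
    (h₄ : g ≫ h = gh) (a : ω.fib i) :
    (ω.pushComp' fg h fgh h₂).hom.app a ≫ (ω.push h).map ((ω.pushComp' f g fg h₁).hom.app a) =
      (ω.pushComp' f gh fgh h₃).hom.app a ≫ (ω.pushComp' g h gh h₄).hom.app _ := by
  subst h₄
  have e := ω.pushComp'_comp_inv_app f g h fg fgh h₁ h₂ h₃ a
  rw [← cancel_epi ((ω.pushComp' f (g ≫ h) fgh h₃).inv.app a), Iso.inv_hom_id_app_assoc, e,
    ← pushComp'_eq_pushComp]
  simp [← Functor.map_comp]

/-- This is associativity in the Grothendieck construction of `ω`. Together with the unit laws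
`comp_pushId'` and `pushId'_comp` it absorbs the coherence of the pseudofunctor. Composites are
variables subject to an equation, which avoids transports between the functors `ω.push`. -/
lemma comp_assoc {i j k l : I} (f : i ⟶ j) (g : j ⟶ k) (h : k ⟶ l) (fg : i ⟶ k)
    (gh : j ⟶ l) (fgh : i ⟶ l) (h₁ : f ≫ g = fg) (h₂ : fg ≫ h = fgh) (h₃ : f ≫ gh = fgh)
    (h₄ : g ≫ h = gh) {a : ω.fib i} {b : ω.fib j} {c : ω.fib k} {d : ω.fib l}
    (α : (ω.push f).obj a ⟶ b) (β : (ω.push g).obj b ⟶ c) (γ : (ω.push h).obj c ⟶ d) :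
    ω.comp fg h fgh h₂ (ω.comp f g fg h₁ α β) γ = ω.comp f gh fgh h₃ α (ω.comp g h gh h₄ β γ) := by
  have e := ω.pushComp'_hom_assoc f g h fg gh fgh h₁ h₂ h₃ h₄ a
  have e' := (ω.pushComp' g h gh h₄).hom.naturality α
  simp only [Functor.comp_map] at e'
  simp only [comp, Functor.map_comp, assoc]
  rw [reassoc_of% e, reassoc_of% e']

variable {ω} in
lemma comp_comp {i j k : I} {f : i ⟶ j} {g : j ⟶ k} {fg : i ⟶ k} {h : f ≫ g = fg}
    {a : ω.fib i} {b : ω.fib j} {c d : ω.fib k} (α : (ω.push f).obj a ⟶ b)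
    (β : (ω.push g).obj b ⟶ c) (γ : c ⟶ d) :
    ω.comp f g fg h α (β ≫ γ) = ω.comp f g fg h α β ≫ γ := by
  simp [comp]

variable {ω} in
lemma comp_map_comp {i j k : I} {f : i ⟶ j} {g : j ⟶ k} {fg : i ⟶ k} {h : f ≫ g = fg}
    {a : ω.fib i} {b b' : ω.fib j} {c : ω.fib k} (α : (ω.push f).obj a ⟶ b)
    (β : b ⟶ b') (γ : (ω.push g).obj b' ⟶ c) :
    ω.comp f g fg h α ((ω.push g).map β ≫ γ) = ω.comp f g fg h (α ≫ β) γ := by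
  simp [comp]

variable {ω} in
lemma map_comp {i j k : I} {f : i ⟶ j} {g : j ⟶ k} {fg : i ⟶ k} {h : f ≫ g = fg}
    {a a' : ω.fib i} {b : ω.fib j} {c : ω.fib k} (α : a ⟶ a') (β : (ω.push f).obj a' ⟶ b)
    (γ : (ω.push g).obj b ⟶ c) :
    (ω.push fg).map α ≫ ω.comp f g fg h β γ = ω.comp f g fg h ((ω.push f).map α ≫ β) γ := by
  have e := (ω.pushComp' f g fg h).hom.naturality α
  simp only [Functor.comp_map] at e
  simp [comp, reassoc_of% e]

lemma comp_pushId' {i j : I} (f : i ⟶ j) (g : j ⟶ j) (hg : g = 𝟙 j) (h : f ≫ g = f)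
    {a : ω.fib i} {b : ω.fib j} (α : (ω.push f).obj a ⟶ b) :
    ω.comp f g f h α ((ω.pushId' g hg).hom.app b) = α := by
  subst hg
  have e := ω.pushComp'_id_inv_app f a
  have e' := (ω.pushId j).hom.naturality α
  simp only [Functor.id_map] at e'
  rw [pushId'_eq_pushId, comp, e', ← reassoc_of% e]
  simp

lemma pushId'_comp {i j : I} (f : i ⟶ i) (hf : f = 𝟙 i) (g : i ⟶ j) (h : f ≫ g = g)
    {a : ω.fib i} {b : ω.fib j} (β : (ω.push g).obj a ⟶ b) :
    ω.comp f g g h ((ω.pushId' f hf).hom.app a) β = β := by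
  subst hf
  have h' := ω.mapComp'_id_comp_hom g.toLoc
  have e : (ω.pushComp' (𝟙 i) g g h).hom.app a ≫ (ω.push g).map ((ω.pushId i).hom.app a) = 𝟙 _ := by
    have h₁ : (ω.pushComp' (𝟙 i) g g h).hom.app a = (ω.push g).map ((ω.pushId i).inv.app a) :=
      (congrArg (fun η => (ModCat.natIso η).hom.app a) h').trans ((id_comp _).trans
        (congrArg (ω.push g).map (ModCat.natIso_inv_hom_app (ω.mapId ⟨i⟩) a)))
    rw [h₁]
    exact ((ω.push g).map_comp _ _).symm.trans
      ((congrArg (ω.push g).map (Iso.inv_hom_id_app (ω.pushId i) a)).trans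
        ((ω.push g).map_id _))
  rw [pushId'_eq_pushId, comp, reassoc_of% e]

variable {ω} in
/-- Morphisms `ω(g)(ω(f)(a)) ⟶ c` are determined by the corresponding morphisms over `f ≫ g`. -/
lemma hom_ext_of_comp {i j k : I} (f : i ⟶ j) (g : j ⟶ k) (fg : i ⟶ k) (h : f ≫ g = fg)
    {a : ω.fib i} {c : ω.fib k} {β β' : (ω.push g).obj ((ω.push f).obj a) ⟶ c}
    (e : ω.comp f g fg h (𝟙 _) β = ω.comp f g fg h (𝟙 _) β') : β = β' := by
  simpa [comp] using e

/-- The morphism `ω(g)(ω(f)(a)) ⟶ c` corresponding to a morphism over `f ≫ g`. -/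
def desc {i j k : I} (f : i ⟶ j) (g : j ⟶ k) (fg : i ⟶ k) (h : f ≫ g = fg)
    {a : ω.fib i} {c : ω.fib k} (γ : (ω.push fg).obj a ⟶ c) :
    (ω.push g).obj ((ω.push f).obj a) ⟶ c :=
  (ω.pushComp' f g fg h).inv.app a ≫ γ

lemma comp_desc {i j k : I} (f : i ⟶ j) (g : j ⟶ k) (fg : i ⟶ k) (h : f ≫ g = fg)
    {a : ω.fib i} {c : ω.fib k} (γ : (ω.push fg).obj a ⟶ c) :
    ω.comp f g fg h (𝟙 _) (ω.desc f g fg h γ) = γ := by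
  simp [comp, desc]

end Diagram

namespace Sect

variable {I : Type w} [Category.{w'} I] {ω : Diagram.{v, u} I}

lemma map_eq_comp (x : Sect ω) {i j k : I} (f : i ⟶ j) (g : j ⟶ k) (fg : i ⟶ k)
    (h : f ≫ g = fg) : x.map fg = ω.comp f g fg h (x.map f) (x.map g) :=
  x.map_comp' f g fg h

variable {I' : Type*} [Category* I'] {J : I' ⥤ I}

/-- The objects of a section of `ω.restrict J`, considered as objects of the fibers of `ω`. -/
def objOver (x : Sect (ω.restrict J)) (i : I') : ω.fib (J.obj i) := x.obj i

/-- The structure maps of a section of `ω.restrict J`. -/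
def mapOver (x : Sect (ω.restrict J)) {i j : I'} (f : i ⟶ j) :
    (ω.push (J.map f)).obj (x.objOver i) ⟶ x.objOver j :=
  x.map f

lemma mapOver_id (x : Sect (ω.restrict J)) (i : I') :
    x.mapOver (𝟙 i) = (ω.pushId' (J.map (𝟙 i)) (J.map_id i)).hom.app (x.objOver i) :=
  x.map_id i

lemma mapOver_comp (x : Sect (ω.restrict J)) {i j k : I'} (f : i ⟶ j) (g : j ⟶ k) :
    x.mapOver (f ≫ g) = ω.comp (J.map f) (J.map g) (J.map (f ≫ g)) (J.map_comp f g).symm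
      (x.mapOver f) (x.mapOver g) :=
  x.map_comp f g

/-- The components of a morphism between sections of `ω.restrict J`. -/
def appOver {x y : Sect (ω.restrict J)} (φ : x ⟶ y) (i : I') : x.objOver i ⟶ y.objOver i :=
  φ.app i

lemma appOver_naturality {x y : Sect (ω.restrict J)} (φ : x ⟶ y) {i j : I'} (f : i ⟶ j) :
    x.mapOver f ≫ appOver φ j = (ω.push (J.map f)).map (appOver φ i) ≫ y.mapOver f :=
  φ.naturality f

lemma hom_ext_over {x y : Sect (ω.restrict J)} {φ ψ : x ⟶ y}
    (h : ∀ i, appOver φ i = appOver ψ i) : φ = ψ :=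
  hom_ext h

/-- Constructor for morphisms of sections of `ω.restrict J`. -/
def homMkOver {x y : Sect (ω.restrict J)} (app : ∀ i, x.objOver i ⟶ y.objOver i)
    (naturality : ∀ {i j : I'} (f : i ⟶ j),
      x.mapOver f ≫ app j = (ω.push (J.map f)).map (app i) ≫ y.mapOver f) : x ⟶ y where
  app := app
  naturality := naturality

/-- Constructor for sections of `ω.restrict J`. -/
def mkOver (obj : ∀ i, ω.fib (J.obj i))
    (map : ∀ {i j : I'} (f : i ⟶ j), (ω.push (J.map f)).obj (obj i) ⟶ obj j)
    (map_id : ∀ i, map (𝟙 i) = (ω.pushId' (J.map (𝟙 i)) (J.map_id i)).hom.app (obj i))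
    (map_comp : ∀ {i j k : I'} (f : i ⟶ j) (g : j ⟶ k),
      map (f ≫ g) = ω.comp (J.map f) (J.map g) (J.map (f ≫ g)) (J.map_comp f g).symm
        (map f) (map g)) : Sect (ω.restrict J) where
  obj := obj
  map := map
  map_id := map_id
  map_comp := map_comp

end Sect

/-- Trivial fibrations are the maps with the right lifting property against cofibrations, and
lifting problems transpose along `adj`. -/
lemma trivialFibration_map_of_adjunction {C D : Type*} [Category* C] [Category* D]
    [ModelCategory C] [ModelCategory D] {L : C ⥤ D} {G : D ⥤ C} (adj : L ⊣ G)
    (hL : ∀ {X Y : C} (i : X ⟶ Y), Cofibration i → Cofibration (L.map i)) {X Y : D} (p : X ⟶ Y)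
    (hp : Fibration p) (hp' : WeakEquivalence p) :
    Fibration (G.map p) ∧ WeakEquivalence (G.map p) := by
  have h : trivialFibrations C (G.map p) := by
    rw [← cofibrations_rlp]
    intro A B i hi
    have := hL i ((cofibration_iff i).2 hi)
    exact (adj.hasLiftingProperty_iff i p).1 inferInstance
  exact ⟨(fibration_iff _).2 h.1, (weakEquivalence_iff _).2 h.2⟩

lemma trivialFibration_piMap {C ι : Type*} [Category* C] [ModelCategory C] {X Y : ι → C}
    [HasProduct X] [HasProduct Y] (f : ∀ i, X i ⟶ Y i) (hf : ∀ i, Fibration (f i))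
    (hf' : ∀ i, WeakEquivalence (f i)) :
    Fibration (Limits.Pi.map f) ∧ WeakEquivalence (Limits.Pi.map f) :=
  ⟨inferInstance, inferInstance⟩

/-! ### Projectively cofibrant sections and coinduction -/

namespace Sect

/-- A section is projectively cofibrant if it lifts against objectwise trivial fibrations. -/
def IsProjCofibrant {I : Type w} [Category.{w'} I] {ω : Diagram.{v, u} I} (x : Sect ω) : Prop :=
  ∀ ⦃y y' : Sect ω⦄ (p : y ⟶ y'), (∀ i, Fibration (p.app i)) → (∀ i, WeakEquivalence (p.app i)) →
    ∀ φ : x ⟶ y', ∃ ψ : x ⟶ y, ψ ≫ p = φ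

variable {I I' : Type} [SmallCategory I] [SmallCategory I'] {ω : Diagram.{v, u} I} {J : I' ⥤ I}

/-- The diagram `k ↦ ω(k)(x_i)` indexed by the morphisms `k : J(i) ⟶ j`. -/
def costructured (x : Sect (ω.restrict J)) (j : I) : CostructuredArrow J j ⥤ ω.fib j where
  obj k := (ω.push k.hom).obj (x.objOver k.left)
  map {k k'} h := ω.comp (J.map h.left) k'.hom k.hom (CostructuredArrow.w h) (x.mapOver h.left)
    (𝟙 _)
  map_id k := by
    have e := x.mapOver_id k.left
    exact (congrArg (fun t => ω.comp _ _ _ _ t _) e).trans (ω.pushId'_comp _ _ _ _ _)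
  map_comp {k k' k''} h h' := by
    rw [← Diagram.comp_comp, id_comp]
    have e := x.mapOver_comp h.left h'.left
    exact (congrArg (fun t => ω.comp _ _ _ _ t _) e).trans
      (ω.comp_assoc _ _ _ _ _ _ _ _ _ _ _ _ _)

/-- The components of a morphism from a diagram `x.costructured j`. -/
def costructuredApp {x : Sect (ω.restrict J)} {j : I} {Y : CostructuredArrow J j ⥤ ω.fib j}
    (θ : x.costructured j ⟶ Y) {r : I'} (f : J.obj r ⟶ j) :
    (ω.push f).obj (x.objOver r) ⟶ Y.obj (CostructuredArrow.mk f) :=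
  θ.app (CostructuredArrow.mk f)

lemma comp_costructured_map {x : Sect (ω.restrict J)} {j : I} {k k' : CostructuredArrow J j}
    (h : k ⟶ k') {c : ω.fib j} (β : (ω.push k'.hom).obj (x.objOver k'.left) ⟶ c) :
    (x.costructured j).map h ≫ β =
      ω.comp (J.map h.left) k'.hom k.hom (CostructuredArrow.w h) (x.mapOver h.left) β :=
  (Diagram.comp_comp _ _ _).symm.trans
    (congrArg (fun t => ω.comp _ _ _ (CostructuredArrow.w h) _ t) (id_comp β))

lemma comp_costructuredApp {x : Sect (ω.restrict J)} {j : I}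
    {Y : CostructuredArrow J j ⥤ ω.fib j} (θ : x.costructured j ⟶ Y) {r s : I'} (g : r ⟶ s)
    (f' : J.obj s ⟶ j) (f : J.obj r ⟶ j) (h : J.map g ≫ f' = f) :
    ω.comp (J.map g) f' f h (x.mapOver g) (costructuredApp θ f') = costructuredApp θ f ≫
      Y.map (CostructuredArrow.homMk g h : CostructuredArrow.mk f ⟶ CostructuredArrow.mk f') :=
  (comp_costructured_map (CostructuredArrow.homMk g h : CostructuredArrow.mk f ⟶
    CostructuredArrow.mk f') (costructuredApp θ f')).symm.trans (θ.naturality _)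

/-- Constructor for morphisms from a diagram `x.costructured j`. -/
def homOfCostructured {x : Sect (ω.restrict J)} {j : I} {Y : CostructuredArrow J j ⥤ ω.fib j}
    (τ : ∀ k : CostructuredArrow J j, (ω.push k.hom).obj (x.objOver k.left) ⟶ Y.obj k)
    (hτ : ∀ {k k' : CostructuredArrow J j} (h : k ⟶ k'),
      ω.comp (J.map h.left) k'.hom k.hom (CostructuredArrow.w h) (x.mapOver h.left) (τ k') =
        τ k ≫ Y.map h) : x.costructured j ⟶ Y where
  app := τ
  naturality _ _ h := (comp_costructured_map _ _).trans (hτ h)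

namespace coind

variable {j : I} (Y Y' : CostructuredArrow J j ⥤ ω.fib j)

/-- The objects of the section coinduced by a diagram indexed by `CostructuredArrow J j`. -/
noncomputable def obj (r : I') : ω.fib (J.obj r) :=
  ∏ᶜ fun f : (J.obj r ⟶ j) => (ω.push f).rightAdjoint.obj (Y.obj (CostructuredArrow.mk f))

/-- The projections from `coind.obj`, as morphisms to values of right adjoints. -/
noncomputable def proj {r : I'} (f : J.obj r ⟶ j) :
    obj Y r ⟶ (ω.push f).rightAdjoint.obj (Y.obj (CostructuredArrow.mk f)) :=
  Pi.π _ f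

/-- The projections from `coind.obj`. -/
noncomputable def π {r : I'} (f : J.obj r ⟶ j) :
    (ω.push f).obj (obj Y r) ⟶ Y.obj (CostructuredArrow.mk f) :=
  ((Adjunction.ofIsLeftAdjoint (ω.push f)).homEquiv _ _).symm (proj Y f)

/-- Constructor for morphisms to `coind.obj`. -/
noncomputable def lift {r : I'} {a : ω.fib (J.obj r)}
    (τ : ∀ f : (J.obj r ⟶ j), (ω.push f).obj a ⟶ Y.obj (CostructuredArrow.mk f)) :
    a ⟶ obj Y r :=
  Pi.lift fun f => (Adjunction.ofIsLeftAdjoint (ω.push f)).homEquiv _ _ (τ f)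

lemma map_lift_π {r : I'} {a : ω.fib (J.obj r)}
    (τ : ∀ f : (J.obj r ⟶ j), (ω.push f).obj a ⟶ Y.obj (CostructuredArrow.mk f))
    (f : J.obj r ⟶ j) : (ω.push f).map (lift Y τ) ≫ π Y f = τ f := by
  apply ((Adjunction.ofIsLeftAdjoint (ω.push f)).homEquiv _ _).injective
  rw [π, Adjunction.homEquiv_naturality_left, Equiv.apply_symm_apply]
  exact Limits.Pi.lift_π _ _

variable {Y} in
lemma hom_ext {r : I'} {a : ω.fib (J.obj r)} {v v' : a ⟶ obj Y r}
    (h : ∀ f : (J.obj r ⟶ j), (ω.push f).map v ≫ π Y f = (ω.push f).map v' ≫ π Y f) :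
    v = v' := by
  refine Pi.hom_ext _ _ fun f => ?_
  change v ≫ proj Y f = v' ≫ proj Y f
  apply ((Adjunction.ofIsLeftAdjoint (ω.push f)).homEquiv _ _).symm.injective
  rw [Adjunction.homEquiv_naturality_left_symm, Adjunction.homEquiv_naturality_left_symm]
  exact h f

variable {Y} in
lemma hom_ext_of_comp {i : I} {r : I'} (g : i ⟶ J.obj r) {a : ω.fib i}
    {v v' : (ω.push g).obj a ⟶ obj Y r}
    (h : ∀ f : (J.obj r ⟶ j), ω.comp g f _ rfl v (π Y f) = ω.comp g f _ rfl v' (π Y f)) :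
    v = v' := by
  refine hom_ext fun f => Diagram.hom_ext_of_comp g f _ rfl ?_
  rw [Diagram.comp_map_comp, Diagram.comp_map_comp, id_comp, id_comp]
  exact h f

/-- The structure maps of the coinduced section. -/
noncomputable def map {r s : I'} (g : r ⟶ s) : (ω.push (J.map g)).obj (obj Y r) ⟶ obj Y s :=
  lift Y fun f => ω.desc (J.map g) f _ rfl
    (π Y (J.map g ≫ f) ≫ Y.map (CostructuredArrow.homMk g rfl))

lemma comp_map_π {r s : I'} (g : r ⟶ s) (f' : J.obj s ⟶ j) (f : J.obj r ⟶ j)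
    (h : J.map g ≫ f' = f) :
    ω.comp (J.map g) f' f h (map Y g) (π Y f') =
      π Y f ≫ Y.map (CostructuredArrow.homMk g h :
        CostructuredArrow.mk f ⟶ CostructuredArrow.mk f') := by
  subst h
  rw [← id_comp (map Y g), ← Diagram.comp_map_comp, map, map_lift_π, Diagram.comp_desc]

end coind

variable {j : I}

/-- The section coinduced by a diagram indexed by `CostructuredArrow J j`. -/
noncomputable def coind (Y : CostructuredArrow J j ⥤ ω.fib j) : Sect (ω.restrict J) :=
  mkOver (coind.obj Y) (coind.map Y)
    (fun i => by
      refine coind.hom_ext_of_comp _ fun f => ?_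
      rw [coind.comp_map_π]
      -- `J.map (𝟙 i) ≫ f` is only propositionally equal to `f`; a free variable `f'` allows
      -- substitution.
      have : ∀ (f' : J.obj i ⟶ j) (h₁ : J.map (𝟙 i) ≫ f = f') (h : f' = f),
          coind.π Y f' ≫ Y.map (CostructuredArrow.homMk (𝟙 i) h₁ :
            CostructuredArrow.mk f' ⟶ CostructuredArrow.mk f) =
            ω.comp (J.map (𝟙 i)) f f' h₁
              ((ω.pushId' (J.map (𝟙 i)) (J.map_id i)).hom.app (coind.obj Y i)) (coind.π Y f) := by
        rintro _ h₁ rfl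
        rw [Diagram.pushId'_comp]
        exact (coind.π Y _ ≫= (Y.map_id _)).trans (comp_id _)
      exact this _ _ (by simp))
    (fun {r s t} g g' => by
      refine coind.hom_ext_of_comp _ fun f => ?_
      rw [coind.comp_map_π, ω.comp_assoc (J.map g) (J.map g') f (J.map (g ≫ g')) _ _ _ rfl
        (by simp) rfl, coind.comp_map_π, Diagram.comp_comp, coind.comp_map_π, assoc,
        ← Functor.map_comp]
      rfl)

variable {Y Y' : CostructuredArrow J j ⥤ ω.fib j}

/-- The functoriality of `coind.obj`. -/
noncomputable def coind.objMap (q : Y ⟶ Y') (r : I') : coind.obj Y r ⟶ coind.obj Y' r :=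
  Limits.Pi.map fun f => (ω.push f).rightAdjoint.map (q.app (CostructuredArrow.mk f))

lemma coind.map_objMap_π (q : Y ⟶ Y') {r : I'} (f : J.obj r ⟶ j) :
    (ω.push f).map (coind.objMap q r) ≫ coind.π Y' f =
      coind.π Y f ≫ q.app (CostructuredArrow.mk f) := by
  have h : coind.objMap q r ≫ coind.proj Y' f =
      coind.proj Y f ≫ (ω.push f).rightAdjoint.map (q.app (CostructuredArrow.mk f)) :=
    Limits.Pi.map_π _ _
  rw [coind.π, coind.π, ← Adjunction.homEquiv_naturality_left_symm, h,
    Adjunction.homEquiv_naturality_right_symm]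

lemma coind.map_objMap (q : Y ⟶ Y') {r s : I'} (g : r ⟶ s) :
    coind.map Y g ≫ coind.objMap q s =
      (ω.push (J.map g)).map (coind.objMap q r) ≫ coind.map Y' g := by
  refine coind.hom_ext_of_comp _ fun f => ?_
  rw [← Diagram.comp_map_comp, coind.map_objMap_π, Diagram.comp_comp, coind.comp_map_π,
    ← Diagram.map_comp, coind.comp_map_π, reassoc_of% (coind.map_objMap_π q), assoc, q.naturality]

/-- The functoriality of coinduced sections. -/
noncomputable def coindMap (q : Y ⟶ Y') : coind Y ⟶ coind Y' :=
  homMkOver (coind.objMap q) (coind.map_objMap q)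

/-- The components of the morphism to a coinduced section corresponding to a morphism
of diagrams. -/
noncomputable def coind.liftApp {x : Sect (ω.restrict J)} (θ : x.costructured j ⟶ Y) (r : I') :
    x.objOver r ⟶ coind.obj Y r :=
  coind.lift Y fun f => costructuredApp θ f

lemma coind.map_liftApp_π {x : Sect (ω.restrict J)} (θ : x.costructured j ⟶ Y) {r : I'}
    (f : J.obj r ⟶ j) :
    (ω.push f).map (coind.liftApp θ r) ≫ coind.π Y f = costructuredApp θ f :=
  coind.map_lift_π _ _ _

lemma coind.map_liftApp {x : Sect (ω.restrict J)} (θ : x.costructured j ⟶ Y) {r s : I'}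
    (g : r ⟶ s) :
    x.mapOver g ≫ coind.liftApp θ s =
      (ω.push (J.map g)).map (coind.liftApp θ r) ≫ coind.map Y g := by
  refine coind.hom_ext_of_comp _ fun f => ?_
  rw [← Diagram.comp_map_comp, coind.map_liftApp_π, ← Diagram.map_comp, coind.comp_map_π,
    ← assoc, coind.map_liftApp_π, comp_costructuredApp]

/-- The morphism to a coinduced section corresponding to a morphism of diagrams. -/
noncomputable def toCoind {x : Sect (ω.restrict J)} (θ : x.costructured j ⟶ Y) : x ⟶ coind Y :=
  homMkOver (coind.liftApp θ) (coind.map_liftApp θ)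

/-- The components of a morphism to a coinduced section. -/
def coind.app {x : Sect (ω.restrict J)} (φ : x ⟶ coind Y) (r : I') :
    x.objOver r ⟶ coind.obj Y r :=
  φ.app r

lemma coind.app_naturality {x : Sect (ω.restrict J)} (φ : x ⟶ coind Y) {r s : I'} (g : r ⟶ s) :
    x.mapOver g ≫ coind.app φ s = (ω.push (J.map g)).map (coind.app φ r) ≫ coind.map Y g :=
  φ.naturality g

/-- The morphism of diagrams corresponding to a morphism to a coinduced section. -/
noncomputable def ofCoind {x : Sect (ω.restrict J)} (φ : x ⟶ coind Y) :
    x.costructured j ⟶ Y :=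
  homOfCostructured (fun k => (ω.push k.hom).map (coind.app φ k.left) ≫ coind.π Y k.hom)
    (fun {k k'} h => by
      have e := coind.comp_map_π Y h.left k'.hom k.hom (CostructuredArrow.w h)
      rw [Diagram.comp_map_comp, coind.app_naturality, ← Diagram.map_comp, e, assoc]
      rfl)

/-- Right adjoints of the functors `ω.push f` preserve trivial fibrations, and so do products. -/
lemma coind.weakEquivalence_objMap (q : Y ⟶ Y') (hq : ∀ k, Fibration (q.app k))
    (hq' : ∀ k, WeakEquivalence (q.app k)) (r : I') :
    Fibration (coind.objMap q r) ∧ WeakEquivalence (coind.objMap q r) := by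
  have h := fun f : J.obj r ⟶ j =>
    trivialFibration_map_of_adjunction (Adjunction.ofIsLeftAdjoint (ω.push f))
      (ω.cofibration_push_map f) (q.app (CostructuredArrow.mk f)) (hq _) (hq' _)
  exact trivialFibration_piMap _ (fun f => (h f).1) (fun f => (h f).2)

/-- Coinduction is right adjoint to `x ↦ x.costructured j` and preserves objectwise trivial
fibrations, so the lifting problem for diagrams transposes to one for sections. -/
lemma IsProjCofibrant.exists_lift {x : Sect (ω.restrict J)} (hx : x.IsProjCofibrant)
    (q : Y ⟶ Y') (hq : ∀ k, Fibration (q.app k)) (hq' : ∀ k, WeakEquivalence (q.app k))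
    (θ : x.costructured j ⟶ Y') : ∃ θ' : x.costructured j ⟶ Y, θ' ≫ q = θ := by
  obtain ⟨ψ, hψ⟩ := hx (coindMap q) (fun r => (coind.weakEquivalence_objMap q hq hq' r).1)
    (fun r => (coind.weakEquivalence_objMap q hq hq' r).2) (toCoind θ)
  refine ⟨ofCoind ψ, ?_⟩
  ext k
  have e : coind.app ψ k.left ≫ coind.objMap q k.left = coind.liftApp θ k.left :=
    congrArg (fun φ => coind.app φ k.left) hψ
  have e' := coind.map_objMap_π q k.hom
  have e'' : ((ω.push k.hom).map (coind.app ψ k.left) ≫ coind.π Y k.hom) ≫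
      q.app (CostructuredArrow.mk k.hom) = costructuredApp θ k.hom := by
    rw [assoc, ← e', ← Functor.map_comp_assoc, e, coind.map_liftApp_π]
  exact e''

end Sect

/-! ### Colimits of projectively cofibrant diagrams over sieves -/

section SubColim

variable {K : Type} [SmallCategory K] {M : Type u} [Category.{v} M]

/-- A diagram is projectively cofibrant if it lifts against objectwise trivial fibrations. -/
def IsProjCofibrantDiagram [ModelCategory M] (X : K ⥤ M) : Prop :=
  ∀ ⦃Y Y' : K ⥤ M⦄ (q : Y ⟶ Y'), (∀ k, Fibration (q.app k)) → (∀ k, WeakEquivalence (q.app k)) →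
    ∀ θ : X ⟶ Y', ∃ θ' : X ⟶ Y, θ' ≫ q = θ

/-- Objects which are sources of morphisms to objects satisfying `S` also satisfy `S`. -/
abbrev IsSieve (S : ObjectProperty K) : Prop := ∀ ⦃k k' : K⦄, (k ⟶ k') → S k' → S k

section coext

variable [HasLimits M]

namespace coext

/-- The values of the diagram `coext`. -/
noncomputable def obj (U : M) (S : ObjectProperty K) (k : K) : M :=
  ∏ᶜ fun _ : PLift (S k) => U

/-- The projection from `coext.obj` to `U`. -/
noncomputable def π (U : M) (S : ObjectProperty K) (k : K) (h : S k) : obj U S k ⟶ U :=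
  Pi.π _ ⟨h⟩

/-- Constructor for morphisms to `coext.obj`. -/
noncomputable def lift {U Z : M} {S : ObjectProperty K} {k : K} (τ : S k → (Z ⟶ U)) :
    Z ⟶ obj U S k :=
  Pi.lift fun h => τ h.down

@[simp]
lemma lift_π {U Z : M} {S : ObjectProperty K} {k : K} (τ : S k → (Z ⟶ U)) (h : S k) :
    lift τ ≫ π U S k h = τ h :=
  Limits.Pi.lift_π _ _

@[simp]
lemma lift_π_assoc {U Z Z' : M} {S : ObjectProperty K} {k : K} (τ : S k → (Z ⟶ U)) (h : S k)
    (g : U ⟶ Z') : lift τ ≫ π U S k h ≫ g = τ h ≫ g := by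
  rw [← assoc, lift_π]

lemma hom_ext {U Z : M} {S : ObjectProperty K} {k : K} {a b : Z ⟶ obj U S k}
    (h : ∀ hk, a ≫ π U S k hk = b ≫ π U S k hk) : a = b :=
  Pi.hom_ext _ _ fun hk => h hk.down

end coext

/-- The transition maps of the diagram `coext`. -/
noncomputable def coext.map (U : M) {S : ObjectProperty K} (hS : IsSieve S) {k k' : K}
    (f : k ⟶ k') : coext.obj U S k ⟶ coext.obj U S k' :=
  coext.lift fun h => coext.π U S k (hS f h)

@[simp]
lemma coext.map_π (U : M) {S : ObjectProperty K} (hS : IsSieve S) {k k' : K}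
    (f : k ⟶ k') (h : S k') : coext.map U hS f ≫ coext.π U S k' h = coext.π U S k (hS f h) :=
  coext.lift_π _ _

@[simp]
lemma coext.map_π_assoc (U : M) {S : ObjectProperty K} (hS : IsSieve S) {k k' : K}
    (f : k ⟶ k') (h : S k') {Z : M} (g : U ⟶ Z) :
    coext.map U hS f ≫ coext.π U S k' h ≫ g = coext.π U S k (hS f h) ≫ g := by
  rw [← assoc, map_π]

/-- The diagram whose value is the object `U` at the objects in the sieve `S` and the terminal
object otherwise. -/
noncomputable def coext (U : M) {S : ObjectProperty K} (hS : IsSieve S) : K ⥤ M where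
  obj k := coext.obj U S k
  map f := coext.map U hS f
  map_id _ := coext.hom_ext fun _ => by simp
  map_comp _ _ := coext.hom_ext fun _ => by simp

/-- The morphism `coext.obj U T k ⟶ coext.obj V S k` induced by `p : U ⟶ V`. -/
noncomputable def coext.objMap {U V : M} (p : U ⟶ V) {S T : ObjectProperty K} (hST : S ≤ T)
    (k : K) : coext.obj U T k ⟶ coext.obj V S k :=
  coext.lift fun h => coext.π U T k (hST k h) ≫ p

@[simp]
lemma coext.objMap_π {U V : M} (p : U ⟶ V) {S T : ObjectProperty K} (hST : S ≤ T) (k : K)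
    (h : S k) : coext.objMap p hST k ≫ coext.π V S k h = coext.π U T k (hST k h) ≫ p :=
  coext.lift_π _ _

@[simp]
lemma coext.objMap_π_assoc {U V Z : M} (p : U ⟶ V) {S T : ObjectProperty K} (hST : S ≤ T) (k : K)
    (h : S k) (g : V ⟶ Z) :
    coext.objMap p hST k ≫ coext.π V S k h ≫ g = coext.π U T k (hST k h) ≫ p ≫ g := by
  rw [← assoc, objMap_π, assoc]

/-- The functoriality of `coext`. -/
noncomputable def coextMap {U V : M} (p : U ⟶ V) {S T : ObjectProperty K} (hS : IsSieve S)
    (hT : IsSieve T) (hST : S ≤ T) : coext U hT ⟶ coext V hS where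
  app k := coext.objMap p hST k
  naturality k k' f := by
    change coext.map U hT f ≫ coext.objMap p hST k' = coext.objMap p hST k ≫ coext.map V hS f
    exact coext.hom_ext fun _ => by simp

/-- Morphisms from a diagram to `coext` given by a cocone on the sieve. -/
noncomputable def toCoext {U : M} {S : ObjectProperty K} (hS : IsSieve S) {X : K ⥤ M}
    (τ : ∀ k, S k → (X.obj k ⟶ U))
    (hτ : ∀ {k k'} (f : k ⟶ k') hk hk', X.map f ≫ τ k' hk' = τ k hk) : X ⟶ coext U hS where
  app k := coext.lift (τ k)
  naturality k k' f := by
    change X.map f ≫ coext.lift (τ k') = coext.lift (τ k) ≫ coext.map U hS f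
    exact coext.hom_ext fun h => by simp [hτ f (hS f h) h]

lemma isIso_coextMap_id_app (U : M) {S T : ObjectProperty K} (hS : IsSieve S)
    (hT : IsSieve T) (hST : S ≤ T) (k : K) (h : T k → S k) :
    IsIso ((coextMap (𝟙 U) hS hT hST).app k) :=
  ⟨coext.lift fun h' => coext.π U S k (h h'), by
    change coext.objMap _ _ _ ≫ coext.lift _ = 𝟙 (coext.obj _ _ _)
    exact coext.hom_ext fun _ => by simp, by
    change coext.lift _ ≫ coext.objMap _ _ _ = 𝟙 (coext.obj _ _ _)
    exact coext.hom_ext fun _ => by simp⟩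

lemma isIso_coextMap_app_of_not {U V : M} (p : U ⟶ V) {S : ObjectProperty K} (hS : IsSieve S)
    (k : K) (h : ¬ S k) : IsIso ((coextMap p hS hS le_rfl).app k) :=
  ⟨coext.lift fun h' => (h h').elim, coext.hom_ext fun h' => (h h').elim,
    coext.hom_ext fun h' => (h h').elim⟩

lemma trivialFibration_coextMap_app [ModelCategory M] {U V : M} (p : U ⟶ V) (hp : Fibration p)
    (hp' : WeakEquivalence p) {S : ObjectProperty K} (hS : IsSieve S) (k : K) :
    Fibration ((coextMap p hS hS le_rfl).app k) ∧
      WeakEquivalence ((coextMap p hS hS le_rfl).app k) := by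
  have e : (coextMap p hS hS le_rfl).app k =
      Limits.Pi.map (f := fun _ : PLift (S k) => U) (g := fun _ => V) fun _ => p :=
    coext.hom_ext fun h => (coext.objMap_π p le_rfl k h).trans
      (Limits.Pi.map_π (f := fun _ : PLift (S k) => U) (g := fun _ => V) (fun _ => p) ⟨h⟩).symm
  rw [e]
  exact trivialFibration_piMap _ (fun _ => hp) (fun _ => hp')

end coext

variable [HasColimits M] (X : K ⥤ M)

/-- The colimit of the restriction of a diagram to a full subcategory. -/
noncomputable abbrev subColim (S : ObjectProperty K) : M := colimit (S.ι ⋙ X)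

/-- The inclusions in `subColim X S`. -/
noncomputable def subColim.ι (S : ObjectProperty K) (k : K) (hk : S k) : X.obj k ⟶ subColim X S :=
  colimit.ι (S.ι ⋙ X) ⟨k, hk⟩

variable {X} in
@[ext]
lemma subColim.hom_ext {S : ObjectProperty K} {Z : M} {a b : subColim X S ⟶ Z}
    (h : ∀ k hk, ι X S k hk ≫ a = ι X S k hk ≫ b) : a = b :=
  colimit.hom_ext fun k => h k.obj k.property

lemma subColim.w (S : ObjectProperty K) {k k' : K} (f : k ⟶ k') (hk : S k) (hk' : S k') :
    X.map f ≫ ι X S k' hk' = ι X S k hk :=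
  colimit.w (S.ι ⋙ X) (ObjectProperty.homMk f : (⟨k, hk⟩ : S.FullSubcategory) ⟶ ⟨k', hk'⟩)

lemma subColim.w_assoc (S : ObjectProperty K) {k k' : K} (f : k ⟶ k') (hk : S k) (hk' : S k')
    {Z : M} (g : subColim X S ⟶ Z) : X.map f ≫ ι X S k' hk' ≫ g = ι X S k hk ≫ g := by
  rw [← assoc, w]

/-- Constructor for morphisms from `subColim X S`. -/
noncomputable def subColim.desc {S : ObjectProperty K} {Z : M} (τ : ∀ k, S k → (X.obj k ⟶ Z))
    (hτ : ∀ {k k'} (f : k ⟶ k') hk hk', X.map f ≫ τ k' hk' = τ k hk) : subColim X S ⟶ Z :=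
  colimit.desc (S.ι ⋙ X) ⟨Z, { app := fun k => τ k.obj k.property
                               naturality := fun k k' f =>
                                (hτ f.hom k.property k'.property).trans (comp_id _).symm }⟩

@[simp]
lemma subColim.ι_desc {S : ObjectProperty K} {Z : M} (τ : ∀ k, S k → (X.obj k ⟶ Z))
    (hτ : ∀ {k k'} (f : k ⟶ k') hk hk', X.map f ≫ τ k' hk' = τ k hk) (k : K) (hk : S k) :
    ι X S k hk ≫ desc X τ hτ = τ k hk :=
  colimit.ι_desc _ _

@[simp]
lemma subColim.ι_desc_assoc {S : ObjectProperty K} {Z Z' : M} (τ : ∀ k, S k → (X.obj k ⟶ Z))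
    (hτ : ∀ {k k'} (f : k ⟶ k') hk hk', X.map f ≫ τ k' hk' = τ k hk) (k : K) (hk : S k)
    (g : Z ⟶ Z') : ι X S k hk ≫ desc X τ hτ ≫ g = τ k hk ≫ g := by
  rw [← assoc, ι_desc]

/-- The functoriality of `subColim`. -/
noncomputable def subColim.inc {S T : ObjectProperty K} (h : S ≤ T) :
    subColim X S ⟶ subColim X T :=
  desc X (fun k hk => ι X T k (h _ hk)) (fun f _ _ => w X T f _ _)

@[simp]
lemma subColim.ι_inc {S T : ObjectProperty K} (h : S ≤ T) (k : K) (hk : S k) :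
    ι X S k hk ≫ inc X h = ι X T k (h _ hk) :=
  ι_desc X _ (fun f _ _ => w X T f _ _) k hk

@[simp]
lemma subColim.ι_inc_assoc {S T : ObjectProperty K} (h : S ≤ T) (k : K) (hk : S k) {Z : M}
    (g : subColim X T ⟶ Z) : ι X S k hk ≫ inc X h ≫ g = ι X T k (h _ hk) ≫ g := by
  rw [← assoc, ι_inc]

lemma subColim.isIso_ι {S : ObjectProperty K} (k₀ : K) (hk₀ : S k₀)
    (h : ∀ k, S k → Nonempty (Unique (k ⟶ k₀))) : IsIso (ι X S k₀ hk₀) := by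
  have u := fun k hk => (h k hk).some
  have ht : IsTerminal (⟨k₀, hk₀⟩ : S.FullSubcategory) :=
    IsTerminal.ofUniqueHom (fun k => ObjectProperty.homMk (u k.obj k.property).default)
      (fun k f => by
        ext
        exact (u k.obj k.property).uniq f.hom)
  exact isIso_ι_of_isTerminal ht (S.ι ⋙ X)

/-- A morphism with target in one of the two sieves has its source there too, so a cocone on the
union is a pair of cocones that agree on the intersection. -/
lemma subColim.isPushout {S T U V : ObjectProperty K} (hS : IsSieve S) (hT : IsSieve T)
    (hU : ∀ k, U k ↔ S k ∧ T k) (hV : ∀ k, V k ↔ S k ∨ T k) :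
    IsPushout (inc X fun k hk => ((hU k).1 hk).1) (inc X fun k hk => ((hU k).1 hk).2)
      (inc X fun k hk => (hV k).2 (Or.inl hk)) (inc X fun k hk => (hV k).2 (Or.inr hk)) where
  w := by
    ext
    simp
  isColimit' := ⟨by
    classical
    have hab : ∀ {Z : M} (a : subColim X S ⟶ Z) (b : subColim X T ⟶ Z)
        (_ : inc X (fun k hk => ((hU k).1 hk).1) ≫ a = inc X (fun k hk => ((hU k).1 hk).2) ≫ b)
        (k : K) (hk : S k) (hk' : T k), ι X S k hk ≫ a = ι X T k hk' ≫ b :=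
      fun a b w k hk hk' => by
        simpa using ι X U k ((hU k).2 ⟨hk, hk'⟩) ≫= w
    have hd : ∀ {Z : M} (a : subColim X S ⟶ Z) (b : subColim X T ⟶ Z)
        (_ : inc X (fun k hk => ((hU k).1 hk).1) ≫ a = inc X (fun k hk => ((hU k).1 hk).2) ≫ b),
        ∃ d : subColim X V ⟶ Z, (∀ k hk, ι X V k ((hV k).2 (Or.inl hk)) ≫ d = ι X S k hk ≫ a) ∧
          (∀ k hk, ι X V k ((hV k).2 (Or.inr hk)) ≫ d = ι X T k hk ≫ b) := fun a b h => by
      -- Choosing `a` first is harmless: by `hab`, the two prescriptions agree on the overlap.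
      refine ⟨desc X (fun k hk => if hk' : S k then ι X S k hk' ≫ a else
          ι X T k (((hV k).1 hk).resolve_left hk') ≫ b) ?_, ?_, ?_⟩
      · intro k k' f hk hk'
        by_cases h₁ : S k'
        · rw [dif_pos h₁, dif_pos (hS f h₁), subColim.w_assoc X S f (hS f h₁) h₁]
        · have h₂ := ((hV k').1 hk').resolve_left h₁
          rw [dif_neg h₁, subColim.w_assoc X T f (hT f h₂) h₂]
          split_ifs with h₃
          · exact (hab a b h k h₃ _).symm
          · rfl
      · intro k hk
        simp [hk]
      · intro k hk
        rw [ι_desc]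
        split_ifs with h₁
        · exact hab a b h k h₁ hk
        · rfl
    choose d hd₁ hd₂ using @hd
    refine PushoutCocone.IsColimit.mk _ (fun s => d s.inl s.inr s.condition) (fun s => ?_)
      (fun s => ?_) (fun s m h₁ h₂ => ?_)
    · ext k hk
      exact (ι_inc_assoc X _ k hk _).trans (hd₁ _ _ _ k hk)
    · ext k hk
      exact (ι_inc_assoc X _ k hk _).trans (hd₂ _ _ _ k hk)
    · ext k hk
      obtain h | h := (hV k).1 hk
      · rw [hd₁ _ _ _ k h, ← h₁]
        simp
      · rw [hd₂ _ _ _ k h, ← h₂]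
        simp⟩

variable [ModelCategory M] [HasLimits M]

variable {X} in
-- Morphisms from `X` to `coext U hS` are the morphisms from `subColim X S` to `U`. A lifting
-- problem of the inclusion against `p : U ⟶ V` therefore becomes a lifting problem of `X` against
-- the map `q` from `coext U hT` to the pullback of `coext U hS` and `coext V hT` over `coext V hS`.
lemma IsProjCofibrantDiagram.cofibration_inc (hX : IsProjCofibrantDiagram X)
    {S T : ObjectProperty K} (hS : IsSieve S) (hT : IsSieve T) (hST : S ≤ T) :
    Cofibration (subColim.inc X hST) := by
  rw [cofibration_iff, ← trivialFibrations_llp]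
  intro U V p hp
  have this' := (fibration_iff p).2 hp.1
  have this'' := (weakEquivalence_iff p).2 hp.2
  constructor
  intro u v sq
  let q₁ := coextMap p hS hS le_rfl
  let q₂ := coextMap (𝟙 V) hS hT hST
  let q : coext U hT ⟶ pullback q₁ q₂ :=
    pullback.lift (coextMap (𝟙 U) hS hT hST) (coextMap p hT hT le_rfl) (by
      ext k
      change coext.objMap (𝟙 U) hST k ≫ coext.objMap p le_rfl k =
        coext.objMap p le_rfl k ≫ coext.objMap (𝟙 V) hST k
      exact coext.hom_ext fun _ => by simp)
  let θ₁ : X ⟶ coext U hS := toCoext hS (fun k hk => subColim.ι X S k hk ≫ u)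
    (fun f hk hk' => by rw [subColim.w_assoc X S f hk hk'])
  let θ₂ : X ⟶ coext V hT := toCoext hT (fun k hk => subColim.ι X T k hk ≫ v)
    (fun f hk hk' => by rw [subColim.w_assoc X T f hk hk'])
  let θ : X ⟶ pullback q₁ q₂ := pullback.lift θ₁ θ₂ (by
      ext k
      change coext.lift (fun hk => subColim.ι X S k hk ≫ u) ≫ coext.objMap p le_rfl k =
        coext.lift (fun hk => subColim.ι X T k hk ≫ v) ≫ coext.objMap (𝟙 V) hST k
      exact coext.hom_ext fun h => by
        simp [sq.w, subColim.ι_inc_assoc X hST k h])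
  have hq : ∀ k, Fibration (q.app k) ∧ WeakEquivalence (q.app k) := fun k => by
    have hk : IsPullback ((pullback.fst q₁ q₂).app k) ((pullback.snd q₁ q₂).app k) (q₁.app k)
      (q₂.app k) := (IsPullback.of_hasPullback q₁ q₂).map ((evaluation K M).obj k)
    have e₁ : q.app k ≫ (pullback.fst q₁ q₂).app k = (coextMap (𝟙 U) hS hT hST).app k := by
      rw [← NatTrans.comp_app, pullback.lift_fst]
    have e₂ : q.app k ≫ (pullback.snd q₁ q₂).app k = (coextMap p hT hT le_rfl).app k := by
      rw [← NatTrans.comp_app, pullback.lift_snd]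
    -- At objects of `S` the map `q` is invertible. Elsewhere the two `coext` diagrams on `S` are
    -- terminal, and `q` is up to isomorphism a power of `p`.
    by_cases hSk : S k
    · have := isIso_coextMap_id_app U hS hT hST k (fun _ => hSk)
      have : IsIso (q₂.app k) := isIso_coextMap_id_app V hS hT hST k (fun _ => hSk)
      have := hk.isIso_fst_of_isIso
      have : IsIso (q.app k ≫ (pullback.fst q₁ q₂).app k) := by
        rw [e₁]
        infer_instance
      have := IsIso.of_isIso_comp_right (q.app k) ((pullback.fst q₁ q₂).app k)
      exact ⟨inferInstance, inferInstance⟩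
    · have : IsIso (q₁.app k) := isIso_coextMap_app_of_not p hS k hSk
      have := hk.isIso_snd_of_isIso
      have h := trivialFibration_coextMap_app p this' this'' hT k
      have e : q.app k = (coextMap p hT hT le_rfl).app k ≫ inv ((pullback.snd q₁ q₂).app k) := by
        rw [← e₂]
        simp
      have := h.1
      have := h.2
      rw [e]
      exact ⟨inferInstance, inferInstance⟩
  obtain ⟨θ', hθ'⟩ := hX q (fun k => (hq k).1) (fun k => (hq k).2) θ
  have h₁ : θ' ≫ coextMap (𝟙 U) hS hT hST = θ₁ := by
    have e : q ≫ pullback.fst q₁ q₂ = coextMap (𝟙 U) hS hT hST := pullback.lift_fst _ _ _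
    rw [← e, ← assoc, hθ']
    exact pullback.lift_fst _ _ _
  have h₂ : θ' ≫ coextMap p hT hT le_rfl = θ₂ := by
    have e : q ≫ pullback.snd q₁ q₂ = coextMap p hT hT le_rfl := pullback.lift_snd _ _ _
    rw [← e, ← assoc, hθ']
    exact pullback.lift_snd _ _ _
  let a (k : K) : X.obj k ⟶ coext.obj U T k := θ'.app k
  have ha₁ (k : K) (hk : S k) : a k ≫ coext.π U T k (hST k hk) = subColim.ι X S k hk ≫ u := by
    have e : a k ≫ coext.objMap (𝟙 U) hST k = coext.lift (fun hk => subColim.ι X S k hk ≫ u) :=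
      NatTrans.congr_app h₁ k
    simpa using e =≫ coext.π U S k hk
  have ha₂ (k : K) (hk : T k) : a k ≫ coext.π U T k hk ≫ p = subColim.ι X T k hk ≫ v := by
    have e : a k ≫ coext.objMap p le_rfl k = coext.lift (fun hk => subColim.ι X T k hk ≫ v) :=
      NatTrans.congr_app h₂ k
    simpa using e =≫ coext.π V T k hk
  have ha₃ {k k' : K} (f : k ⟶ k') (hk : T k) (hk' : T k') :
      X.map f ≫ a k' ≫ coext.π U T k' hk' = a k ≫ coext.π U T k hk := by
    have e : X.map f ≫ a k' = a k ≫ coext.map U hT f := θ'.naturality f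
    rw [reassoc_of% e, coext.map_π]
  refine ⟨⟨⟨subColim.desc X (fun k hk => a k ≫ coext.π U T k hk) ha₃, ?_, ?_⟩⟩⟩
  · ext k hk
    rw [subColim.ι_inc_assoc X hST k hk, subColim.ι_desc, ha₁]
  · ext k hk
    rw [← assoc, subColim.ι_desc, assoc, ha₂]

end SubColim

lemma isIso_desc_colimit_ι {K : Type} [SmallCategory K] {M : Type u} [Category.{v} M]
    [HasColimits M] (X : K ⥤ M) {S : ObjectProperty K} (hS : ∀ k, S k) :
    IsIso (subColim.desc (S := S) X (fun k _ => colimit.ι X k) (fun f _ _ => colimit.w X f)) := by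
  refine ⟨colimit.desc X ⟨_, { app := fun k => subColim.ι X S k (hS k)
                               naturality := fun k k' f =>
                                (subColim.w X S f _ _).trans (comp_id _).symm }⟩, ?_, ?_⟩
  · ext k hk
    rw [subColim.ι_desc_assoc, colimit.ι_desc, comp_id]
  · refine colimit.hom_ext fun k => ?_
    rw [colimit.ι_desc_assoc, comp_id]
    exact subColim.ι_desc _ _ _ _ _

/-! ### Collapsing a cone of vertex sets to its apex -/

section Contraction

variable {K : Type} [SmallCategory K] {M : Type u} [Category.{v} M] [ModelCategory M]
  [HasColimits M] [HasLimits M] {X : K ⥤ M}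

/-- The colimit over the empty sieve is initial, so this is the case `S = ⊥` of `cofibration_inc`.
-/
lemma IsProjCofibrantDiagram.isCofibrant_subColim (hX : IsProjCofibrantDiagram X)
    {S : ObjectProperty K} (hS : IsSieve S) : IsCofibrant (subColim X S) := by
  have h := hX.cofibration_inc (S := ⊥) (T := S) (fun _ _ _ h => h.elim) hS bot_le
  have hi : IsInitial (subColim X ⊥) :=
    IsInitial.ofUniqueHom (fun Z => subColim.desc X (fun _ h => h.elim) (fun _ h => h.elim))
      (fun _ _ => subColim.hom_ext fun _ h => h.elim)
  exact (isCofibrant_iff_of_isInitial _ hi).2 h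

lemma IsProjCofibrantDiagram.isCofibrant_colimit (hX : IsProjCofibrantDiagram X) :
    IsCofibrant (colimit X) := by
  have := hX.isCofibrant_subColim (S := ⊤) (fun _ _ _ h => h)
  have := isIso_desc_colimit_ι X (S := ⊤) (fun _ => trivial)
  exact isCofibrant_of_cofibration (subColim.desc (S := ⊤) X (fun k _ => colimit.ι X k)
    (fun f _ _ => colimit.w X f))

/-- Since `k₀` is terminal, the colimit of the whole diagram is its value at `k₀`. -/
lemma IsProjCofibrantDiagram.isCofibrant_obj (hX : IsProjCofibrantDiagram X) (k₀ : K)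
    (hk₀ : ∀ k, Nonempty (Unique (k ⟶ k₀))) : IsCofibrant (X.obj k₀) := by
  have := hX.isCofibrant_subColim (S := ⊤) (fun _ _ _ h => h)
  have := subColim.isIso_ι X (S := ⊤) k₀ trivial (fun k _ => hk₀ k)
  exact isCofibrant_of_cofibration (inv (subColim.ι X ⊤ k₀ trivial))

variable {P : Type} [DecidableEq P] {m : P} {rg : K → Finset P} {Ch : Finset P → Prop}

/-- The sieve of objects whose range belongs to a family of subsets. -/
abbrev rangeSieve (rg : K → Finset P) (𝒜 : Finset (Finset P)) : ObjectProperty K :=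
  fun k => rg k ∈ 𝒜

/-- Think of `rg k` as the vertex set of a simplex `k`, and of `𝒜` as a simplicial complex (with the
empty face) which is a cone with apex `m`. By `hterm`, the objects with vertices in `σ` have a
terminal one. A maximal face `σ` is removed together with the face opposite to `m`. What remains is
a smaller cone, and the colimit over `𝒜` is obtained from the one over it by pushout along the
inclusion of a horn of `σ`. That inclusion is a trivial cofibration: both of its ends receive a weak
equivalence from `X.obj k`, by induction for the horn and by terminality for the full simplex. -/
lemma weakEquivalence_subColim_ι (hX : IsProjCofibrantDiagram X)
    (hX' : ∀ {k k' : K} (f : k ⟶ k'), WeakEquivalence (X.map f))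
    (hrg : ∀ {k k' : K}, (k ⟶ k') → rg k ⊆ rg k') (hne : ∀ k, (rg k).Nonempty)
    (hterm : ∀ σ, Ch σ → σ.Nonempty →
      ∃ k₀, rg k₀ = σ ∧ ∀ k, rg k ⊆ σ → Nonempty (Unique (k ⟶ k₀)))
    (n : ℕ) (𝒜 : Finset (Finset P)) (hn : 𝒜.card ≤ n) (h₁ : ∀ σ ∈ 𝒜, Ch σ)
    (h₂ : ∀ σ ∈ 𝒜, ∀ τ, τ ⊆ σ → τ ∈ 𝒜) (h₃ : ∀ σ ∈ 𝒜, insert m σ ∈ 𝒜) (k : K)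
    (hk : rg k = {m}) (hk' : rg k ∈ 𝒜) :
    WeakEquivalence (subColim.ι X (rangeSieve rg 𝒜) k hk') := by
  induction n generalizing 𝒜 with
  | zero =>
    rw [Finset.card_eq_zero.1 (Nat.le_zero.1 hn)] at hk'
    simp at hk'
  | succ n hrec =>
  have hsieve (ℬ : Finset (Finset P)) (hℬ : ∀ σ ∈ ℬ, ∀ τ, τ ⊆ σ → τ ∈ ℬ) :
      IsSieve (rangeSieve rg ℬ) := fun k k' f h => hℬ _ h _ (hrg f)
  -- The full simplex on `σ`: its terminal object computes the colimit, and transition maps are weak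
  -- equivalences.
  have key (S : ObjectProperty K) (σ : Finset P) (hσ : Ch σ) (hS : ∀ k, S k ↔ rg k ⊆ σ)
      (hk : S k) : WeakEquivalence (subColim.ι X S k hk) := by
    obtain ⟨k₀, h, h'⟩ := hterm σ hσ ((hne k).mono ((hS k).1 hk))
    have hk₀ : S k₀ := (hS k₀).2 h.subset
    have := subColim.isIso_ι X k₀ hk₀ (fun k hk => h' k ((hS k).1 hk))
    rw [← subColim.w X S (h' k ((hS k).1 hk)).some.default hk hk₀]
    have := hX' (h' k ((hS k).1 hk)).some.default
    infer_instance
  -- If only the apex remains, the sieve is the full simplex on `{m}`.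
  by_cases h : ∀ σ ∈ 𝒜, σ ⊆ {m}
  · exact key _ _ (h₁ _ (hk ▸ hk')) (fun k => ⟨h _, h₂ _ (hk ▸ hk') _⟩) _
  · push Not at h
    obtain ⟨σ₀, hσ₀, hσ₀'⟩ := h
    obtain ⟨σ, hσ, hmax⟩ := (𝒜.filter fun σ => ¬ σ ⊆ {m}).exists_max_image Finset.card
      ⟨σ₀, Finset.mem_filter.2 ⟨hσ₀, hσ₀'⟩⟩
    simp only [Finset.mem_filter] at hσ hmax
    obtain ⟨hσ, hσ'⟩ := hσ
    -- Maximal cardinality gives maximality for inclusion, and closure under `insert m` then forces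
    -- `m ∈ σ`.
    have hmax' (τ) (hτ : τ ∈ 𝒜) (h : σ ⊆ τ) : τ = σ :=
      (Finset.eq_of_subset_of_card_le h (hmax τ ⟨hτ, fun h' => hσ' (h.trans h')⟩)).symm
    have hm : m ∈ σ := Finset.insert_eq_self.1 (hmax' _ (h₃ σ hσ) (Finset.subset_insert _ _))
    have hτ₁ (τ) (h : σ.erase m ⊆ τ) (h' : τ ⊆ σ) : τ = σ ∨ τ = σ.erase m := by
      by_cases hm' : m ∈ τ
      · exact Or.inl (h'.antisymm (by
          rw [← Finset.insert_erase hm]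
          exact Finset.insert_subset hm' h))
      · exact Or.inr (h.antisymm' (Finset.subset_erase.2 ⟨h', hm'⟩))
    -- Removing the pair at once keeps the family both closed under subsets and closed under `insert
    -- m`.
    let 𝒜' := (𝒜.erase σ).erase (σ.erase m)
    have mem (τ) : τ ∈ 𝒜' ↔ τ ≠ σ.erase m ∧ τ ≠ σ ∧ τ ∈ 𝒜 := by simp [𝒜']
    have hlow : ∀ σ ∈ 𝒜', ∀ τ, τ ⊆ σ → τ ∈ 𝒜' := by
      intro τ hτ τ' h
      rw [mem] at hτ ⊢
      refine ⟨?_, ?_, h₂ _ hτ.2.2 _ h⟩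
      · rintro rfl
        have h' : insert m τ = σ := hmax' _ (h₃ _ hτ.2.2) (by
          rw [← Finset.insert_erase hm]
          exact Finset.insert_subset_insert _ h)
        obtain h | h := hτ₁ τ h (h' ▸ Finset.subset_insert _ _)
        · exact hτ.2.1 h
        · exact hτ.1 h
      · rintro rfl
        exact hτ.2.1 (hmax' _ hτ.2.2 h)
    have hins : ∀ τ ∈ 𝒜', insert m τ ∈ 𝒜' := by
      intro τ hτ
      rw [mem] at hτ ⊢
      refine ⟨fun h => ?_, fun h => ?_, h₃ _ hτ.2.2⟩
      · have := h ▸ Finset.mem_insert_self m τ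
        simp at this
      · obtain h | h := hτ₁ τ (by
          rw [← h]
          exact Finset.erase_insert_subset _ _) (h ▸ Finset.subset_insert _ _)
        · exact hτ.2.1 h
        · exact hτ.1 h
    have hm' : {m} ∈ 𝒜' := by
      rw [mem]
      refine ⟨fun h => ?_, fun h => hσ' h.ge, hk ▸ hk'⟩
      have := h ▸ Finset.mem_singleton_self m
      simp at this
    have hcard : 𝒜'.card ≤ n := by
      have h₁ := Finset.card_erase_lt_of_mem hσ
      have h₂ : 𝒜'.card ≤ _ := Finset.card_erase_le
      omega
    -- This is the horn: all faces of `σ` except `σ` itself and the one opposite to `m`. It is again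
    -- a cone with apex `m`, so induction applies to it too.
    let 𝒜'' := 𝒜' ∩ σ.powerset
    have hlow'' : ∀ σ ∈ 𝒜'', ∀ τ, τ ⊆ σ → τ ∈ 𝒜'' := by
      intro τ hτ τ' h
      simp only [𝒜'', Finset.mem_inter, Finset.mem_powerset] at hτ ⊢
      exact ⟨hlow _ hτ.1 _ h, h.trans hτ.2⟩
    have hw' := hrec 𝒜' hcard (fun τ hτ => h₁ τ ((mem τ).1 hτ).2.2) hlow hins (hk ▸ hm')
    have hw'' := hrec 𝒜'' ((Finset.card_le_card Finset.inter_subset_left).trans hcard)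
      (fun τ hτ => h₁ τ ((mem τ).1 (Finset.mem_inter.1 hτ).1).2.2) hlow'' (by
        intro τ hτ
        simp only [𝒜'', Finset.mem_inter, Finset.mem_powerset] at hτ ⊢
        exact ⟨hins _ hτ.1, Finset.insert_subset hm hτ.2⟩) (by
        simp only [𝒜'', Finset.mem_inter, Finset.mem_powerset]
        exact ⟨hk ▸ hm', by simpa [hk]⟩)
    have hpow : ∀ τ ∈ σ.powerset, ∀ τ', τ' ⊆ τ → τ' ∈ σ.powerset := fun τ hτ τ' h =>
      Finset.mem_powerset.2 (h.trans (Finset.mem_powerset.1 hτ))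
    have sq := subColim.isPushout X (S := rangeSieve rg 𝒜') (T := rangeSieve rg σ.powerset)
      (U := rangeSieve rg 𝒜'') (V := rangeSieve rg 𝒜) (hsieve _ hlow) (hsieve _ hpow)
      (fun k => Finset.mem_inter) (fun k => by
        constructor
        · intro h
          by_cases h' : rg k ∈ 𝒜'
          · exact Or.inl h'
          · right
            rw [mem] at h'
            refine Finset.mem_powerset.2 ?_
            by_cases h₁ : rg k = σ
            · exact h₁.le
            · have : rg k = σ.erase m := by
                by_contra h₂
                exact h' ⟨h₂, h₁, h⟩
              rw [this]
              exact Finset.erase_subset _ _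
        · rintro (h | h)
          · exact ((mem _).1 h).2.2
          · exact h₂ _ hσ _ (Finset.mem_powerset.1 h))
    have hi : rangeSieve rg 𝒜'' ≤ rangeSieve rg σ.powerset :=
      fun k hk => (Finset.mem_inter.1 hk).2
    have hj : rangeSieve rg 𝒜' ≤ rangeSieve rg 𝒜 := fun k hk => ((mem _).1 hk).2.2
    have hcof := hX.cofibration_inc (hsieve _ hlow'') (hsieve _ hpow) hi
    have hweq : WeakEquivalence (subColim.inc X hi) := by
      have hk'' : rangeSieve rg σ.powerset k := by simpa [hk]
      have := key _ σ (h₁ _ hσ) (fun k => Finset.mem_powerset) hk''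
      exact weakEquivalence_of_precomp_of_fac (subColim.ι_inc X hi k _)
    have htriv : trivialCofibrations M (subColim.inc X hj) :=
      MorphismProperty.of_isPushout sq
        ⟨(cofibration_iff _).1 hcof, (weakEquivalence_iff _).1 hweq⟩
    have := (weakEquivalence_iff _).2 htriv.2
    rw [← subColim.ι_inc X hj k (show rg k ∈ 𝒜' from hk ▸ hm')]
    infer_instance

/-- The canonical morphisms to the colimit of a projectively cofibrant diagram of
weak equivalences are weak equivalences when the index category can be contracted by adding
the element `m` to the ranges of its objects. -/
lemma IsProjCofibrantDiagram.weakEquivalence_colimit_ι [Fintype P]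
    (hX : IsProjCofibrantDiagram X)
    (hX' : ∀ {k k' : K} (f : k ⟶ k'), WeakEquivalence (X.map f))
    (hrg : ∀ {k k' : K}, (k ⟶ k') → rg k ⊆ rg k') (hne : ∀ k, (rg k).Nonempty)
    (hCh : ∀ k, Ch (rg k)) (hCh' : ∀ σ τ, Ch σ → τ ⊆ σ → Ch τ) (hCh'' : ∀ σ, Ch σ → Ch (insert m σ))
    (hterm : ∀ σ, Ch σ → σ.Nonempty →
      ∃ k₀, rg k₀ = σ ∧ ∀ k, rg k ⊆ σ → Nonempty (Unique (k ⟶ k₀))) (k : K) :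
    WeakEquivalence (colimit.ι X k) := by
  classical
  let 𝒜 : Finset (Finset P) := Finset.univ.filter Ch
  have h𝒜 (k : K) : rangeSieve rg 𝒜 k := by simp [𝒜, hCh]
  have hw (k : K) (hk : rg k = {m}) : WeakEquivalence (subColim.ι X (rangeSieve rg 𝒜) k (h𝒜 k)) :=
    weakEquivalence_subColim_ι (m := m) hX hX' hrg hne hterm _ 𝒜 le_rfl (by simp [𝒜])
      (by simpa [𝒜] using fun σ h τ => hCh' σ τ h) (by simpa [𝒜] using hCh'') k hk (h𝒜 k)
  have hw' : WeakEquivalence (subColim.ι X (rangeSieve rg 𝒜) k (h𝒜 k)) := by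
    -- The object `k` and an object `k₂` with range `{m}` both map to the object with range `insert
    -- m (rg k)`, so two-out-of-three transfers the result from `k₂` to `k`.
    have h₁ := hCh'' _ (hCh k)
    obtain ⟨k₁, e₁, hk₁⟩ := hterm _ h₁ (Finset.insert_nonempty _ _)
    obtain ⟨k₂, e₂, -⟩ := hterm {m} (hCh' _ _ h₁ (by simp)) (by simp)
    have f := (hk₁ k (Finset.subset_insert _ _)).some.default
    have g := (hk₁ k₂ (by simp [e₂])).some.default
    have := hX' f
    have : WeakEquivalence (subColim.ι X (rangeSieve rg 𝒜) k₁ (h𝒜 k₁)) :=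
      have := hX' g
      have := hw k₂ e₂
      weakEquivalence_of_precomp_of_fac (subColim.w X _ g (h𝒜 _) (h𝒜 _))
    rw [← subColim.w X _ f (h𝒜 k) (h𝒜 k₁)]
    infer_instance
  have := isIso_desc_colimit_ι X h𝒜
  rw [← subColim.ι_desc X (S := rangeSieve rg 𝒜) (fun k _ => colimit.ι X k)
    (fun f _ _ => colimit.w X f) k (h𝒜 k)]
  infer_instance

end Contraction

/-! ### Left Kan extension of sections -/

namespace Sect

/-- Constructor for sections in terms of `Diagram.comp`. -/
def mkComp {I : Type w} [Category.{w'} I] {ω : Diagram.{v, u} I} (obj : ∀ i, ω.fib i)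
    (map : ∀ {i j : I} (f : i ⟶ j), (ω.push f).obj (obj i) ⟶ obj j)
    (map_id : ∀ i, map (𝟙 i) = (ω.pushId i).hom.app (obj i))
    (map_comp : ∀ {i j k : I} (f : i ⟶ j) (g : j ⟶ k),
      map (f ≫ g) = ω.comp f g _ rfl (map f) (map g)) : Sect ω where
  obj := obj
  map := map
  map_id := map_id
  map_comp f g := by
    rw [map_comp, Diagram.comp, Diagram.pushComp'_eq_pushComp]

section

variable {I : Type w} [Category.{w'} I] {ω : Diagram.{v, u} I} {I' : Type*} [Category* I']
  {J : I' ⥤ I}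

/-- Constructor for morphisms to a pullback section. -/
def toPullback {x : Sect (ω.restrict J)} {y : Sect ω} (ψ : ∀ r, x.objOver r ⟶ y.obj (J.obj r))
    (hψ : ∀ {r s : I'} (g : r ⟶ s),
      x.mapOver g ≫ ψ s = (ω.push (J.map g)).map (ψ r) ≫ y.map (J.map g)) :
    x ⟶ (pullback ω J).obj y :=
  homMkOver ψ hψ

/-- The components of a morphism to a pullback section. -/
def pullbackApp {x : Sect (ω.restrict J)} {y : Sect ω} (φ : x ⟶ (pullback ω J).obj y) (r : I') :
    x.objOver r ⟶ y.obj (J.obj r) :=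
  φ.app r

lemma pullbackApp_naturality {x : Sect (ω.restrict J)} {y : Sect ω}
    (φ : x ⟶ (pullback ω J).obj y) {r s : I'} (g : r ⟶ s) :
    x.mapOver g ≫ pullbackApp φ s =
      (ω.push (J.map g)).map (pullbackApp φ r) ≫ y.map (J.map g) :=
  φ.naturality g

end

variable {I I' : Type} [SmallCategory I] [SmallCategory I'] {ω : Diagram.{v, u} I} {J : I' ⥤ I}

lemma IsProjCofibrant.costructured {x : Sect (ω.restrict J)} (hx : x.IsProjCofibrant) (j : I) :
    IsProjCofibrantDiagram (x.costructured j) :=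
  fun _ _ q hq hq' θ => hx.exists_lift q hq hq' θ

variable (x : Sect (ω.restrict J))

namespace lan

/-- The objects of the left Kan extension of a section. -/
noncomputable def obj (j : I) : ω.fib j := colimit (x.costructured j)

/-- The canonical morphisms to the objects of the left Kan extension of a section. -/
noncomputable def inj {r : I'} {j : I} (f : J.obj r ⟶ j) :
    (ω.push f).obj (x.objOver r) ⟶ obj x j :=
  colimit.ι (x.costructured j) (CostructuredArrow.mk f)

lemma comp_inj {r s : I'} {j : I} (g : r ⟶ s) (f' : J.obj s ⟶ j) (f : J.obj r ⟶ j)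
    (h : J.map g ≫ f' = f) :
    ω.comp (J.map g) f' f h (x.mapOver g) (inj x f') = inj x f :=
  (comp_costructured_map (CostructuredArrow.homMk g h : CostructuredArrow.mk f ⟶
    CostructuredArrow.mk f') (inj x f')).symm.trans (colimit.w (x.costructured j) _)

variable {x}

lemma hom_ext {j : I} {c : ω.fib j} {a b : obj x j ⟶ c}
    (h : ∀ {r : I'} (f : J.obj r ⟶ j), inj x f ≫ a = inj x f ≫ b) : a = b :=
  colimit.hom_ext fun k => h k.hom

/-- Constructor for morphisms from the objects of the left Kan extension of a section. -/
noncomputable def desc {j : I} {c : ω.fib j}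
    (τ : ∀ {r : I'} (f : J.obj r ⟶ j), (ω.push f).obj (x.objOver r) ⟶ c)
    (hτ : ∀ {r s : I'} (g : r ⟶ s) (f' : J.obj s ⟶ j) (f : J.obj r ⟶ j) (h : J.map g ≫ f' = f),
      ω.comp (J.map g) f' f h (x.mapOver g) (τ f') = τ f) : obj x j ⟶ c :=
  colimit.desc (x.costructured j) ⟨c, homOfCostructured (fun k => τ k.hom) (fun {k k'} h =>
    (hτ h.left k'.hom k.hom (CostructuredArrow.w h)).trans (comp_id _).symm)⟩

lemma inj_desc {j : I} {c : ω.fib j}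
    (τ : ∀ {r : I'} (f : J.obj r ⟶ j), (ω.push f).obj (x.objOver r) ⟶ c)
    (hτ : ∀ {r s : I'} (g : r ⟶ s) (f' : J.obj s ⟶ j) (f : J.obj r ⟶ j) (h : J.map g ≫ f' = f),
      ω.comp (J.map g) f' f h (x.mapOver g) (τ f') = τ f) {r : I'} (f : J.obj r ⟶ j) :
    inj x f ≫ desc τ hτ = τ f :=
  colimit.ι_desc _ _

/-- The functor `ω.push g` is a left adjoint, so it keeps the defining colimit of `lan.obj x j` a
colimit. -/
lemma hom_ext_over {j j' : I} (g : j ⟶ j') {c : ω.fib j'} {a b : (ω.push g).obj (obj x j) ⟶ c}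
    (h : ∀ {r : I'} (f : J.obj r ⟶ j) (fg : J.obj r ⟶ j') (e : f ≫ g = fg),
      ω.comp f g fg e (inj x f) a = ω.comp f g fg e (inj x f) b) : a = b := by
  refine (isColimitOfPreserves (ω.push g) (colimit.isColimit (x.costructured j))).hom_ext
    fun k => ?_
  change (ω.push g).map (inj x k.hom) ≫ a = (ω.push g).map (inj x k.hom) ≫ b
  refine Diagram.hom_ext_of_comp k.hom g _ rfl ?_
  rw [Diagram.comp_map_comp, Diagram.comp_map_comp, id_comp]
  exact h k.hom _ rfl

/-- Constructor for morphisms from `ω(g)` of the objects of the left Kan extension of a section. -/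
noncomputable def descOver {j j' : I} (g : j ⟶ j') {c : ω.fib j'}
    (τ : ∀ {r : I'} (f : J.obj r ⟶ j), (ω.push (f ≫ g)).obj (x.objOver r) ⟶ c)
    (hτ : ∀ {r s : I'} (h : r ⟶ s) (f' : J.obj s ⟶ j) (f : J.obj r ⟶ j)
      (_ : J.map h ≫ f' = f) (e : J.map h ≫ f' ≫ g = f ≫ g),
      ω.comp (J.map h) (f' ≫ g) (f ≫ g) e (x.mapOver h) (τ f') = τ f) :
    (ω.push g).obj (obj x j) ⟶ c :=
  (isColimitOfPreserves (ω.push g) (colimit.isColimit (x.costructured j))).desc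
    ⟨c, { app := fun k => ω.desc k.hom g _ rfl (τ k.hom)
          naturality := fun k k' h => by
            refine Eq.trans ?_ (comp_id _).symm
            refine Diagram.hom_ext_of_comp k.hom g _ rfl ?_
            refine (Diagram.comp_map_comp _ ((x.costructured j).map h) _).trans ?_
            refine Eq.trans ?_ (ω.comp_desc _ _ _ _ _).symm
            refine (congrArg (fun t => ω.comp _ _ _ _ t _) (id_comp _)).trans ?_
            refine (ω.comp_assoc (J.map h.left) k'.hom g k.hom (k'.hom ≫ g) (k.hom ≫ g)
              (CostructuredArrow.w h) rfl ?_ rfl _ _ _).trans ?_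
            · rw [← assoc, CostructuredArrow.w h]
            · exact (congrArg (fun t => ω.comp _ _ _ _ _ t) (ω.comp_desc _ _ _ _ _)).trans
                (hτ _ _ _ (CostructuredArrow.w h) _) }⟩

lemma comp_inj_descOver {j j' : I} (g : j ⟶ j') {c : ω.fib j'}
    (τ : ∀ {r : I'} (f : J.obj r ⟶ j), (ω.push (f ≫ g)).obj (x.objOver r) ⟶ c)
    (hτ : ∀ {r s : I'} (h : r ⟶ s) (f' : J.obj s ⟶ j) (f : J.obj r ⟶ j)
      (_ : J.map h ≫ f' = f) (e : J.map h ≫ f' ≫ g = f ≫ g),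
      ω.comp (J.map h) (f' ≫ g) (f ≫ g) e (x.mapOver h) (τ f') = τ f)
    {r : I'} (f : J.obj r ⟶ j) :
    ω.comp f g _ rfl (inj x f) (descOver g τ hτ) = τ f := by
  have e : (ω.push g).map (inj x f) ≫ descOver g τ hτ = ω.desc f g _ rfl (τ f) :=
    (isColimitOfPreserves (ω.push g) (colimit.isColimit (x.costructured j))).fac _ _
  have e' := Diagram.comp_map_comp (h := rfl (a := f ≫ g)) (𝟙 _) (inj x f) (descOver g τ hτ)
  rw [e, Diagram.comp_desc, id_comp] at e'
  exact e'.symm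

variable (x)

/-- The structure maps of the left Kan extension of a section. -/
noncomputable def map {j j' : I} (g : j ⟶ j') : (ω.push g).obj (obj x j) ⟶ obj x j' :=
  descOver g (fun f => inj x (f ≫ g)) (fun h _ _ _ e => comp_inj x h _ _ e)

lemma comp_inj_map {r : I'} {j j' : I} (f : J.obj r ⟶ j) (g : j ⟶ j') (fg : J.obj r ⟶ j')
    (h : f ≫ g = fg) : ω.comp f g fg h (inj x f) (map x g) = inj x fg := by
  subst h
  exact comp_inj_descOver g (fun f => inj x (f ≫ g)) (fun h _ _ _ e => comp_inj x h _ _ e) f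

end lan

/-- The left Kan extension of a section. -/
noncomputable def lan : Sect ω :=
  mkComp (lan.obj x) (lan.map x)
    (fun j => lan.hom_ext_over _ fun f fg e => by
      obtain rfl : f = fg := by simpa using e
      rw [lan.comp_inj_map, ← Diagram.pushId'_eq_pushId, Diagram.comp_pushId'])
    (fun g g' => lan.hom_ext_over _ fun f fg e => by
      rw [lan.comp_inj_map, ← ω.comp_assoc f g g' (f ≫ g) (g ≫ g') fg rfl (by rw [← e, assoc]) e rfl,
        lan.comp_inj_map, lan.comp_inj_map])

namespace lan

/-- The components of the unit of the adjunction between the left Kan extension and the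
pullback of sections. -/
noncomputable def unitApp (r : I') : x.objOver r ⟶ obj x (J.obj r) :=
  (ω.pushId (J.obj r)).inv.app (x.objOver r) ≫ inj x (𝟙 (J.obj r))

lemma pushId_hom_unitApp (r : I') :
      (ω.pushId (J.obj r)).hom.app (x.objOver r) ≫ unitApp x r = inj x (𝟙 (J.obj r)) :=
  Iso.hom_inv_id_app_assoc _ _ _

lemma map_unitApp {r : I'} {j : I} (f : J.obj r ⟶ j) :
    (ω.push f).map (unitApp x r) ≫ map x f = inj x f := by
  rw [← ω.pushId'_comp (𝟙 _) rfl f (id_comp f) ((ω.push f).map (unitApp x r) ≫ map x f),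
    Diagram.comp_map_comp, Diagram.pushId'_eq_pushId, pushId_hom_unitApp, comp_inj_map]

lemma mapOver_unitApp {r s : I'} (g : r ⟶ s) : x.mapOver g ≫ unitApp x s = inj x (J.map g) := by
  rw [← comp_inj x g (𝟙 _) (J.map g) (comp_id _), ← pushId_hom_unitApp, Diagram.comp_comp,
    ← Diagram.pushId'_eq_pushId, Diagram.comp_pushId']

variable {x} {y : Sect ω}

lemma comp_mapOver_pullbackApp (ψ : x ⟶ (pullback ω J).obj y) {r s : I'} {j : I} (g : r ⟶ s)
    (f' : J.obj s ⟶ j) (f : J.obj r ⟶ j) (h : J.map g ≫ f' = f) :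
    ω.comp (J.map g) f' f h (x.mapOver g) ((ω.push f').map (pullbackApp ψ s) ≫ y.map f') =
      (ω.push f).map (pullbackApp ψ r) ≫ y.map f := by
  rw [Diagram.comp_map_comp, pullbackApp_naturality, ← Diagram.map_comp, ← y.map_eq_comp]

/-- The components of the morphism from a left Kan extension corresponding to a
morphism to a pullback. -/
noncomputable def homOfPullbackApp (ψ : x ⟶ (pullback ω J).obj y) (j : I) :
    obj x j ⟶ y.obj j :=
  desc (fun {r} f => (ω.push f).map (pullbackApp ψ r) ≫ y.map f) (comp_mapOver_pullbackApp ψ)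

lemma inj_homOfPullbackApp (ψ : x ⟶ (pullback ω J).obj y) {r : I'} {j : I} (f : J.obj r ⟶ j) :
    inj x f ≫ homOfPullbackApp ψ j = (ω.push f).map (pullbackApp ψ r) ≫ y.map f :=
  inj_desc _ (comp_mapOver_pullbackApp ψ) _

lemma map_homOfPullbackApp (ψ : x ⟶ (pullback ω J).obj y) {j j' : I} (g : j ⟶ j') :
    map x g ≫ homOfPullbackApp ψ j' = (ω.push g).map (homOfPullbackApp ψ j) ≫ y.map g := by
  refine hom_ext_over g fun f fg e => ?_
  refine (Diagram.comp_comp _ _ _).trans ?_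
  rw [comp_inj_map, inj_homOfPullbackApp]
  refine Eq.trans ?_ (Diagram.comp_map_comp _ _ _).symm
  rw [inj_homOfPullbackApp, ← Diagram.map_comp, ← y.map_eq_comp]

/-- The components of a morphism from a left Kan extension. -/
noncomputable def homApp (φ : lan x ⟶ y) (j : I) : obj x j ⟶ y.obj j :=
  φ.app j

lemma homApp_naturality (φ : lan x ⟶ y) {j j' : I} (g : j ⟶ j') :
    map x g ≫ homApp φ j' = (ω.push g).map (homApp φ j) ≫ y.map g :=
  φ.naturality g

lemma mapOver_unitApp_homApp (φ : lan x ⟶ y) {r s : I'} (g : r ⟶ s) :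
    x.mapOver g ≫ unitApp x s ≫ homApp φ (J.obj s) =
      (ω.push (J.map g)).map (unitApp x r ≫ homApp φ (J.obj r)) ≫ y.map (J.map g) := by
  rw [← assoc, mapOver_unitApp, Functor.map_comp, assoc, ← homApp_naturality, ← map_unitApp, assoc]

/-- Morphisms from the left Kan extension of a section. -/
noncomputable def homEquiv : (lan x ⟶ y) ≃ (x ⟶ (pullback ω J).obj y) where
  toFun φ := toPullback (fun r => unitApp x r ≫ homApp φ (J.obj r)) (mapOver_unitApp_homApp φ)
  invFun ψ :=
    { app := homOfPullbackApp ψ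
      naturality := map_homOfPullbackApp ψ }
  left_inv φ := by
    ext j
    refine hom_ext (b := homApp φ j) fun {r} f => ?_
    refine (inj_homOfPullbackApp _ f).trans ?_
    change (ω.push f).map (unitApp x r ≫ homApp φ _) ≫ _ = _
    rw [Functor.map_comp, assoc, ← homApp_naturality, ← assoc, map_unitApp]
  right_inv ψ := by
    refine Sect.hom_ext_over fun r => ?_
    change unitApp x r ≫ homOfPullbackApp ψ _ = pullbackApp ψ r
    have e := (ω.pushId (J.obj r)).hom.naturality (pullbackApp ψ r)
    rw [unitApp, assoc, inj_homOfPullbackApp, y.map_id]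
    exact (_ ≫= e).trans (Iso.inv_hom_id_app_assoc _ _ _)

end lan

variable (ω J)

/-- The left Kan extension functor on sections. -/
noncomputable def lanFunctor : Sect (ω.restrict J) ⥤ Sect ω :=
  Adjunction.leftAdjointOfEquiv (G := pullback ω J) (F_obj := fun x => lan x)
    (fun _ _ => lan.homEquiv) (fun x y y' g h => by
      refine hom_ext_over fun r => ?_
      exact (assoc (lan.unitApp x r) (lan.homApp h _) (g.app _)).symm)

/-- The left Kan extension of sections is left adjoint to the pullback. -/
noncomputable def lanAdjunction : lanFunctor ω J ⊣ pullback ω J :=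
  Adjunction.adjunctionOfEquivLeft _ _

variable {ω J}

lemma lanAdjunction_homEquiv (x : Sect (ω.restrict J)) (y : Sect ω) :
    (lanAdjunction ω J).homEquiv x y = lan.homEquiv := by
  exact congrFun (congrFun (Adjunction.mkOfHomEquiv_homEquiv _) x) y

lemma lanAdjunction_unit_app_app (x : Sect (ω.restrict J)) (r : I') :
    pullbackApp ((lanAdjunction ω J).unit.app x) r = lan.unitApp x r := by
  rw [← Adjunction.homEquiv_id, lanAdjunction_homEquiv]
  exact comp_id _

lemma lanAdjunction_homEquiv_symm_app (x : Sect (ω.restrict J)) (y : Sect ω)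
    (ψ : x ⟶ (pullback ω J).obj y) (j : I) :
    (((lanAdjunction ω J).homEquiv x y).symm ψ).app j = lan.homOfPullbackApp ψ j := by
  rw [lanAdjunction_homEquiv]
  rfl

end Sect

/-! ### Cartesian sections and restriction along a functor -/

/-- Variant of `exists_isEquivalence_lift_of_adjunction` where the weak equivalences are only
propositionally those of the model category structures. -/
lemma exists_isEquivalence_lift_of_rightQuillen {C D : Type*} [Category* C] [Category* D]
    [MC : ModelCategory C] [MD : ModelCategory D] [iC : CategoryWithWeakEquivalences C]
    [iD : CategoryWithWeakEquivalences D] (hMC : iC = MC.categoryWithWeakEquivalences)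
    (hMD : iD = MD.categoryWithWeakEquivalences) {L : D ⥤ C} {G : C ⥤ D} (adj : L ⊣ G)
    (hGf : ∀ {X Y : C} (p : X ⟶ Y), Fibration p → Fibration (G.map p))
    (hGw : ∀ {X Y : C} (p : X ⟶ Y), WeakEquivalence p → WeakEquivalence (G.map p))
    (GH : Ho C ⥤ Ho D) (e : toHo C ⋙ GH ≅ G ⋙ toHo D)
    (P : ObjectProperty (Ho C)) (Q : ObjectProperty (Ho D))
    [P.IsClosedUnderIsomorphisms] [Q.IsClosedUnderIsomorphisms]
    (hPQ : ∀ y, P ((toHo C).obj y) → Q ((toHo D).obj (G.obj y)))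
    (h₁ : ∀ x, IsCofibrant x → Q ((toHo D).obj x) →
      P ((toHo C).obj (L.obj x)) ∧ WeakEquivalence (adj.unit.app x))
    (h₂ : ∀ y x (p : x ⟶ G.obj y), IsCofibrant x → WeakEquivalence p → P ((toHo C).obj y) →
      WeakEquivalence ((adj.homEquiv _ _).symm p)) :
    ∃ h, (Q.lift (P.ι ⋙ GH) h).IsEquivalence := by
  subst hMC hMD
  -- `L` preserves trivial cofibrations because `G` preserves fibrations; Ken Brown's lemma then
  -- applies to `L`.
  have hL {X Y : D} (i : X ⟶ Y) (hi : Cofibration i) (hi' : WeakEquivalence i) :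
      WeakEquivalence (L.map i) := by
    have h : trivialCofibrations C (L.map i) := by
      rw [← fibrations_llp]
      intro A B p hp
      have := hGf p ((fibration_iff p).2 hp)
      exact (adj.hasLiftingProperty_iff i p).2 inferInstance
    exact (weakEquivalence_iff _).2 h.2
  exact exists_isEquivalence_lift_of_adjunction adj
    (fun f hX hY hf => isIso_toHo_map _ (weakEquivalence_map_of_cofibrant L hL f hX hY hf))
    GH e P Q hPQ h₁ h₂

lemma weakEquivalence_of_comp_eq {C : Type*} [Category* C] [ModelCategory C] {x y z : C}
    {f : x ⟶ y} {g : y ⟶ z} {fg : x ⟶ z} (e : f ≫ g = fg) (hf : WeakEquivalence f)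
    (hfg : WeakEquivalence fg) : WeakEquivalence g :=
  weakEquivalence_of_precomp_of_fac e

lemma weakEquivalence_iso_hom_app {C D : Type*} [Category* C] [Category* D] [ModelCategory D]
    {F G : C ⥤ D} (e : F ≅ G) (x : C) : WeakEquivalence (e.hom.app x) :=
  inferInstance

lemma exists_lift_of_isCofibrant {C : Type*} [Category* C] [ModelCategory C] {x y y' : C}
    (hx : IsCofibrant x) (p : y ⟶ y') (hp : Fibration p) (hp' : WeakEquivalence p) (φ : x ⟶ y') :
    ∃ ψ : x ⟶ y, ψ ≫ p = φ := by
  have sq : CommSq (initial.to y) (initial.to x) p φ := ⟨initial.hom_ext _ _⟩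
  exact ⟨sq.lift, sq.fac_right⟩

namespace Sect

section

variable {I : Type w} [Category.{w'} I] {ω : Diagram.{v, u} I}

instance : (IsCartesian ω).IsClosedUnderIsomorphisms where
  of_iso e h i j f := by
    have := h f
    exact (NatTrans.isIso_app_iff_of_iso (hoEvMap ω f) e).1 this

lemma isCartesian_toHo_iff_of_weakEquivalence {x y : Sect ω} (φ : x ⟶ y)
    (hφ : WeakEquivalence φ) :
    IsCartesian ω ((toHo (Sect ω)).obj x) ↔ IsCartesian ω ((toHo (Sect ω)).obj y) := by
  have := isIso_toHo_map φ hφ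
  exact (IsCartesian ω).prop_iff_of_iso (asIso ((toHo (Sect ω)).map φ))

lemma isCartesian_pullback {I' : Type*} [Category* I'] (J : I' ⥤ I) {y : Sect ω}
    (hy : IsCartesian ω ((toHo (Sect ω)).obj y)) :
    IsCartesian (ω.restrict J) ((toHo _).obj ((pullback ω J).obj y)) :=
  (isCartesian_toHo_obj_iff _ _).2 fun _ _ f => (isCartesian_toHo_obj_iff _ _).1 hy (J.map f)

lemma isIso_leftDerivedPushCounit_app {i j : I} (f : i ⟶ j) (c : ω.fib i) (hc : IsCofibrant c) :
    IsIso ((ω.leftDerivedPushCounit f).app c) :=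
  have : (ω.leftDerivedPush f).IsLeftDerivedFunctor (ω.leftDerivedPushCounit f)
      (weakEquivalences (ω.fib i)) :=
    inferInstanceAs (((ω.push f ⋙ toHo (ω.fib j)).totalLeftDerived (toHo (ω.fib i))
      (weakEquivalences (ω.fib i))).IsLeftDerivedFunctor
        ((ω.push f ⋙ toHo (ω.fib j)).totalLeftDerivedCounit (toHo (ω.fib i))
          (weakEquivalences (ω.fib i))) (weakEquivalences (ω.fib i)))
  isIso_leftDerived_app (LF := ω.leftDerivedPush f) (ω.leftDerivedPushCounit f)
    (fun g hX hY hg => isIso_toHo_map _ (ω.weakEquivalence_push_map f g hX hY hg)) c hc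

/-- If a section is cartesian, its structure maps become weak equivalences after composition with
`ω(f)` of a cofibrant resolution. -/
lemma weakEquivalence_map_comp_map {x : Sect ω} (hx : IsCartesian ω ((toHo (Sect ω)).obj x))
    {i j : I} (f : i ⟶ j) {c : ω.fib i} (p : c ⟶ x.obj i) (hc : IsCofibrant c)
    (hp : WeakEquivalence p) : WeakEquivalence ((ω.push f).map p ≫ x.map f) := by
  refine weakEquivalence_of_isIso (toHo (ω.fib j)) _ ?_
  have h₁ := (isCartesian_toHo_obj_iff _ _).1 hx f
  have h₂ := isIso_leftDerivedPushCounit_app f c hc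
  have e : (toHo (ω.fib i) ⋙ ω.leftDerivedPush f).map p ≫ (ω.leftDerivedPushCounit f).app _ =
      (ω.leftDerivedPushCounit f).app _ ≫ (toHo (ω.fib j)).map ((ω.push f).map p) :=
    (ω.leftDerivedPushCounit f).naturality p
  have h₃ : IsIso ((toHo (ω.fib i) ⋙ ω.leftDerivedPush f).map p) := by
    have := isIso_toHo_map p hp
    dsimp only [Functor.comp_map]
    infer_instance
  have h₄ : IsIso ((ω.leftDerivedPushCounit f).app c ≫
      (toHo (ω.fib j)).map ((ω.push f).map p ≫ x.map f)) := by
    rw [Functor.map_comp, ← assoc, ← e, assoc]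
    infer_instance
  exact IsIso.of_isIso_comp_left ((ω.leftDerivedPushCounit f).app c) _

/-- On cofibrant objects the morphism from the derived to the underived push-forward is invertible,
so only the structure maps matter. -/
lemma isCartesian_of_isCofibrant {x : Sect ω} (hx : ∀ i, IsCofibrant (x.obj i))
    (hx' : ∀ {i j : I} (f : i ⟶ j), WeakEquivalence (x.map f)) :
    IsCartesian ω ((toHo (Sect ω)).obj x) := by
  refine (isCartesian_toHo_obj_iff _ _).2 fun i j f => ?_
  have := isIso_leftDerivedPushCounit_app f _ (hx i)
  have := isIso_toHo_map _ (hx' f)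
  infer_instance

lemma weakEquivalence_map_of_isCartesian {x : Sect ω} {i : I} (hx : IsCofibrant (x.obj i))
    (hx' : IsCartesian ω ((toHo (Sect ω)).obj x)) {j : I} (f : i ⟶ j) :
    WeakEquivalence (x.map f) := by
  simpa using weakEquivalence_map_comp_map hx' f (𝟙 (x.obj i)) hx inferInstance

/-- Trades cofibrancy for a lifting property which no longer refers to the chosen model structure
`M`. -/
lemma isProjCofibrant_of_isCofibrant [M : ModelCategory (Sect ω)]
    (hw : @weakEquivalences (Sect ω) _ M.categoryWithWeakEquivalences = weakEquivalences (Sect ω))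
    (hf : @fibrations (Sect ω) _ M.categoryWithFibrations = objectwiseFibrations ω)
    {x : Sect ω} (hx : IsCofibrant x) : x.IsProjCofibrant := by
  intro y y' p hp hp' φ
  have h₁ : Fibration p := (fibration_iff p).2 (hf ▸ hp)
  have h₂ : @WeakEquivalence (Sect ω) _ _ _ p M.categoryWithWeakEquivalences :=
    @WeakEquivalence.mk (Sect ω) _ _ _ p M.categoryWithWeakEquivalences (by rw [hw]; exact hp')
  exact @exists_lift_of_isCofibrant (Sect ω) _ M _ _ _ hx p h₁ h₂ φ

end

variable {I I' : Type} [SmallCategory I] [SmallCategory I'] {ω : Diagram.{v, u} I} {J : I' ⥤ I}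

/-- Seen as a section along the identity functor, `x` has ω(𝟙)(x_i) as value of its `costructured i`
diagram at the terminal object `(i, 𝟙 i)`. -/
lemma IsProjCofibrant.isCofibrant_obj {x : Sect ω} (hx : x.IsProjCofibrant) (i : I) :
    IsCofibrant (x.obj i) := by
  let x' : Sect (ω.restrict (𝟭 I)) := (pullback ω (𝟭 I)).obj x
  -- Sections of `ω.restrict (𝟭 I)` and of `ω` have the same data, but the axioms involve different
  -- expressions of the structure isomorphisms.
  let u (y : Sect (ω.restrict (𝟭 I))) : Sect ω := mkComp y.objOver (fun f => y.mapOver f)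
    (fun i => (y.mapOver_id i).trans (by rw [← Diagram.pushId'_eq_pushId]; rfl))
    (fun f g => y.mapOver_comp f g)
  have hx' : x'.IsProjCofibrant := by
    intro y y' p hp hp' φ
    obtain ⟨ψ, hψ⟩ := hx (y := u y) (y' := u y') ⟨p.app, p.naturality⟩ hp hp'
      ⟨φ.app, φ.naturality⟩
    exact ⟨⟨ψ.app, ψ.naturality⟩, Sect.hom_ext fun i => congrArg (fun t => t.app i) hψ⟩
  have h := (hx'.costructured i).isCofibrant_obj (CostructuredArrow.mk (𝟙 i)) (fun k =>
    ⟨⟨⟨CostructuredArrow.homMk k.hom (comp_id _)⟩, fun f => by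
      ext
      have := CostructuredArrow.w f
      simpa using this⟩⟩)
  have h' : IsCofibrant ((ω.push (𝟙 i)).obj (x.obj i)) := h
  exact isCofibrant_of_cofibration ((ω.pushId i).hom.app (x.obj i))

lemma weakEquivalence_costructured_map {x : Sect (ω.restrict J)}
    (hx : ∀ r, IsCofibrant (x.objOver r))
    (hx' : ∀ {r s : I'} (f : r ⟶ s), WeakEquivalence (x.mapOver f)) (j : I)
    {k k' : CostructuredArrow J j} (h : k ⟶ k') : WeakEquivalence ((x.costructured j).map h) := by
  have := ω.weakEquivalence_push_map k'.hom (x.mapOver h.left)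
    (ω.isCofibrant_push_obj _ (hx _)) (hx _) (hx' _)
  exact inferInstanceAs (WeakEquivalence (((ω.pushComp' (J.map h.left) k'.hom k.hom
    (CostructuredArrow.w h)).hom.app _) ≫ (ω.push k'.hom).map (x.mapOver h.left) ≫ 𝟙 _))

/-- The restriction of sections along `J` induces an equivalence between the homotopy categories
of cartesian sections if the canonical morphisms to the colimits of projectively cofibrant diagrams
of weak equivalences indexed by the categories `CostructuredArrow J j` are weak equivalences. -/
theorem exists_isEquivalence_lift_hoPullback (hω : HasProjectiveModelStructure ω)
    (hω' : HasProjectiveModelStructure (ω.restrict J))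
    (hJ : ∀ j, ∃ r, Nonempty (J.obj r ⟶ j))
    (hJ' : ∀ j (X : CostructuredArrow J j ⥤ ω.fib j), IsProjCofibrantDiagram X →
      (∀ {k k'} (f : k ⟶ k'), WeakEquivalence (X.map f)) →
        ∀ k, WeakEquivalence (colimit.ι X k)) :
    ∃ h, ((IsCartesian (ω.restrict J)).lift
      ((IsCartesian ω).ι ⋙ hoPullback ω J) h).IsEquivalence := by
  obtain ⟨M, hMw, hMf⟩ := hω
  obtain ⟨M', hMw', hMf'⟩ := hω'
  -- The key fact: cofibrancy and cartesianness of `x` turn the hypothesis `hJ'` into a statement on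
  -- the maps to `lan x`.
  have hinj {x : Sect (ω.restrict J)} (hx : x.IsProjCofibrant)
      (hx' : IsCartesian (ω.restrict J) ((toHo _).obj x)) {r : I'} {j : I} (f : J.obj r ⟶ j) :
      WeakEquivalence (lan.inj x f) :=
    hJ' j _ (hx.costructured j) (weakEquivalence_costructured_map hx.isCofibrant_obj
      (fun f => weakEquivalence_map_of_isCartesian (hx.isCofibrant_obj _) hx' f) j)
      (CostructuredArrow.mk f)
  refine exists_isEquivalence_lift_of_rightQuillen (MC := M) (MD := M') ?_ ?_
    (lanAdjunction ω J) ?_ ?_ (hoPullback ω J)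
    (Localization.fac (pullback ω J ⋙ toHo (Sect (ω.restrict J))) (pullback_inverts ω J)
      (toHo (Sect ω))) _ _ ?_ ?_ ?_
  · exact congrArg CategoryWithWeakEquivalences.mk hMw.symm
  · exact congrArg CategoryWithWeakEquivalences.mk hMw'.symm
  · intro X Y p hp
    have hp' : objectwiseFibrations ω p := hMf ▸ hp.mem
    exact ⟨by rw [hMf']; exact fun r => hp' (J.obj r)⟩
  · exact fun p hp => ⟨fun r => hp.mem (J.obj r)⟩
  · exact fun y hy => isCartesian_pullback J hy
  · intro x hx hx'
    have hxc := isProjCofibrant_of_isCofibrant hMw' hMf' hx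
    have hobj (j) : IsCofibrant (lan.obj x j) := (hxc.costructured j).isCofibrant_colimit
    refine ⟨isCartesian_of_isCofibrant hobj fun {j j'} g => ?_, ⟨fun r => ?_⟩⟩
    -- The structure map of `lan x` along `g` is compared with `lan.inj x f` and `lan.inj x (f ≫
    -- g)`, both weak equivalences.
    · obtain ⟨r, ⟨f⟩⟩ := hJ j
      have h₁ := hinj hxc hx' f
      have h₂ := hinj hxc hx' (f ≫ g)
      have h₃ := ω.weakEquivalence_push_map g _
        (ω.isCofibrant_push_obj f (hxc.isCofibrant_obj r)) (hobj j) h₁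
      have e : (ω.pushComp' f g _ rfl).hom.app _ ≫ (ω.push g).map (lan.inj x f) ≫
        lan.map x g = lan.inj x (f ≫ g) := lan.comp_inj_map x f g _ rfl
      exact weakEquivalence_of_comp_eq rfl h₃ (weakEquivalence_of_comp_eq e
        (weakEquivalence_iso_hom_app _ _) h₂)
    · have h := lanAdjunction_unit_app_app x r
      have h₁ := hinj hxc hx' (𝟙 (J.obj r))
      have h₂ : WeakEquivalence (lan.unitApp x r) := by
        dsimp only [lan.unitApp]
        infer_instance
      rw [← h] at h₂
      exact h₂
  · intro y x p hx hp hy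
    have hxc := isProjCofibrant_of_isCofibrant hMw' hMf' hx
    have hx' := (isCartesian_toHo_iff_of_weakEquivalence p hp).2 (isCartesian_pullback J hy)
    refine ⟨fun j => ?_⟩
    obtain ⟨r, ⟨f⟩⟩ := hJ j
    have h₁ := hinj hxc hx' f
    -- The objects of `y` need not be cofibrant, so its structure map is only tested after
    -- precomposition with ω(f) of the resolution given by `p` at `r`.
    have h₂ := weakEquivalence_map_comp_map hy f (pullbackApp p r)
      (hxc.isCofibrant_obj r) (hp.mem r)
    rw [lanAdjunction_homEquiv_symm_app]
    exact weakEquivalence_of_comp_eq (lan.inj_homOfPullbackApp p f) h₁ h₂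

end Sect

/-! ### Simplices of a product of two simplices, and statement (2) -/

/-- The elements of a nonempty chain in a product of two linear orders can be enumerated. -/
lemma exists_orderEmbedding_of_isChain {α β : Type*} [LinearOrder α] [LinearOrder β]
    (σ : Finset (α × β)) (hσ : IsChain (· ≤ ·) (σ : Set (α × β))) (hσ' : σ.Nonempty) :
    ∃ (n : ℕ) (e : Fin (n + 1) ↪o α × β), ∀ x, x ∈ σ ↔ ∃ i, e i = x := by
  obtain ⟨n, hn⟩ := Nat.exists_eq_add_one_of_ne_zero hσ'.card_ne_zero
  -- The lexicographic order is linear, so it enumerates `σ`. It extends the product order, hence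
  -- agrees with it on a chain.
  let σ' : Finset (α ×ₗ β) := σ.map toLex.toEmbedding
  have hσ'' : σ'.card = n + 1 := (Finset.card_map _).trans hn
  let e := σ'.orderEmbOfFin hσ''
  have he (i) : ofLex (e i) ∈ σ := by
    obtain ⟨y, hy, hy'⟩ := Finset.mem_map.1 (σ'.orderEmbOfFin_mem hσ'' i)
    have : y = ofLex (e i) := hy'
    exact this ▸ hy
  refine ⟨n, OrderEmbedding.ofMapLEIff (fun i => ofLex (e i)) fun i j => ⟨fun h => ?_, fun h => ?_⟩,
    fun x => ⟨fun hx => ?_, ?_⟩⟩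
  · exact e.le_iff_le.1 (Prod.Lex.toLex_mono h)
  · obtain h' | h' := hσ.total (he i) (he j)
    · exact h'
    · have : j ≤ i := e.le_iff_le.1 (Prod.Lex.toLex_mono h')
      rw [le_antisymm h this]
  · have hx' : toLex x ∈ Set.range e := by
      rw [Finset.range_orderEmbOfFin]
      exact Finset.mem_map.2 ⟨x, hx, rfl⟩
    obtain ⟨i, hi⟩ := hx'
    exact ⟨i, congrArg ofLex hi⟩
  · rintro ⟨i, rfl⟩
    exact he i

namespace SimplexDiagonal

/-- The poset of pairs of vertices of two simplices. -/
abbrev Vertices (a : SimplexCategory × SimplexCategory) : Type :=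
  Fin (a.1.len + 1) × Fin (a.2.len + 1)

variable {a : SimplexCategory × SimplexCategory}

/-- The monotone map corresponding to a morphism to `a` from an object in the image of the
diagonal. -/
def toOrderHom {n : SimplexCategory} (f : (Functor.diag SimplexCategory).obj n ⟶ a) :
    Fin (n.len + 1) →o Vertices a :=
  (SimplexCategory.Hom.toOrderHom f.1).prod (SimplexCategory.Hom.toOrderHom f.2)

/-- The morphism to `a` from an object in the image of the diagonal corresponding to
a monotone map. -/
def homMk {n : SimplexCategory} (f : Fin (n.len + 1) →o Vertices a) :
    (Functor.diag SimplexCategory).obj n ⟶ a :=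
  ⟨SimplexCategory.Hom.mk (OrderHom.fst.comp f), SimplexCategory.Hom.mk (OrderHom.snd.comp f)⟩

lemma toOrderHom_injective {n : SimplexCategory}
    {f g : (Functor.diag SimplexCategory).obj n ⟶ a} (h : toOrderHom f = toOrderHom g) : f = g := by
  have h' (i) : toOrderHom f i = toOrderHom g i := by rw [h]
  refine Prod.hom_ext (SimplexCategory.Hom.ext _ _ ?_) (SimplexCategory.Hom.ext _ _ ?_)
  · exact OrderHom.ext _ _ (funext fun i => congrArg Prod.fst (h' i))
  · exact OrderHom.ext _ _ (funext fun i => congrArg Prod.snd (h' i))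

/-- The image of the monotone map corresponding to an object over `a`. -/
def range (k : CostructuredArrow (Functor.diag SimplexCategory) a) : Finset (Vertices a) :=
  Finset.univ.image (toOrderHom k.hom)

lemma mem_range (k : CostructuredArrow (Functor.diag SimplexCategory) a) (x : Vertices a) :
    x ∈ range k ↔ ∃ i, toOrderHom k.hom i = x := by
  simp [range]

/-- The vertex ⊤ is comparable with every other one, so the chains are stable under inserting it and
form a cone with apex `m = ⊤`. -/
lemma weakEquivalence_colimit_ι {M : Type u} [Category.{v} M] [ModelCategory M] [HasColimits M]
    [HasLimits M] {X : CostructuredArrow (Functor.diag SimplexCategory) a ⥤ M}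
    (hX : IsProjCofibrantDiagram X) (hX' : ∀ {k k'} (f : k ⟶ k'), WeakEquivalence (X.map f)) (k) :
    WeakEquivalence (colimit.ι X k) := by
  refine hX.weakEquivalence_colimit_ι (rg := range) (m := ⊤)
    (Ch := fun σ => IsChain (· ≤ ·) (σ : Set (Vertices a))) hX' ?_ ?_ ?_ ?_ ?_ ?_ k
  · intro k k' f x hx
    rw [mem_range] at hx ⊢
    obtain ⟨i, rfl⟩ := hx
    refine ⟨SimplexCategory.Hom.toOrderHom f.left i, ?_⟩
    rw [← CostructuredArrow.w f]
    rfl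
  · exact fun k => ⟨_, (mem_range k _).2 ⟨0, rfl⟩⟩
  · intro k x hx y hy _
    obtain ⟨i, rfl⟩ := (mem_range k x).1 hx
    obtain ⟨j, rfl⟩ := (mem_range k y).1 hy
    exact (le_total i j).imp (fun h => (toOrderHom k.hom).monotone h)
      (fun h => (toOrderHom k.hom).monotone h)
  · exact fun σ τ hσ h => hσ.mono h
  · intro σ hσ
    rw [Finset.coe_insert]
    exact hσ.insert fun _ _ _ => Or.inr le_top
  · intro σ hσ hσ'
    -- The nondegenerate simplex enumerating `σ` is the terminal object: a simplex with vertices in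
    -- `σ` factors uniquely through the embedding `e`.
    obtain ⟨n, e, he⟩ := exists_orderEmbedding_of_isChain σ hσ hσ'
    let k₀ : CostructuredArrow (Functor.diag SimplexCategory) a :=
      CostructuredArrow.mk (Y := SimplexCategory.mk n) (homMk (n := SimplexCategory.mk n) e.toOrderHom)
    have hk₀ (i) : toOrderHom k₀.hom i = e i := rfl
    refine ⟨k₀, ?_, fun k hk => ?_⟩
    · ext x
      rw [mem_range, he]
      rfl
    · have h (i) : ∃ j, e j = toOrderHom k.hom i := (he _).1 (hk ((mem_range k _).2 ⟨i, rfl⟩))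
      choose j hj using h
      let j' : Fin (k.left.len + 1) →o Fin (n + 1) := ⟨j, fun x y hxy => by
        rw [← e.le_iff_le, hj, hj]
        exact (toOrderHom k.hom).monotone hxy⟩
      let f : k ⟶ k₀ := CostructuredArrow.homMk (SimplexCategory.Hom.mk j')
        (toOrderHom_injective (OrderHom.ext _ _ (funext hj)))
      refine ⟨⟨⟨f⟩, fun g => ?_⟩⟩
      ext : 1
      refine SimplexCategory.Hom.ext _ _ (OrderHom.ext _ _ (funext fun i => e.injective ?_))
      refine Eq.trans ?_ (hj i).symm
      rw [← CostructuredArrow.w g]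
      rfl

end SimplexDiagonal

theorem Sect.exists_isEquivalence_lift_hoPullback_diag
    (F : Diagram.{v, u} (SimplexCategory × SimplexCategory)) (hF : HasProjectiveModelStructure F)
    (hF' : HasProjectiveModelStructure (F.restrict (Functor.diag SimplexCategory))) :
    ∃ h, ((IsCartesian (F.restrict (Functor.diag SimplexCategory))).lift
      ((IsCartesian F).ι ⋙ hoPullback F (Functor.diag SimplexCategory)) h).IsEquivalence :=
  exists_isEquivalence_lift_hoPullback hF hF'
    (fun _ => ⟨SimplexCategory.mk 0, ⟨SimplexDiagonal.homMk ⟨fun _ => ⊤, fun _ _ _ => le_rfl⟩⟩⟩)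
    (fun _ _ hX hX' k => SimplexDiagonal.weakEquivalence_colimit_ι hX hX' k)

/-! ### Shifted sections and contraction to an initial object -/

/-- Variant of `exists_isEquivalence_lift_of_zigzag` where the weak equivalences are only
propositionally those of the model category structure. -/
lemma exists_isEquivalence_lift_of_zigzag_of_eq {C D : Type*} [Category* C] [Category* D]
    [ModelCategory C] [MD : ModelCategory D] [iD : CategoryWithWeakEquivalences D]
    (hMD : iD = MD.categoryWithWeakEquivalences)
    (L : C ⥤ D) (S : D ⥤ C) (T : D ⥤ D)
    (K : ObjectProperty D) (hK : ∀ x, IsCofibrant x → K x)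
    (hL : ∀ {X Y : C} (f : X ⟶ Y), IsCofibrant X → IsCofibrant Y → WeakEquivalence f →
      WeakEquivalence (L.map f)) (hLK : ∀ X, IsCofibrant X → K (L.obj X))
    (hS : ∀ {X Y : D} (f : X ⟶ Y), K X → K Y → WeakEquivalence f → WeakEquivalence (S.map f))
    (hSK : ∀ X, K X → IsCofibrant (S.obj X))
    (hT : ∀ {X Y : D} (f : X ⟶ Y), K X → K Y → WeakEquivalence f → WeakEquivalence (T.map f))
    (i : L ⋙ S ≅ 𝟭 C) (a : S ⋙ L ⟶ T) (b : 𝟭 D ⟶ T) (P : ObjectProperty (Ho D))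
    [P.IsClosedUnderIsomorphisms] (hPL : ∀ X, IsCofibrant X → P ((toHo D).obj (L.obj X)))
    (hab : ∀ x, IsCofibrant x → P ((toHo D).obj x) →
      WeakEquivalence (a.app x) ∧ WeakEquivalence (b.app x))
    (LH : Ho C ⥤ Ho D) (α : toHo C ⋙ LH ⟶ L ⋙ toHo D)
    [LH.IsLeftDerivedFunctor α (weakEquivalences C)] :
    ∃ h, (P.lift LH h).IsEquivalence := by
  subst hMD
  exact exists_isEquivalence_lift_of_zigzag L S T K hK hL hLK hS hSK hT i a b P hPL hab LH α

namespace Diagram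

variable {I : Type w} [Category.{w'} I] {ω : Diagram.{v, u} I}

lemma weakEquivalence_comp_id {i j k : I} (f : i ⟶ j) (g : j ⟶ k) (fg : i ⟶ k) (h : f ≫ g = fg)
    {a : ω.fib i} {b : ω.fib j} (α : (ω.push f).obj a ⟶ b) (ha : IsCofibrant a)
    (hb : IsCofibrant b) (hα : WeakEquivalence α) :
    WeakEquivalence (ω.comp f g fg h α (𝟙 _)) := by
  have := ω.weakEquivalence_push_map g α (ω.isCofibrant_push_obj f ha) hb hα
  dsimp only [comp]
  infer_instance

lemma weakEquivalence_of_comp_id {i j k : I} (f : i ⟶ j) (g : j ⟶ k) (fg : i ⟶ k)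
    (h : f ≫ g = fg) {a : ω.fib i} {c : ω.fib k} {β : (ω.push g).obj ((ω.push f).obj a) ⟶ c}
    (hβ : WeakEquivalence (ω.comp f g fg h (𝟙 _) β)) : WeakEquivalence β := by
  have e : (ω.pushComp' f g fg h).hom.app a ≫ β = ω.comp f g fg h (𝟙 _) β := by
    simp [comp]
  exact weakEquivalence_of_comp_eq e (weakEquivalence_iso_hom_app _ _) hβ

end Diagram

namespace Sect

variable {I : Type w} [Category.{w'} I] (ω : Diagram.{v, u} I) {I' : Type*} [Category* I']
  {J : I' ⥤ I}

lemma mapOver_eq_comp {x : Sect (ω.restrict J)} {i j k : I'} (f : i ⟶ j) (g : j ⟶ k) (fg : i ⟶ k)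
    (h : f ≫ g = fg) (h' : J.map f ≫ J.map g = J.map fg) :
    x.mapOver fg = ω.comp (J.map f) (J.map g) (J.map fg) h' (x.mapOver f) (x.mapOver g) := by
  subst h
  exact x.mapOver_comp f g

lemma comp_mapOver_id (x : Sect (ω.restrict J)) {i : I'} (f : i ⟶ i) (hf : f = 𝟙 i) {j : I}
    (g : J.obj i ⟶ j) (h : J.map f ≫ g = g) {c : ω.fib j} (β : (ω.push g).obj (x.objOver i) ⟶ c) :
    ω.comp (J.map f) g g h (x.mapOver f) β = β := by
  subst hf
  rw [mapOver_id, Diagram.pushId'_comp]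

variable {ω} {E : I' ⥤ I'} (u : E ⋙ J ⟶ J)

namespace shift

/-- The objects of the section `shift u x`. -/
def obj (x : Sect (ω.restrict J)) (i : I') : ω.fib (J.obj i) :=
  (ω.push (u.app i)).obj (x.objOver (E.obj i))

variable {u} in
/-- Morphisms `ω(u(i))(x_{E(i)}) ⟶ c`, considered as morphisms to the object `shift.obj u x i`. -/
def ι (x : Sect (ω.restrict J)) (i : I') :
    (ω.push (u.app i)).obj (x.objOver (E.obj i)) ⟶ obj u x i := 𝟙 _

lemma hom_ext {x : Sect (ω.restrict J)} {i : I'} {j : I} (f : J.obj i ⟶ j)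
    (uf : J.obj (E.obj i) ⟶ j) (h : u.app i ≫ f = uf) {c : ω.fib j}
    {β β' : (ω.push f).obj (obj u x i) ⟶ c}
    (e : ω.comp (u.app i) f uf h (ι x i) β = ω.comp (u.app i) f uf h (ι x i) β') : β = β' :=
  Diagram.hom_ext_of_comp _ _ _ h e

lemma naturality {i j : I'} (g : i ⟶ j) :
    J.map (E.map g) ≫ u.app j = u.app i ≫ J.map g := u.naturality g

/-- The structure maps of the section `shift u x`. -/
def map (x : Sect (ω.restrict J)) {i j : I'} (g : i ⟶ j) :
    (ω.push (J.map g)).obj (obj u x i) ⟶ obj u x j :=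
  ω.desc (u.app i) (J.map g) _ rfl
    (ω.comp (J.map (E.map g)) (u.app j) _ (naturality u g) (x.mapOver (E.map g)) (ι x j))

lemma comp_ι_map (x : Sect (ω.restrict J)) {i j : I'} (g : i ⟶ j) (f : J.obj (E.obj i) ⟶ J.obj j)
    (h : u.app i ≫ J.map g = f) :
    ω.comp (u.app i) (J.map g) f h (ι x i) (map u x g) =
      ω.comp (J.map (E.map g)) (u.app j) f ((naturality u g).trans h) (x.mapOver (E.map g))
        (ι x j) := by
  subst h
  exact ω.comp_desc _ _ _ _ _

/-- The functoriality of `shift.obj`. -/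
def appMap {x y : Sect (ω.restrict J)} (φ : x ⟶ y) (i : I') : obj u x i ⟶ obj u y i :=
  (ω.push (u.app i)).map (appOver φ (E.obj i))

lemma ι_appMap {x y : Sect (ω.restrict J)} (φ : x ⟶ y) (i : I') :
    ι x i ≫ appMap u φ i = (ω.push (u.app i)).map (appOver φ (E.obj i)) ≫ ι y i :=
  (id_comp _).trans (comp_id _).symm

lemma comp_ι_appMap {x y : Sect (ω.restrict J)} (φ : x ⟶ y) {r i : I'} (g : r ⟶ E.obj i)
    (f : J.obj r ⟶ J.obj i) (h : J.map g ≫ u.app i = f) :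
    ω.comp (J.map g) (u.app i) f h (x.mapOver g) (ι x i) ≫ appMap u φ i =
      (ω.push f).map (appOver φ r) ≫
        ω.comp (J.map g) (u.app i) f h (y.mapOver g) (ι y i) := by
  rw [← Diagram.comp_comp, ι_appMap, Diagram.comp_map_comp, appOver_naturality, Diagram.map_comp]

lemma map_appMap {x y : Sect (ω.restrict J)} (φ : x ⟶ y) {i j : I'} (g : i ⟶ j) :
    map u x g ≫ appMap u φ j = (ω.push (J.map g)).map (appMap u φ i) ≫ map u y g := by
  refine hom_ext u _ _ rfl ?_
  rw [Diagram.comp_comp, Diagram.comp_map_comp, comp_ι_map, ι_appMap, ← Diagram.map_comp,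
    comp_ι_map, comp_ι_appMap]

end shift

/-- The section `i ↦ ω(u(i))(x_{E(i)})` for a natural transformation `u : E ⋙ J ⟶ J`. -/
def shift : Sect (ω.restrict J) ⥤ Sect (ω.restrict J) where
  obj x := mkOver (shift.obj u x) (shift.map u x)
    (fun i => by
      refine shift.hom_ext u _ (u.app i) (by simp) ?_
      rw [shift.comp_ι_map, Diagram.comp_pushId']
      exact comp_mapOver_id ω x _ (E.map_id i) _ _ _)
    (fun {i j k} f g => by
      refine shift.hom_ext u _ _ rfl ?_
      rw [shift.comp_ι_map, ← ω.comp_assoc (u.app i) (J.map f) (J.map g) _ _ _ rfl (by simp) rfl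
        (J.map_comp f g).symm, shift.comp_ι_map,
        ω.comp_assoc (J.map (E.map f)) (u.app j) (J.map g) _ _ _ _ _
          (by rw [J.map_comp, reassoc_of% (shift.naturality u f)]) rfl, shift.comp_ι_map,
        mapOver_eq_comp ω (E.map f) (E.map g) _ (E.map_comp f g).symm (by simp),
        ω.comp_assoc (J.map (E.map f)) (J.map (E.map g)) (u.app k) _ (u.app j ≫ J.map g) _ _ _
          (by rw [J.map_comp, reassoc_of% (shift.naturality u f)]) (shift.naturality u g)])
  map φ := homMkOver (shift.appMap u φ) (shift.map_appMap u φ)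
  map_id x := hom_ext_over fun i => (ω.push (u.app i)).map_id _
  map_comp φ ψ := hom_ext_over fun i => (ω.push (u.app i)).map_comp _ _

variable {u}

/-- Common computation for the two legs of the zigzag: `r = i` for the morphism from a section to
its shift, and a fixed `r` for the morphism from the section induced by ω(ε)(x_r). -/
lemma comp_shift_ι_map (x : Sect (ω.restrict J)) {r i j : I'} (e : r ⟶ E.obj i)
    (e' : r ⟶ E.obj j) (g : i ⟶ j) (he : e ≫ E.map g = e') (v : J.obj r ⟶ J.obj i)
    (v' : J.obj r ⟶ J.obj j) (hv : J.map e ≫ u.app i = v) (hv' : J.map e' ≫ u.app j = v')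
    (h : v ≫ J.map g = v') :
    ω.comp v (J.map g) v' h (ω.comp (J.map e) (u.app i) v hv (x.mapOver e) (shift.ι x i))
      (shift.map u x g) =
        ω.comp (J.map e') (u.app j) v' hv' (x.mapOver e') (shift.ι x j) := by
  rw [ω.comp_assoc (J.map e) (u.app i) (J.map g) _ _ _ _ _
    (by rw [← h, ← hv, assoc]) rfl, shift.comp_ι_map, mapOver_eq_comp ω e (E.map g) e' he
    (by rw [← he, J.map_comp]), ω.comp_assoc (J.map e) (J.map (E.map g)) (u.app j) _
      (u.app i ≫ J.map g) _ _ _ (by rw [← h, ← hv, assoc]) (shift.naturality u g)]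

/-- The components of the morphism from a section to a shifted section. -/
def shift.unitApp (e : ∀ i, i ⟶ E.obj i)
    (he : ∀ i, J.map (e i) ≫ u.app i = 𝟙 (J.obj i))
    (x : Sect (ω.restrict J)) (i : I') : x.objOver i ⟶ shift.obj u x i :=
  (ω.pushId (J.obj i)).inv.app (x.objOver i) ≫
    ω.comp (J.map (e i)) (u.app i) (𝟙 _) (he i) (x.mapOver (e i)) (shift.ι x i)

lemma shift.pushId_hom_unitApp (e : ∀ i, i ⟶ E.obj i)
    (he : ∀ i, J.map (e i) ≫ u.app i = 𝟙 (J.obj i))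
    (x : Sect (ω.restrict J)) (i : I') :
    (ω.pushId' (𝟙 (J.obj i)) rfl).hom.app (x.objOver i) ≫ shift.unitApp e he x i =
      ω.comp (J.map (e i)) (u.app i) (𝟙 _) (he i) (x.mapOver (e i)) (shift.ι x i) := by
  rw [Diagram.pushId'_eq_pushId]
  exact Iso.hom_inv_id_app_assoc _ _ _

lemma shift.mapOver_unitApp (e : ∀ i, i ⟶ E.obj i)
    (hnat : ∀ {i j : I'} (g : i ⟶ j), g ≫ e j = e i ≫ E.map g)
    (he : ∀ i, J.map (e i) ≫ u.app i = 𝟙 (J.obj i))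
    (x : Sect (ω.restrict J)) {i j : I'} (g : i ⟶ j) :
    x.mapOver g ≫ shift.unitApp e he x j =
      (ω.push (J.map g)).map (shift.unitApp e he x i) ≫ shift.map u x g := by
  have hg := hnat g
  have h : J.map (e i ≫ E.map g) ≫ u.app j = J.map g := by
    rw [← hg, J.map_comp, assoc, he, comp_id]
  -- Both sides equal the composite over `e i ≫ E.map g`, which is `g ≫ e j` by naturality.
  trans ω.comp (J.map (e i ≫ E.map g)) (u.app j) (J.map g) h
    (x.mapOver (e i ≫ E.map g)) (shift.ι x j)
  · rw [← ω.comp_pushId' (J.map g) (𝟙 _) rfl (comp_id _) (x.mapOver g), ← Diagram.comp_comp,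
      shift.pushId_hom_unitApp, mapOver_eq_comp ω g (e j) _ hg (by rw [← hg, J.map_comp]),
      ω.comp_assoc]
  · rw [← ω.pushId'_comp (𝟙 _) rfl (J.map g) (id_comp _)
      ((ω.push (J.map g)).map (shift.unitApp e he x i) ≫ shift.map u x g), Diagram.comp_map_comp,
      shift.pushId_hom_unitApp, comp_shift_ι_map x (e i) _ g rfl _ _ _ h]

/-- The morphism from a section to a shifted section induced by a natural transformation
`e : 𝟭 I' ⟶ E`. -/
def toShift (e : ∀ i, i ⟶ E.obj i)
    (hnat : ∀ {i j : I'} (g : i ⟶ j), g ≫ e j = e i ≫ E.map g)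
    (he : ∀ i, J.map (e i) ≫ u.app i = 𝟙 (J.obj i)) :
    𝟭 (Sect (ω.restrict J)) ⟶ shift u where
  app x := homMkOver (shift.unitApp e he x) (shift.mapOver_unitApp e hnat he x)
  naturality x y φ := by
    refine hom_ext_over fun i => ?_
    change appOver φ i ≫ shift.unitApp e he y i = shift.unitApp e he x i ≫ shift.appMap u φ i
    have h := (ω.pushId' (𝟙 (J.obj i)) rfl).hom.naturality (appOver φ i)
    simp only [Functor.id_map] at h
    rw [← cancel_epi ((ω.pushId' (𝟙 (J.obj i)) rfl).hom.app (x.objOver i)), ← assoc, ← assoc,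
      shift.pushId_hom_unitApp, shift.comp_ι_appMap, ← h, assoc, shift.pushId_hom_unitApp]

end Sect

namespace Sect

section

variable {I : Type w} [Category.{w'} I] (ω : Diagram.{v, u} I) {I' : Type*} [Category* I']
  {J : I' ⥤ I} {i₀ : I} (h₀ : IsInitial i₀)

lemma comp_pushComp'_inv {i j k : I} (f : i ⟶ j) (g : j ⟶ k) (fg : i ⟶ k) (h : f ≫ g = fg)
    (c : ω.fib i) : ω.comp f g fg h (𝟙 _) ((ω.pushComp' f g fg h).inv.app c) = 𝟙 _ := by
  simp [Diagram.comp]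

/-- The section `r ↦ ω(i₀ ⟶ J(r))(c)`. -/
abbrev ofInitialOver (J : I' ⥤ I) : ω.fib i₀ ⥤ Sect (ω.restrict J) :=
  ofInitial ω h₀ ⋙ pullback ω J

/-- The structure maps of the sections `r ↦ ω(i₀ ⟶ J(r))(c)`. -/
def ofInitialOver.map (c : ω.fib i₀) {r s : I'} (g : r ⟶ s) :
    (ω.push (J.map g)).obj ((ω.push (h₀.to (J.obj r))).obj c) ⟶
      (ω.push (h₀.to (J.obj s))).obj c :=
  (ω.pushComp' (h₀.to _) (J.map g) (h₀.to _) (h₀.hom_ext _ _)).inv.app c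

lemma ofInitialOver.comp_map (c : ω.fib i₀) {r s : I'} (g : r ⟶ s) :
    ω.comp (h₀.to (J.obj r)) (J.map g) (h₀.to (J.obj s)) (h₀.hom_ext _ _) (𝟙 _)
      (map ω h₀ c g) = 𝟙 _ :=
  comp_pushComp'_inv _ _ _ _ _ _

/-- The functor which sends a section `x` to `ω(ε)(x_r)` for `ε : J(r) ⟶ i₀`. -/
def evPush {r : I'} {i : I} (ε : J.obj r ⟶ i) : Sect (ω.restrict J) ⥤ ω.fib i where
  obj x := (ω.push ε).obj (x.objOver r)
  map φ := (ω.push ε).map (appOver φ r)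
  map_id _ := (ω.push ε).map_id _
  map_comp _ _ := (ω.push ε).map_comp _ _

/-- The evaluation of the section `r ↦ ω(i₀ ⟶ J(r))(c)` gives back `c`. -/
def ofInitialOverCompEvPush {r : I'} (ε : J.obj r ⟶ i₀) :
    ofInitialOver ω h₀ J ⋙ evPush ω ε ≅ 𝟭 (ω.fib i₀) :=
  (ω.pushComp' (h₀.to (J.obj r)) ε (𝟙 _) (h₀.hom_ext _ _)).symm ≪≫ ω.pushId i₀

variable {ω} {E : I' ⥤ I'} {u : E ⋙ J ⟶ J} {r : I'} (ε : J.obj r ⟶ i₀) (e : ∀ i, r ⟶ E.obj i)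
  (he : ∀ i, J.map (e i) ≫ u.app i = ε ≫ h₀.to (J.obj i))

/-- The components of the morphism from the section induced by `ω(ε)(x_r)` to a
shifted section. -/
def shift.descApp (x : Sect (ω.restrict J)) (i : I') :
    (ω.push (h₀.to (J.obj i))).obj ((ω.push ε).obj (x.objOver r)) ⟶ shift.obj u x i :=
  ω.desc ε (h₀.to (J.obj i)) _ rfl
    (ω.comp (J.map (e i)) (u.app i) _ (he i) (x.mapOver (e i)) (shift.ι x i))

lemma shift.comp_descApp (x : Sect (ω.restrict J)) (i : I') :
    ω.comp ε (h₀.to (J.obj i)) _ rfl (𝟙 _) (shift.descApp h₀ ε e he x i) =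
      ω.comp (J.map (e i)) (u.app i) _ (he i) (x.mapOver (e i)) (shift.ι x i) :=
  ω.comp_desc _ _ _ _ _

lemma shift.map_descApp (hnat : ∀ {i j : I'} (g : i ⟶ j), e i ≫ E.map g = e j)
    (x : Sect (ω.restrict J)) {i j : I'} (g : i ⟶ j) :
    ofInitialOver.map ω h₀ ((ω.push ε).obj (x.objOver r)) g ≫ shift.descApp h₀ ε e he x j =
      (ω.push (J.map g)).map (shift.descApp h₀ ε e he x i) ≫ shift.map u x g := by
  -- The source is a triple push-forward; it is unfolded twice, until both sides are morphisms out
  -- of a single push-forward of `x.objOver r`.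
  refine Diagram.hom_ext_of_comp (h₀.to (J.obj i)) (J.map g) (h₀.to (J.obj j)) (h₀.hom_ext _ _) ?_
  rw [Diagram.comp_comp, ofInitialOver.comp_map, id_comp, Diagram.comp_map_comp, id_comp]
  refine Diagram.hom_ext_of_comp ε (h₀.to (J.obj j)) _ rfl ?_
  rw [← ω.comp_assoc ε (h₀.to (J.obj i)) (J.map g) _ (h₀.to (J.obj j)) _ rfl
      (by rw [assoc, h₀.hom_ext (h₀.to (J.obj i) ≫ J.map g) (h₀.to (J.obj j))]) rfl
      (h₀.hom_ext _ _), shift.comp_descApp, shift.comp_descApp,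
    comp_shift_ι_map x (e i) (e j) g (hnat g) _ _ _ (he j)]

/-- The morphism from the section induced by `ω(ε)(x_r)` to a shifted section. -/
def shiftDesc (hnat : ∀ {i j : I'} (g : i ⟶ j), e i ≫ E.map g = e j) :
    evPush ω ε ⋙ ofInitialOver ω h₀ J ⟶ shift u where
  app x := homMkOver (shift.descApp h₀ ε e he x) (shift.map_descApp h₀ ε e he hnat x)
  naturality x y φ := by
    refine hom_ext_over fun i => ?_
    change (ω.push (h₀.to (J.obj i))).map ((ω.push ε).map (appOver φ r)) ≫
      shift.descApp h₀ ε e he y i = shift.descApp h₀ ε e he x i ≫ shift.appMap u φ i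
    refine Diagram.hom_ext_of_comp ε (h₀.to (J.obj i)) _ rfl ?_
    have h := Diagram.map_comp (h := rfl (a := ε ≫ h₀.to (J.obj i))) (appOver φ r) (𝟙 _)
      (shift.descApp h₀ ε e he y i)
    rw [Diagram.comp_map_comp, Diagram.comp_comp, shift.comp_descApp, shift.comp_ι_appMap, id_comp,
      ← shift.comp_descApp, h, comp_id]

end

/-- The restriction to `I'` of sections induced by objects over an initial object `i₀` gives an
equivalence from `Ho ω(i₀)` to the homotopy category of cartesian sections if the sections can be
contracted to `i₀` using an endofunctor `E` of `I'`. -/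
theorem exists_isEquivalence_lift_hoOfInitial {I : Type w} [Category.{w'} I]
    (ω : Diagram.{v, u} I) {I' : Type} [SmallCategory I'] {J : I' ⥤ I} {i₀ : I}
    (h₀ : IsInitial i₀) (hω : HasProjectiveModelStructure (ω.restrict J)) {E : I' ⥤ I'}
    (u : E ⋙ J ⟶ J) (e : ∀ i, i ⟶ E.obj i)
    (hnat : ∀ {i j : I'} (g : i ⟶ j), g ≫ e j = e i ≫ E.map g)
    (he : ∀ i, J.map (e i) ≫ u.app i = 𝟙 (J.obj i)) {r : I'} (ε : J.obj r ⟶ i₀)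
    (e' : ∀ i, r ⟶ E.obj i) (hnat' : ∀ {i j : I'} (g : i ⟶ j), e' i ≫ E.map g = e' j)
    (he' : ∀ i, J.map (e' i) ≫ u.app i = ε ≫ h₀.to (J.obj i)) :
    ∃ h, ((IsCartesian (ω.restrict J)).lift (hoOfInitial ω J h₀) h).IsEquivalence := by
  obtain ⟨M, hMw, hMf⟩ := hω
  have hLH : (hoOfInitial ω J h₀).IsLeftDerivedFunctor
      ((ofInitialOver ω h₀ J ⋙ toHo (Sect (ω.restrict J))).totalLeftDerivedCounit
        (toHo (ω.fib i₀)) (weakEquivalences (ω.fib i₀))) (weakEquivalences (ω.fib i₀)) :=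
    inferInstanceAs (((ofInitialOver ω h₀ J ⋙ toHo (Sect (ω.restrict J))).totalLeftDerived
      (toHo (ω.fib i₀)) (weakEquivalences (ω.fib i₀))).IsLeftDerivedFunctor
        ((ofInitialOver ω h₀ J ⋙ toHo (Sect (ω.restrict J))).totalLeftDerivedCounit
          (toHo (ω.fib i₀)) (weakEquivalences (ω.fib i₀))) (weakEquivalences (ω.fib i₀)))
  have hcof {x : Sect (ω.restrict J)} (hx : IsCofibrant x) (i : I') : IsCofibrant (x.objOver i) :=
    (isProjCofibrant_of_isCofibrant hMw hMf hx).isCofibrant_obj i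
  -- `K` is objectwise cofibrancy: this is what the sections induced by a cofibrant object of ω(i₀)
  -- are known to satisfy, and it suffices for ω(ε)(x_r) and the shift to preserve weak
  -- equivalences.
  refine exists_isEquivalence_lift_of_zigzag_of_eq (MD := M) ?_ (ofInitialOver ω h₀ J)
    (evPush ω ε) (shift u) (fun x => ∀ i, IsCofibrant (x.objOver i)) (fun x hx i => hcof hx i)
    (fun f hX hY hf => ⟨fun i => ω.weakEquivalence_push_map (h₀.to (J.obj i)) f hX hY hf⟩)
    (fun X hX i => ω.isCofibrant_push_obj (h₀.to (J.obj i)) hX)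
    (fun φ hX hY hφ => ω.weakEquivalence_push_map ε (appOver φ r) (hX r) (hY r) (hφ.mem r))
    (fun X hX => ω.isCofibrant_push_obj ε (hX r))
    (fun φ hX hY hφ => ⟨fun i => ω.weakEquivalence_push_map (u.app i) (appOver φ (E.obj i))
      (hX _) (hY _) (hφ.mem _)⟩)
    (ofInitialOverCompEvPush ω h₀ ε) (shiftDesc h₀ ε e' he' hnat') (toShift e hnat he) _
    (fun X hX => ?_) (fun x hx hx' => ?_) _
    ((ofInitialOver ω h₀ J ⋙ toHo (Sect (ω.restrict J))).totalLeftDerivedCounit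
        (toHo (ω.fib i₀)) (weakEquivalences (ω.fib i₀)))
  · exact congrArg CategoryWithWeakEquivalences.mk hMw.symm
  · exact isCartesian_of_isCofibrant (fun i => ω.isCofibrant_push_obj (h₀.to (J.obj i)) hX)
      (fun {i j} g => weakEquivalence_iso_hom_app (ω.pushComp' (h₀.to (J.obj i)) (J.map g)
        (h₀.to (J.obj j)) (h₀.hom_ext _ _)).symm X)
  -- Each leg of the zigzag is, up to structure isomorphisms, ω(u(i)) applied to a structure map of
  -- `x`, along `e' i` or `e i`; these are weak equivalences between cofibrant objects.
  · have hmap {i j : I'} (g : i ⟶ j) : WeakEquivalence (x.mapOver g) :=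
      weakEquivalence_map_of_isCartesian (hcof hx i) hx' g
    refine ⟨⟨fun i => ?_⟩, ⟨fun i => ?_⟩⟩
    · have h : WeakEquivalence (ω.comp (J.map (e' i)) (u.app i) _ (he' i) (x.mapOver (e' i))
          (shift.ι x i)) :=
        Diagram.weakEquivalence_comp_id _ _ _ _ _ (hcof hx _) (hcof hx _) (hmap _)
      rw [← shift.comp_descApp] at h
      exact Diagram.weakEquivalence_of_comp_id _ _ _ _ h
    · have h : WeakEquivalence (ω.comp (J.map (e i)) (u.app i) _ (he i) (x.mapOver (e i))
          (shift.ι x i)) :=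
        Diagram.weakEquivalence_comp_id _ _ _ _ _ (hcof hx _) (hcof hx _) (hmap _)
      exact weakEquivalence_of_comp_eq (shift.pushId_hom_unitApp e he x i)
        (weakEquivalence_iso_hom_app _ _) h

end Sect

/-! ### Décalage of Δ, and statement (1) -/

/-- The monotone map `[p + 1] ⟶ [q + 1]` which extends a monotone map `[p] ⟶ [q]` and preserves
the last elements. -/
def snocOrderHom {m n : ℕ} (f : Fin m →o Fin n) : Fin (m + 1) →o Fin (n + 1) where
  toFun := Fin.snoc (α := fun _ => Fin (n + 1)) (fun i => (f i).castSucc) (Fin.last n)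
  monotone' i j h := by
    induction j using Fin.lastCases with
    | last =>
      rw [Fin.snoc_last]
      exact Fin.le_last _
    | cast j =>
      induction i using Fin.lastCases with
      | last => exact absurd h (Fin.castSucc_lt_last j).not_ge
      | cast i =>
        rw [Fin.snoc_castSucc, Fin.snoc_castSucc]
        exact Fin.castSucc_le_castSucc_iff.2 (f.monotone (Fin.castSucc_le_castSucc_iff.1 h))

@[simp]
lemma snocOrderHom_castSucc {m n : ℕ} (f : Fin m →o Fin n) (i : Fin m) :
    snocOrderHom f i.castSucc = (f i).castSucc :=
  Fin.snoc_castSucc (α := fun _ => Fin (n + 1)) (Fin.last n) (fun i => (f i).castSucc) i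

@[simp]
lemma snocOrderHom_last {m n : ℕ} (f : Fin m →o Fin n) :
    snocOrderHom f (Fin.last m) = Fin.last n :=
  Fin.snoc_last (α := fun _ => Fin (n + 1)) (Fin.last n) (fun i => (f i).castSucc)

/-- The pointed monotone map which sends the last element to the base point. -/
def collapseLast (n : ℕ) : WithTop (Fin (n + 1)) →o WithTop (Fin n) where
  toFun := WithTop.recTopCoe ⊤
    (Fin.snoc (α := fun _ => WithTop (Fin n)) (fun i => (i : WithTop (Fin n))) ⊤)
  monotone' x y h := by
    induction y with
    | top => exact le_top
    | coe j =>
      induction x with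
      | top => exact absurd h (WithTop.coe_lt_top j).not_ge
      | coe i =>
        rw [WithTop.coe_le_coe] at h
        simp only [WithTop.recTopCoe_coe]
        induction j using Fin.lastCases with
        | last =>
          rw [Fin.snoc_last]
          exact le_top
        | cast j =>
          induction i using Fin.lastCases with
          | last => exact absurd h (Fin.castSucc_lt_last j).not_ge
          | cast i =>
            rw [Fin.snoc_castSucc, Fin.snoc_castSucc]
            exact WithTop.coe_le_coe.2 (Fin.castSucc_le_castSucc_iff.1 h)

@[simp]
lemma collapseLast_coe_castSucc {n : ℕ} (i : Fin n) :
    collapseLast n ((i.castSucc : Fin (n + 1)) : WithTop (Fin (n + 1))) = (i : WithTop (Fin n)) :=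
  Fin.snoc_castSucc (α := fun _ => WithTop (Fin n)) ⊤
    (fun i : Fin n => (i : WithTop (Fin n))) i

@[simp]
lemma collapseLast_coe_last (n : ℕ) :
    collapseLast n ((Fin.last n : Fin (n + 1)) : WithTop (Fin (n + 1))) = ⊤ :=
  Fin.snoc_last (α := fun _ => WithTop (Fin n)) ⊤
    (fun i : Fin n => (i : WithTop (Fin n)))

/-- The functor `[p] ↦ [p + 1]`, where monotone maps are extended to the last elements. -/
def decalage : SimplexCategory ⥤ SimplexCategory where
  obj n := SimplexCategory.mk (n.len + 1)
  map f := SimplexCategory.Hom.mk (snocOrderHom (SimplexCategory.Hom.toOrderHom f))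
  map_id n := SimplexCategory.Hom.ext _ _ (OrderHom.ext _ _ (funext fun i => by
    induction i using Fin.lastCases with
    | last => exact snocOrderHom_last _
    | cast i => exact snocOrderHom_castSucc _ _))
  map_comp f g := SimplexCategory.Hom.ext _ _ (OrderHom.ext _ _ (funext fun i => by
    change snocOrderHom _ i = snocOrderHom _ (snocOrderHom _ i)
    induction i using Fin.lastCases with
    | last => simp
    | cast i =>
      simp only [snocOrderHom_castSucc]
      rfl))

namespace PointedSimplexCategory

lemma hom_ext {X Y : PointedSimplexCategory} {f g : X ⟶ Y}
    (h : ∀ i : Fin X.card, Hom.toOrderHom f i = Hom.toOrderHom g i) : f = g :=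
  Hom.ext (OrderHom.ext _ _ (funext fun x => by
    induction x with
    | none => exact f.map_top.trans g.map_top.symm
    | some i => exact h i))

/-- Naturality of `decalageIncl`: the extended map keeps the last vertex last, so it may be
collapsed before or after. -/
lemma collapseLast_snocOrderHom {m n : ℕ} (f : Fin m →o Fin n) (i : Fin (m + 1)) :
    collapseLast n ((snocOrderHom f i : Fin (n + 1)) : WithTop (Fin (n + 1))) =
      f.withTopMap (collapseLast m (i : WithTop (Fin (m + 1)))) := by
  induction i using Fin.lastCases with
  | last =>
    rw [snocOrderHom_last, collapseLast_coe_last, collapseLast_coe_last]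
    rfl
  | cast i =>
    rw [snocOrderHom_castSucc, collapseLast_coe_castSucc, collapseLast_coe_castSucc]
    rfl

/-- The natural transformation `[p + 1]_* ⟶ [p]_*` which sends the last vertex to the
base point. -/
def decalageIncl : decalage ⋙ incl ⟶ incl where
  app n := { toOrderHom := collapseLast (n.len + 1), map_top := rfl }
  naturality _ _ f := hom_ext fun i =>
    collapseLast_snocOrderHom (SimplexCategory.Hom.toOrderHom f) i

end PointedSimplexCategory

/-- The map `[p] ⟶ [p + 1]` which misses the last element. -/
def toDecalage (n : SimplexCategory) : n ⟶ decalage.obj n :=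
  SimplexCategory.Hom.mk (Fin.castSuccOrderEmb).toOrderHom

/-- The map `[0] ⟶ [p + 1]` whose value is the last element. -/
def lastDecalage (n : SimplexCategory) : SimplexCategory.mk 0 ⟶ decalage.obj n :=
  SimplexCategory.Hom.mk ⟨fun _ => Fin.last _, fun _ _ _ => le_rfl⟩

open PointedSimplexCategory in
-- The contraction is the extra degeneracy available in Δ_*. The composite [p] ⟶ [p+1]_* ⟶ [p]_*
-- restricts to the identity on vertices, while the last vertex [0] ⟶ [p+1] goes to the base point,
-- so that composite factors through [-1]_*.
theorem Sect.exists_isEquivalence_lift_hoOfInitial_incl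
    (F : Diagram.{v, u} PointedSimplexCategory) (hF : HasProjectiveModelStructure (F.restrict incl)) :
    ∃ h, ((IsCartesian (F.restrict incl)).lift
      (hoOfInitial F incl isInitialBase) h).IsEquivalence := by
  refine exists_isEquivalence_lift_hoOfInitial F isInitialBase hF (E := decalage)
    decalageIncl toDecalage (fun {m n} g => ?_) (fun n => ?_) (r := SimplexCategory.mk 0)
    { toOrderHom := ⟨fun _ => ⊤, fun _ _ _ => le_rfl⟩, map_top := rfl } lastDecalage
    (fun {m n} g => ?_) (fun n => ?_)
  · refine SimplexCategory.Hom.ext _ _ (OrderHom.ext _ _ (funext fun i => ?_))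
    exact (snocOrderHom_castSucc _ i).symm
  · exact PointedSimplexCategory.hom_ext fun i => collapseLast_coe_castSucc i
  · refine SimplexCategory.Hom.ext _ _ (OrderHom.ext _ _ (funext fun i => ?_))
    exact snocOrderHom_last _
  · exact PointedSimplexCategory.hom_ext fun i => collapseLast_coe_last _

end HoSect

theorem mainTheorem9 :
    (∀ F : Diagram.{v, u} PointedSimplexCategory,
      Sect.HasProjectiveModelStructure (F.restrict PointedSimplexCategory.incl) →
      ∃ h : ∀ c, Sect.IsCartesian (F.restrict PointedSimplexCategory.incl)
          ((Sect.hoOfInitial F PointedSimplexCategory.incl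
            PointedSimplexCategory.isInitialBase).obj c),
        ((Sect.IsCartesian (F.restrict PointedSimplexCategory.incl)).lift
          (Sect.hoOfInitial F PointedSimplexCategory.incl
            PointedSimplexCategory.isInitialBase) h).IsEquivalence) ∧
    (∀ F : Diagram.{v, u} (SimplexCategory × SimplexCategory),
      Sect.HasProjectiveModelStructure F →
      Sect.HasProjectiveModelStructure (F.restrict (Functor.diag SimplexCategory)) →
      ∃ h : ∀ x : Sect.HoCart F, Sect.IsCartesian (F.restrict (Functor.diag SimplexCategory))
          (((Sect.IsCartesian F).ι ⋙
            Sect.hoPullback F (Functor.diag SimplexCategory)).obj x),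
        ((Sect.IsCartesian (F.restrict (Functor.diag SimplexCategory))).lift
          ((Sect.IsCartesian F).ι ⋙ Sect.hoPullback F (Functor.diag SimplexCategory))
          h).IsEquivalence) :=
  ⟨fun F hF => Sect.exists_isEquivalence_lift_hoOfInitial_incl F hF,
    fun F hF hF' => Sect.exists_isEquivalence_lift_hoPullback_diag F hF hF'⟩
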